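/- **Setting.** Let $\mathbb H$ be the quaternions, $\mathbb C_I=\mathbb R+\mathbb RI$ for $I\in\mathbb H$ with $I^2=-1$, and let $\mathbb S_+$ be the hemisphere of imaginary units $I=\cos\phi\,\mathbf i+\sin\phi\cos\psi\,\mathbf j+\sin\phi\sin\psi\,\mathbf k$, $\phi,\psi\in(0,\pi)$, with normalized area measure $d\sigma(I)=\frac1{2\pi}\sin\phi\,d\phi\,d\psi$. Let $\mu$ be the Gaussian measure on $\mathbb H$ given by $d\mu(x+Iy)=e^{-x^2-y^2}\,dx\,dy\,d\sigma(I)$, $(x,y)\in\mathbb R^2$, $I\in\mathbb S_+$; $L^2_{\mathbb H}=L^2(\mathbb H,\mathbb H;\mu)$ with $\langle f,g\rangle=\int\overline f g\,d\mu$; and $$\mathcal C_{\mathbb H}f(q)=\frac1\pi\int_{\mathbb H}\mathcal N(q,p)f(p)\,d\mu(p),\qquad \mathcal N(q,p)=\big((q-\bar p)^{-1}q(q-\bar p)-p\big)^{-1}.$$ For integers $m,n\ge0$ put $$H^Q_{m,n}(q,\bar q)=\sum_{\ell=0}^{\min(m,n)}(-1)^\ell\,\ell!\binom m\ell\binom n\ell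 q^{m-\ell}\bar q^{\,n-\ell},\qquad H^Q_{-1,n}(q,\bar q)=-\frac{\bar q^{\,n+1}}{n+1}\,{}_1F_1(1;n+2;|q|^2).$$ Let $\mathcal F^2_{k,slice}$ be the space of all functions $f(q)=\sum_{m\ge0}H^Q_{m,k}(q,\bar q)\alpha_m$ on $\mathbb H$ with $\alpha_m\in\mathbb H$, $\sum_m m!|\alpha_m|^2<\infty$. Let $\mathcal K_k(q,p)=\sum_m\frac{1}{\pi m!k!}H^Q_{m,k}(q,\bar q)\overline{H^Q_{m,k}(p,\bar p)}$, and let $P_kf(q)=\langle\mathcal K_k(\cdot,q),f\rangle$ be the $k$-th Bergman projection. The left star product $\star^q_{sp}$ of functions $\sum_j\bar q^{\,j}\sum_n q^n c_{n,j}$ (finite in $j$) is the convolution of coefficients: $(q^a\bar q^{\,b}c)\star^q_{sp}(q^{a'}\bar q^{\,b'}c')=q^{a+a'}\bar q^{\,b+b'}cc'$. Let $e_*^{[q,\bar p]}=\sum_n q^n\bar p^{\,n}/n!$ and $H^\star_{m,n}(q-p,\bar q-\bar p)=\sum_{\ell}(-1)^\ell\ell!\binom m\ell\binom n\ell(q-p)^{\star(m-\ell)}\star^q_{sp}(\bar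 q-\bar p)^{\star(n-\ell)}$. A function on $\mathbb H$ is left slice regular if it is real differentiable and $\frac12(\partial_x+I\partial_y)f(x+Iy)=0$ on every $\mathbb C_I$, and left slice polyregular of order $n$ if it is $\sum_{j<n}\bar q^{\,j}f_j(q)$ with left slice regular $f_j$. **Theorem.** Let $k\ge0$ be an integer. The series defining $\mathcal K_k(q,p)$ and $$\mathcal R_k(q,p)=\sum_{m=0}^\infty\frac{1}{\pi m!k!}H^Q_{m,k}(q,\bar q)\,H^Q_{k-1,m}(p,\bar p)\,e^{-|p|^2}$$ converge absolutely for all $q,p\in\mathbb H$. 1. Let $f\in L^2_{\mathbb H}$. Then the integral $\mathcal C_{\mathbb H}f(q)$ converges absolutely for $\mu$-almost every $q$, $\mathcal C_{\mathbb H}f\in L^2_{\mathbb H}$, $P_k\mathcal C_{\mathbb H}f\in\mathcal F^2_{k,slice}\subset L^2_{\mathbb H}$, and $\mathcal C_{\mathbb H}f-P_k\mathcal C_{\mathbb H}f$ is orthogonal to $\mathcal F^2_{k,slice}$ (so that $P_k\mathcal C_{\mathbb H}f$ is the orthogonal projection of $\mathcal C_{\mathbb H}f$). For every $q\in\mathbb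 H$, with absolutely convergent integrals (the one on the right and the one defining $P_k\mathcal C_{\mathbb H}f(q)$), $$P_k\mathcal C_{\mathbb H}f(q)=\int_{\mathbb H}\mathcal R_k(q,p)f(p)\,d\mu(p).$$ 2. If $k\ge1$, then for all $q,p\in\mathbb H$ $$\mathcal R_k(q,p)=\frac{(-1)^{k-1}}{\pi k!}\,e^{-|p|^2}\;e_*^{[q,\bar p]}\star^q_{sp}H^\star_{k-1,k}(q-p,\bar q-\bar p),$$ the power series in $q$ that occur in the star product being absolutely convergent. Moreover, for every $p\in\mathbb H$ and every imaginary unit $I$ with $p\in\mathbb C_I$, the function $q\mapsto e^{|p|^2}\mathcal R_k(q,p)$ is the unique left slice polyregular function of order $k+1$ on $\mathbb H$ that equals $\frac{(-1)^{k-1}}{\pi k!}e^{q\bar p}H^Q_{k-1,k}(q-p,\bar q-\bar p)$ for all $q\in\mathbb C_I$. -/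

import Mathlib

open MeasureTheory
open scoped Quaternion

namespace SliceCauchy

noncomputable section

/-- The quaternions carry their Borel σ-algebra. -/
instance quaternionMeasurableSpace : MeasurableSpace ℍ[ℝ] := borel ℍ[ℝ]

instance quaternionBorelSpace : BorelSpace ℍ[ℝ] := ⟨rfl⟩

/-! ### The Gaussian slice measure -/

/-- The imaginary unit `cos φ i + sin φ cos ψ j + sin φ sin ψ k`; for `φ, ψ ∈ (0, π)` these run
through the open hemisphere of imaginary units with positive `k`-component. -/
def unitDir (φ ψ : ℝ) : ℍ[ℝ] :=
  ⟨0, Real.cos φ, Real.sin φ * Real.cos ψ, Real.sin φ * Real.sin ψ⟩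

/-- The surface measure `sin φ dφ dψ` of the hemisphere in the angles `(φ, ψ) ∈ (0, π)²`, divided
by its total mass `2π`, so that the hemisphere has area one. -/
def hemisphereMeasure : Measure (ℝ × ℝ) :=
  (volume.restrict (Set.Ioo 0 Real.pi ×ˢ Set.Ioo 0 Real.pi)).withDensity
    fun a => ENNReal.ofReal (Real.sin a.1 / (2 * Real.pi))

/-- The Gaussian measure `exp (-(x² + y²)) dx dy` of a slice, in the coordinates `(x, y)`. -/
def planeGaussian : Measure (ℝ × ℝ) :=
  volume.withDensity fun z => ENNReal.ofReal (Real.exp (-(z.1 ^ 2 + z.2 ^ 2)))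

/-- The Gaussian measure `dμ(x + I y) = exp (-(x² + y²)) dx dy dσ(I)` on the quaternions, written
in the coordinates `(x, y) ∈ ℝ²` of the slice and `I` in the hemisphere. -/
def gaussMeasure : Measure ℍ[ℝ] :=
  (hemisphereMeasure.prod planeGaussian).map
    fun t => (t.2.1 : ℍ[ℝ]) + t.2.2 • unitDir t.1.1 t.1.2

/-! ### Quaternionic Itô–Hermite polynomials -/

/-- The quaternionic Itô–Hermite polynomial
`H_{m,n}(q, q̄) = ∑_{ℓ ≤ min m n} (-1)^ℓ ℓ! C(m,ℓ) C(n,ℓ) q^{m-ℓ} q̄^{n-ℓ}`. -/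
def itoHermite (m n : ℕ) (q : ℍ[ℝ]) : ℍ[ℝ] :=
  ∑ l ∈ Finset.range (min m n + 1),
    ((-1 : ℝ) ^ l * (l.factorial : ℝ) * (m.choose l : ℝ) * (n.choose l : ℝ)) •
      (q ^ (m - l) * star q ^ (n - l))

/-- Kummer's confluent hypergeometric function
`₁F₁(a; c; x) = Γ(c)/Γ(a) ∑_j Γ(a+j)/Γ(c+j) x^j/j!` (used for `a, c > 0` only). -/
def kummer (a c x : ℝ) : ℝ :=
  Real.Gamma c / Real.Gamma a *
    ∑' j : ℕ, Real.Gamma (a + j) / Real.Gamma (c + j) * (x ^ j / (j.factorial : ℝ))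

/-- The Hermite function `H_{k-1,n}(q, q̄)`, where for `k = 0`
`H_{-1,n}(q, q̄) = - q̄^{n+1}/(n+1) ₁F₁(1; n+2; |q|²)`. -/
def itoHermitePred : ℕ → ℕ → ℍ[ℝ] → ℍ[ℝ]
  | 0, n, q => (-(kummer 1 ((n : ℝ) + 2) (‖q‖ ^ 2)) / ((n : ℝ) + 1)) • star q ^ (n + 1)
  | k + 1, n, q => itoHermite k n q

/-! ### The Cauchy transform, the Bargmann spaces and the Bergman projections -/

/-- The Cauchy kernel `N(q, p) = ((q - p̄)⁻¹ q (q - p̄) - p)⁻¹`. -/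
def cauchyKernel (q p : ℍ[ℝ]) : ℍ[ℝ] :=
  ((q - star p)⁻¹ * q * (q - star p) - p)⁻¹

/-- The weighted quaternionic Cauchy transform `C f(q) = (1/π) ∫ N(q, p) f(p) dμ(p)`. -/
def cauchyTransform (f : ℍ[ℝ] → ℍ[ℝ]) (q : ℍ[ℝ]) : ℍ[ℝ] :=
  (1 / Real.pi) • ∫ p, cauchyKernel q p * f p ∂gaussMeasure

/-- The `k`-th S-polyregular Bargmann space of the second kind: the functions
`f(q) = ∑_m H_{m,k}(q, q̄) α_m` on the quaternions with `∑_m m! |α_m|² < ∞`. -/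
def bargmannSpace (k : ℕ) : Set (ℍ[ℝ] → ℍ[ℝ]) :=
  {f | ∃ α : ℕ → ℍ[ℝ], Summable (fun m => (m.factorial : ℝ) * ‖α m‖ ^ 2) ∧
    ∀ q, HasSum (fun m => itoHermite m k q * α m) (f q)}

/-- The terms of the series of the reproducing kernel of the `k`-th Bargmann space. -/
def bargmannKernelTerm (k : ℕ) (q p : ℍ[ℝ]) (m : ℕ) : ℍ[ℝ] :=
  (1 / (Real.pi * (m.factorial : ℝ) * (k.factorial : ℝ))) •
    (itoHermite m k q * star (itoHermite m k p))

/-- The reproducing kernel `K_k(q, p) = ∑_m H_{m,k}(q, q̄) conj(H_{m,k}(p, p̄)) / (π m! k!)`. -/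
def bargmannKernel (k : ℕ) (q p : ℍ[ℝ]) : ℍ[ℝ] :=
  ∑' m, bargmannKernelTerm k q p m

/-- The `k`-th Bergman projection `P_k f(q) = ⟨K_k(·, q), f⟩ = ∫ conj(K_k(p, q)) f(p) dμ(p)`. -/
def bergmanProj (k : ℕ) (f : ℍ[ℝ] → ℍ[ℝ]) (q : ℍ[ℝ]) : ℍ[ℝ] :=
  ∫ p, star (bargmannKernel k p q) * f p ∂gaussMeasure

/-- The terms of the series of the kernel `R_k`. -/
def projKernelTerm (k : ℕ) (q p : ℍ[ℝ]) (m : ℕ) : ℍ[ℝ] :=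
  (Real.exp (-‖p‖ ^ 2) / (Real.pi * (m.factorial : ℝ) * (k.factorial : ℝ))) •
    (itoHermite m k q * itoHermitePred k m p)

/-- The kernel
`R_k(q, p) = ∑_m H_{m,k}(q, q̄) H_{k-1,m}(p, p̄) exp (-|p|²) / (π m! k!)`. -/
def projKernel (k : ℕ) (q p : ℍ[ℝ]) : ℍ[ℝ] :=
  ∑' m, projKernelTerm k q p m

/-! ### The star product of S-polyregular functions

A polynomial `∑_j Y^j F_j` in a central variable `Y`, whose coefficients `F_j = ∑_n X^n c_{n,j}` are
power series in a central variable `X`, stands for the function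
`q ↦ ∑_j q̄^j (∑_n q^n c_{n,j})`, with all coefficients to the right of the powers of `q` and `q̄`.
The star product of such functions is the convolution of their coefficients,
`(q^a q̄^b c) ⋆ (q^a' q̄^b' c') = q^(a+a') q̄^(b+b') c c'`, that is the product in the ring
`ℍ⟦X⟧[Y]`. -/

/-- Coefficients of S-polyregular functions, with the star product as multiplication. -/
abbrev SliceSeries : Type := Polynomial (PowerSeries ℍ[ℝ])

/-- All series `∑_n q^n c_{n,j}` converge (absolutely) at `q`. -/
def SliceSeries.ConvergesAt (F : SliceSeries) (q : ℍ[ℝ]) : Prop :=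
  ∀ j : ℕ, Summable fun n : ℕ => q ^ n * PowerSeries.coeff n (Polynomial.coeff F j)

/-- The value `∑_j q̄^j ∑_n q^n c_{n,j}` at `q`. -/
def SliceSeries.value (F : SliceSeries) (q : ℍ[ℝ]) : ℍ[ℝ] :=
  ∑ j ∈ Polynomial.support F,
    star q ^ j * ∑' n : ℕ, q ^ n * PowerSeries.coeff n (Polynomial.coeff F j)

/-- The function `q ↦ q`. -/
def varQ : SliceSeries := Polynomial.C PowerSeries.X

/-- The function `q ↦ q̄`. -/
def varQbar : SliceSeries := Polynomial.X

/-- The constant function with value `c`. -/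
def constS (c : ℍ[ℝ]) : SliceSeries := Polynomial.C (PowerSeries.C c)

/-- The star exponential `e_*^{[q, b]} = ∑_n q^n b^n / n!`, as a function of `q`. -/
def starExp (b : ℍ[ℝ]) : SliceSeries :=
  Polynomial.C (PowerSeries.mk fun n => (1 / (n.factorial : ℝ)) • b ^ n)

/-- The star polynomial
`H^⋆_{m,n}(q-p, q̄-p̄) = ∑_ℓ (-1)^ℓ ℓ! C(m,ℓ) C(n,ℓ) (q-p)^{⋆(m-ℓ)} ⋆ (q̄-p̄)^{⋆(n-ℓ)}`,
as a function of `q`. -/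
def starHermite (m n : ℕ) (p : ℍ[ℝ]) : SliceSeries :=
  ∑ l ∈ Finset.range (min m n + 1),
    ((-1 : ℤ) ^ l * (l.factorial : ℤ) * (m.choose l : ℤ) * (n.choose l : ℤ)) •
      ((varQ - constS p) ^ (m - l) * (varQbar - constS (star p)) ^ (n - l))

/-! ### Slice regular and slice polyregular functions -/

/-- The slice `ℂ_I = ℝ + ℝ I`. -/
def slicePlane (I : ℍ[ℝ]) : Set ℍ[ℝ] :=
  {q | ∃ x y : ℝ, q = (x : ℍ[ℝ]) + y • I}

/-- Left slice regular functions on the quaternions: real differentiable functions whose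
restriction to every slice satisfies `½ (∂/∂x + I ∂/∂y) f(x + y I) = 0`. -/
def IsLeftSliceRegular (f : ℍ[ℝ] → ℍ[ℝ]) : Prop :=
  Differentiable ℝ f ∧ ∀ I : ℍ[ℝ], I * I = -1 → ∀ x y : ℝ,
    (1 / 2 : ℝ) • (deriv (fun s : ℝ => f ((s : ℍ[ℝ]) + y • I)) x +
      I * deriv (fun t : ℝ => f ((x : ℍ[ℝ]) + t • I)) y) = 0

/-- Left slice polyregular functions of order `n`: the functions `∑_{j < n} q̄^j f_j(q)` with
left slice regular `f_j`. -/
def IsLeftSlicePolyregular (n : ℕ) (f : ℍ[ℝ] → ℍ[ℝ]) : Prop :=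
  ∃ F : Fin n → ℍ[ℝ] → ℍ[ℝ], (∀ j, IsLeftSliceRegular (F j)) ∧
    ∀ q, f q = ∑ j : Fin n, star q ^ (j : ℕ) * F j q

/-- The complex closed form
`(-1)^{k-1} / (π k!) exp(q p̄) H_{k-1,k}(q - p, q̄ - p̄)` (for commuting `q` and `p`). -/
def sliceClosedForm (k : ℕ) (p q : ℍ[ℝ]) : ℍ[ℝ] :=
  ((-1 : ℝ) ^ (k - 1) / (Real.pi * (k.factorial : ℝ))) •
    (NormedSpace.exp (q * star p) * itoHermite (k - 1) k (q - p))

end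

end SliceCauchy

open SliceCauchy

open scoped ENNReal

namespace SliceCauchy

noncomputable section

/-! ### The complex Itô–Hermite polynomials -/

/-- The complex Itô–Hermite polynomial `H_{m,n}(z, z̄)`. -/
def complexHermite (m n : ℕ) (z : ℂ) : ℂ :=
  ∑ l ∈ Finset.range (min m n + 1),
    ((-1 : ℝ) ^ l * (l.factorial : ℝ) * (m.choose l : ℝ) * (n.choose l : ℝ)) •
      (z ^ (m - l) * star z ^ (n - l))

lemma complexHermite_eq_sum_range (m n : ℕ) (z : ℂ) : complexHermite m n z =
    ∑ l ∈ Finset.range (n + 1),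
      ((-1 : ℝ) ^ l * (l.factorial : ℝ) * (m.choose l : ℝ) * (n.choose l : ℝ)) •
        (z ^ (m - l) * star z ^ (n - l)) := by
  refine Finset.sum_subset (fun l hl => ?_) fun l hl hl' => ?_
  · simp only [Finset.mem_range] at *; omega
  · simp only [Finset.mem_range] at *
    have : m < l := by omega
    simp [Nat.choose_eq_zero_of_lt this]

lemma star_complexHermite (m n : ℕ) (z : ℂ) :
    star (complexHermite m n z) = complexHermite n m z := by
  simp only [complexHermite, star_sum, min_comm n m]
  refine Finset.sum_congr rfl fun l _ => ?_
  rw [star_smul, star_mul (z ^ _), star_pow, star_pow, star_star, star_trivial]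
  congr 1
  ring

lemma complexHermite_star (m n : ℕ) (z : ℂ) :
    complexHermite m n (star z) = complexHermite n m z := by
  simp only [complexHermite, min_comm n m, star_star]
  refine Finset.sum_congr rfl fun l _ => ?_
  rw [mul_comm (z ^ _)]
  congr 1
  ring

@[simp] lemma complexHermite_zero_right (m : ℕ) (z : ℂ) : complexHermite m 0 z = z ^ m := by
  simp [complexHermite]

@[simp] lemma complexHermite_zero_left (n : ℕ) (z : ℂ) :
    complexHermite 0 n z = star z ^ n := by
  simp [complexHermite]

lemma complexHermite_succ_left (m n : ℕ) (z : ℂ) :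
    complexHermite (m + 1) n z =
      z * complexHermite m n z - n * complexHermite m (n - 1) z := by
  rcases n with _ | n
  · simp [pow_succ']
  rw [complexHermite_eq_sum_range, complexHermite_eq_sum_range m (n + 1),
    complexHermite_eq_sum_range m (n + 1 - 1), Finset.sum_range_succ', Finset.sum_range_succ' _ (n + 1),
    mul_add, Finset.mul_sum, Finset.mul_sum, add_sub_right_comm, Nat.add_sub_cancel,
    ← Finset.sum_sub_distrib]
  congr 1
  · refine Finset.sum_congr rfl fun l _ => ?_
    have h1 : ((l + 1).factorial : ℂ) * ((n + 1).choose (l + 1) : ℂ) =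
        (n + 1) * (l.factorial * (n.choose l : ℂ)) := by
      have := Nat.add_one_mul_choose_eq n l
      rw [Nat.factorial_succ]
      have h : ((n : ℂ) + 1) * (n.choose l) = ((n + 1).choose (l + 1)) * (l + 1) := by
        exact_mod_cast this
      push_cast
      linear_combination (-(l.factorial : ℂ)) * h
    have h2 : (m.choose (l + 1) : ℂ) * (z * z ^ (m - (l + 1))) =
        m.choose (l + 1) * z ^ (m - l) := by
      rcases Nat.lt_or_ge m (l + 1) with h | h
      · simp [Nat.choose_eq_zero_of_lt h]
      · rw [← pow_succ']; congr 2; omega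
    simp only [Complex.real_smul, Nat.choose_succ_succ m l, Nat.add_sub_add_right]
    push_cast
    linear_combination (-1) ^ (l + 1) * (m.choose l : ℂ) * z ^ (m - l) * star z ^ (n - l) * h1
      - (-1) ^ (l + 1) * ((l + 1).factorial : ℂ) * ((n + 1).choose (l + 1) : ℂ) *
        star z ^ (n - l) * h2
  · simp [pow_succ']
    ring

lemma complexHermite_succ_right (m n : ℕ) (z : ℂ) :
    complexHermite m (n + 1) z =
      star z * complexHermite m n z - m * complexHermite (m - 1) n z := by
  rw [← star_complexHermite, complexHermite_succ_left, star_sub, star_mul', star_mul',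
    star_complexHermite, star_complexHermite]
  simp

/-- The real linear map `v ↦ a v + b v̄`. -/
def wirtinger (a b : ℂ) : ℂ →L[ℝ] ℂ :=
  a • (1 : ℂ →L[ℝ] ℂ) + b • (Complex.conjCLE : ℂ →L[ℝ] ℂ)

lemma wirtinger_apply (a b v : ℂ) : wirtinger a b v = a * v + b * star v := by
  simp [wirtinger]

lemma hasFDerivAt_complexHermite (m n : ℕ) (z : ℂ) :
    HasFDerivAt (complexHermite m n) (wirtinger (m * complexHermite (m - 1) n z)
      (n * complexHermite m (n - 1) z)) z := by
  have hstar : HasFDerivAt (fun z : ℂ => star z) (wirtinger 0 1) z := by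
    have := (Complex.conjCLE : ℂ →L[ℝ] ℂ).hasFDerivAt (x := z)
    convert! this using 1
    refine ContinuousLinearMap.ext fun v => ?_
    simp [wirtinger_apply]
  have hid : HasFDerivAt (fun z : ℂ => z) (wirtinger 1 0) z := by
    convert! hasFDerivAt_id (𝕜 := ℝ) z using 1
    refine ContinuousLinearMap.ext fun v => ?_
    simp [wirtinger_apply]
  induction m generalizing n with
  | zero =>
    have : complexHermite 0 n = fun z => star z ^ n := by ext; simp
    rw [this]
    refine (hstar.pow n).congr_fderiv ?_
    refine ContinuousLinearMap.ext fun v => ?_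
    simp [wirtinger_apply]
  | succ m ih =>
    have : complexHermite (m + 1) n =
        fun z => z * complexHermite m n z - (n : ℂ) * complexHermite m (n - 1) z := by
      ext; rw [complexHermite_succ_left]
    rw [this]
    refine ((hid.mul (ih n)).sub ((ih (n - 1)).const_mul (n : ℂ))).congr_fderiv ?_
    refine ContinuousLinearMap.ext fun v => ?_
    simp only [sub_apply, add_apply, smul_apply, wirtinger_apply, smul_eq_mul, Nat.add_sub_cancel]
    rw [complexHermite_succ_left m (n - 1)]
    have h1 : (m : ℂ) * (z * complexHermite (m - 1) n z - n * complexHermite (m - 1) (n - 1) z)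
        = m * complexHermite m n z := by
      rcases m with _ | m
      · simp
      · rw [Nat.add_sub_cancel, complexHermite_succ_left m n]
    push_cast
    linear_combination v * h1

lemma continuous_complexHermite (m n : ℕ) : Continuous (complexHermite m n) :=
  continuous_iff_continuousAt.2 fun z => (hasFDerivAt_complexHermite m n z).continuousAt

lemma norm_complexHermite_le_mul_pow (m n : ℕ) :
    ∃ C : ℝ, 0 ≤ C ∧ ∀ z, ‖complexHermite m n z‖ ≤ C * (1 + ‖z‖) ^ (m + n) := by
  refine ⟨∑ l ∈ Finset.range (min m n + 1),
    ‖((-1 : ℝ) ^ l * (l.factorial : ℝ) * (m.choose l : ℝ) * (n.choose l : ℝ))‖,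
    by positivity, fun z => ?_⟩
  rw [Finset.sum_mul]
  refine norm_sum_le_of_le _ fun l _ => ?_
  rw [norm_smul, norm_mul (z ^ _), norm_pow, norm_pow, norm_star, ← pow_add]
  refine mul_le_mul_of_nonneg_left ?_ (norm_nonneg _)
  have h0 := norm_nonneg z
  calc ‖z‖ ^ (m - l + (n - l)) ≤ (1 + ‖z‖) ^ (m - l + (n - l)) := by gcongr; linarith
    _ ≤ _ := pow_le_pow_right₀ (by linarith) (by omega)

/-- A Gaussian absorbs every polynomial. -/
lemma exists_one_add_pow_mul_exp_le (N : ℕ) :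
    ∃ C : ℝ, 0 ≤ C ∧ ∀ t : ℝ, 0 ≤ t → (1 + t) ^ N * Real.exp (-t ^ 2) ≤ C := by
  refine ⟨N.factorial * Real.exp 2, by positivity, fun t ht => ?_⟩
  have h1 : (1 + t) ^ N ≤ N.factorial * Real.exp (1 + t) := by
    have := Real.pow_div_factorial_le_exp (1 + t) (by linarith) N
    rwa [div_le_iff₀ (by positivity), mul_comm] at this
  calc (1 + t) ^ N * Real.exp (-t ^ 2)
      ≤ N.factorial * Real.exp (1 + t) * Real.exp (-t ^ 2) := by gcongr
    _ = N.factorial * Real.exp (1 + t - t ^ 2) := by rw [mul_assoc, ← Real.exp_add]; ring_nf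
    _ ≤ _ := by gcongr; nlinarith [sq_nonneg (t - 1 / 2)]

lemma exists_norm_complexHermite_mul_exp_le (m n N : ℕ) :
    ∃ C : ℝ, 0 ≤ C ∧ ∀ z, ‖complexHermite m n z‖ * Real.exp (-‖z‖ ^ 2) ≤ C / (1 + ‖z‖) ^ N := by
  obtain ⟨C, hC, h⟩ := norm_complexHermite_le_mul_pow m n
  obtain ⟨D, hD, h'⟩ := exists_one_add_pow_mul_exp_le (m + n + N)
  refine ⟨C * D, by positivity, fun z => ?_⟩
  have h0 := norm_nonneg z
  rw [le_div_iff₀ (by positivity)]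
  calc ‖complexHermite m n z‖ * Real.exp (-‖z‖ ^ 2) * (1 + ‖z‖) ^ N
      ≤ C * (1 + ‖z‖) ^ (m + n) * Real.exp (-‖z‖ ^ 2) * (1 + ‖z‖) ^ N := by gcongr; exact h z
    _ = C * ((1 + ‖z‖) ^ (m + n + N) * Real.exp (-‖z‖ ^ 2)) := by ring
    _ ≤ _ := by gcongr; exact h' _ h0

/-! ### Growth in the first index -/

lemma norm_sum_hermite_le (m n : ℕ) (t : ℝ) (ht : 0 ≤ t) :
    ∑ l ∈ Finset.range (min m n + 1),
      ((l.factorial : ℝ) * (m.choose l : ℝ) * (n.choose l : ℝ)) * (t ^ (m - l) * t ^ (n - l)) ≤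
    (2 ^ n * n.factorial * (1 + t) ^ n * Real.exp 1) * (Real.exp 1 * (1 + t)) ^ m := by
  have h1 : ∀ l ∈ Finset.range (min m n + 1),
      ((l.factorial : ℝ) * (m.choose l : ℝ) * (n.choose l : ℝ)) * (t ^ (m - l) * t ^ (n - l)) ≤
      (n.choose l : ℝ) * ((n.factorial * Real.exp (m + 1)) * (1 + t) ^ (m + n)) := by
    intro l hl
    have hl' : l ≤ n := by simp only [Finset.mem_range] at hl; omega
    have ha : (l.factorial : ℝ) * m.choose l ≤ n.factorial * Real.exp (m + 1) := by
      have h2 : (l.factorial : ℝ) * m.choose l ≤ ((m : ℝ) + 1) ^ n := by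
        have h3 : l.factorial * m.choose l ≤ m ^ l := by
          rw [← Nat.descFactorial_eq_factorial_mul_choose]; exact Nat.descFactorial_le_pow m l
        calc (l.factorial : ℝ) * m.choose l ≤ (m : ℝ) ^ l := by exact_mod_cast h3
          _ ≤ ((m : ℝ) + 1) ^ l := by gcongr; linarith
          _ ≤ _ := pow_le_pow_right₀ (by linarith [(Nat.cast_nonneg m : (0 : ℝ) ≤ m)]) hl'
      have := Real.pow_div_factorial_le_exp ((m : ℝ) + 1) (by positivity) n
      rw [div_le_iff₀ (by positivity), mul_comm] at this
      exact h2.trans this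
    have hb : t ^ (m - l) * t ^ (n - l) ≤ (1 + t) ^ (m + n) := by
      rw [← pow_add]
      calc t ^ (m - l + (n - l)) ≤ (1 + t) ^ (m - l + (n - l)) := by gcongr; linarith
        _ ≤ _ := pow_le_pow_right₀ (by linarith) (by omega)
    calc _ = (n.choose l : ℝ) * (((l.factorial : ℝ) * m.choose l) * (t ^ (m - l) * t ^ (n - l))) := by
          ring
      _ ≤ _ := by gcongr
  refine (Finset.sum_le_sum h1).trans ?_
  rw [← Finset.sum_mul]
  have h2 : ∑ l ∈ Finset.range (min m n + 1), (n.choose l : ℝ) ≤ 2 ^ n := by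
    have := Nat.sum_range_choose n
    calc ∑ l ∈ Finset.range (min m n + 1), (n.choose l : ℝ)
        ≤ ∑ l ∈ Finset.range (n + 1), (n.choose l : ℝ) :=
          Finset.sum_le_sum_of_subset_of_nonneg
            (Finset.range_mono (by omega)) fun _ _ _ => by positivity
      _ = 2 ^ n := by exact_mod_cast this
  calc _ ≤ (2 : ℝ) ^ n * ((n.factorial * Real.exp (m + 1)) * (1 + t) ^ (m + n)) := by gcongr
    _ = _ := by
      rw [Real.exp_add, mul_pow, pow_add, ← Real.exp_nat_mul, mul_one]; ring

/-- `H_{m,n}` grows at most geometrically in `m`. -/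
lemma norm_itoHermite_le (m n : ℕ) (q : ℍ[ℝ]) : ‖itoHermite m n q‖ ≤
    (2 ^ n * n.factorial * (1 + ‖q‖) ^ n * Real.exp 1) * (Real.exp 1 * (1 + ‖q‖)) ^ m := by
  refine le_trans (norm_sum_le_of_le _ fun l _ => ?_) (norm_sum_hermite_le m n ‖q‖ (norm_nonneg q))
  rw [norm_smul, norm_mul (q ^ _), norm_pow q, norm_pow (star q), Quaternion.norm_star]
  simp

/-! ### The incomplete Gamma function and Kummer's function -/

/-- The function `∫₀¹ s^m e^{-ts} ds = t^{-m-1} γ(m+1, t)`. -/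
def gammaQuot (m : ℕ) (t : ℝ) : ℝ := ∫ s in (0 : ℝ)..1, s ^ m * Real.exp (-(t * s))

lemma hasDerivAt_gammaQuot (m : ℕ) (t : ℝ) :
    HasDerivAt (gammaQuot m) (-gammaQuot (m + 1) t) t := by
  have h := intervalIntegral.hasDerivAt_integral_of_dominated_loc_of_deriv_le (μ := volume)
    (𝕜 := ℝ) (a := 0) (b := 1) (x₀ := t) (s := Metric.ball t 1)
    (F := fun t s : ℝ => s ^ m * Real.exp (-(t * s)))
    (F' := fun t s : ℝ => s ^ m * (Real.exp (-(t * s)) * (-s)))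
    (bound := fun _ => Real.exp (|t| + 1)) (Metric.ball_mem_nhds t one_pos)
    (Filter.Eventually.of_forall fun x => (by fun_prop : Continuous fun s : ℝ =>
      s ^ m * Real.exp (-(x * s))).aestronglyMeasurable)
    ((by fun_prop : Continuous fun s : ℝ => s ^ m * Real.exp (-(t * s))).intervalIntegrable _ _)
    ((by fun_prop : Continuous fun s : ℝ =>
      s ^ m * (Real.exp (-(t * s)) * (-s))).aestronglyMeasurable)
    (Filter.Eventually.of_forall fun s hs x hx => ?_) (by simp)
    (Filter.Eventually.of_forall fun s hs x hx => ?_)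
  · refine h.2.congr_deriv ?_
    rw [gammaQuot, ← intervalIntegral.integral_neg]
    congr 1
    ext s
    ring
  · rw [Set.uIoc_of_le zero_le_one] at hs
    have hs0 := hs.1.le
    have hx' : |x| ≤ |t| + 1 := by
      have h1 : |x - t| < 1 := by simpa [Real.dist_eq] using hx
      have h2 := abs_add_le (x - t) t
      rw [sub_add_cancel] at h2
      linarith
    rw [norm_mul, norm_mul, norm_neg, norm_pow, Real.norm_of_nonneg hs0, Real.norm_of_nonneg
      (Real.exp_pos _).le]
    have h1 : Real.exp (-(x * s)) ≤ Real.exp (|t| + 1) := by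
      apply Real.exp_le_exp.2
      have : |x * s| ≤ |x| * 1 := by
        rw [abs_mul, abs_of_nonneg hs0]; gcongr; exact hs.2
      linarith [neg_abs_le (x * s)]
    have h2 : s ^ m ≤ 1 := pow_le_one₀ hs0 hs.2
    calc s ^ m * (Real.exp (-(x * s)) * s) ≤ 1 * (Real.exp (|t| + 1) * 1) := by
          gcongr; exact hs.2
      _ = _ := by ring
  · have : HasDerivAt (fun x : ℝ => -(x * s)) (-s) x := by
      simpa using ((hasDerivAt_id x).mul_const s).fun_neg
    exact (this.exp.const_mul (s ^ m))

lemma mul_gammaQuot_succ (m : ℕ) (t : ℝ) :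
    t * gammaQuot (m + 1) t = (m + 1) * gammaQuot m t - Real.exp (-t) := by
  have h : ∫ s in (0 : ℝ)..1, ((m + 1) * (s ^ m * Real.exp (-(t * s))) -
      t * (s ^ (m + 1) * Real.exp (-(t * s)))) =
      (1 : ℝ) ^ (m + 1) * Real.exp (-(t * 1)) - (0 : ℝ) ^ (m + 1) * Real.exp (-(t * 0)) := by
    refine intervalIntegral.integral_eq_sub_of_hasDerivAt
      (f := fun s => s ^ (m + 1) * Real.exp (-(t * s))) (fun s _ => ?_)
      (Continuous.intervalIntegrable (by fun_prop) _ _)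
    have h1 : HasDerivAt (fun s : ℝ => -(t * s)) (-t) s := by
      simpa using ((hasDerivAt_id s).const_mul t).fun_neg
    refine ((hasDerivAt_pow (m + 1) s).mul h1.exp).congr_deriv ?_
    rw [Nat.add_sub_cancel]
    push_cast
    ring
  rw [intervalIntegral.integral_sub (Continuous.intervalIntegrable (by fun_prop) _ _)
    (Continuous.intervalIntegrable (by fun_prop) _ _), intervalIntegral.integral_const_mul,
    intervalIntegral.integral_const_mul] at h
  simp only [one_pow, one_mul, mul_one, ne_eq, Nat.add_eq_zero_iff, one_ne_zero, and_false,
    not_false_eq_true, zero_pow, zero_mul, sub_zero] at h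
  rw [gammaQuot, gammaQuot]
  linarith

lemma gammaQuot_nonneg (m : ℕ) (t : ℝ) : 0 ≤ gammaQuot m t :=
  intervalIntegral.integral_nonneg zero_le_one fun s hs => by have := hs.1; positivity

lemma gammaQuot_le_one (m : ℕ) {t : ℝ} (ht : 0 ≤ t) : gammaQuot m t ≤ 1 := by
  have h : gammaQuot m t ≤ ∫ _ in (0 : ℝ)..1, (1 : ℝ) := by
    refine intervalIntegral.integral_mono_on zero_le_one
      (Continuous.intervalIntegrable (by fun_prop) _ _) (by simp) fun s hs => ?_
    have h1 : Real.exp (-(t * s)) ≤ 1 := Real.exp_le_one_iff.2 (by nlinarith [hs.1])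
    exact mul_le_one₀ (pow_le_one₀ hs.1 hs.2) (Real.exp_pos _).le h1
  simpa using h

lemma pow_mul_gammaQuot_le (m : ℕ) {t : ℝ} (ht : 0 ≤ t) :
    t ^ (m + 1) * gammaQuot m t ≤ m.factorial := by
  induction m with
  | zero =>
    have h : gammaQuot 0 t * t = 1 - Real.exp (-t) := by
      have h2 : ∫ s in (0 : ℝ)..1, t * Real.exp (-(t * s)) =
          (-Real.exp (-(t * 1))) - (-Real.exp (-(t * 0))) := by
        refine intervalIntegral.integral_eq_sub_of_hasDerivAt
          (f := fun s => -Real.exp (-(t * s))) (fun s _ => ?_)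
          (Continuous.intervalIntegrable (by fun_prop) _ _)
        have h1 : HasDerivAt (fun s : ℝ => -(t * s)) (-t) s := by
          simpa using ((hasDerivAt_id s).const_mul t).fun_neg
        refine h1.exp.neg.congr_deriv (by ring)
      rw [intervalIntegral.integral_const_mul] at h2
      simp only [gammaQuot, pow_zero, one_mul]
      rw [mul_comm, h2]
      simp
      ring
    simp only [zero_add, pow_one, Nat.factorial_zero, Nat.cast_one]
    have := Real.exp_pos (-t)
    linarith
  | succ m ih =>
    have h := mul_gammaQuot_succ m t
    have : t ^ (m + 1 + 1) * gammaQuot (m + 1) t =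
        (m + 1) * (t ^ (m + 1) * gammaQuot m t) - t ^ (m + 1) * Real.exp (-t) := by
      rw [pow_succ, mul_assoc, h]; ring
    rw [this, Nat.factorial_succ]
    push_cast
    have h1 : 0 ≤ t ^ (m + 1) * Real.exp (-t) := by positivity
    nlinarith

lemma kummer_term (m j : ℕ) (x : ℝ) :
    Real.Gamma ((m : ℝ) + 2) / Real.Gamma 1 *
      (Real.Gamma (1 + j) / Real.Gamma ((m : ℝ) + 2 + j) * (x ^ j / (j.factorial : ℝ))) =
    ((m + 1).factorial : ℝ) / ((m + 1 + j).factorial : ℝ) * x ^ j := by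
  have h1 : Real.Gamma ((m : ℝ) + 2) = (m + 1).factorial := by
    rw [← Real.Gamma_nat_eq_factorial]; push_cast; ring_nf
  have h2 : Real.Gamma (1 + (j : ℝ)) = j.factorial := by
    rw [← Real.Gamma_nat_eq_factorial]; ring_nf
  have h3 : Real.Gamma ((m : ℝ) + 2 + j) = (m + 1 + j).factorial := by
    rw [← Real.Gamma_nat_eq_factorial]; push_cast; ring_nf
  rw [h1, h2, h3, Real.Gamma_one]
  have : (j.factorial : ℝ) ≠ 0 := by positivity
  field_simp

lemma exp_mul_gammaQuot_eq_sum (m N : ℕ) (t : ℝ) :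
    Real.exp t * ((m + 1) * gammaQuot m t) =
      ∑ j ∈ Finset.range N, ((m + 1).factorial : ℝ) / ((m + 1 + j).factorial : ℝ) * t ^ j +
      t ^ N * ((m + 1).factorial / (m + N).factorial * (Real.exp t * gammaQuot (m + N) t)) := by
  induction N with
  | zero =>
    rw [Nat.factorial_succ]
    push_cast
    have : (m.factorial : ℝ) ≠ 0 := by positivity
    simp
    field_simp
  | succ N ih =>
    rw [ih, Finset.sum_range_succ, add_assoc]
    congr 1
    have h := mul_gammaQuot_succ (m + N) t
    have h' : gammaQuot (m + N) t =
        (t * gammaQuot (m + (N + 1)) t + Real.exp (-t)) / ((m + N : ℕ) + 1) := by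
      rw [eq_div_iff (by positivity), ← add_assoc, h]; ring
    rw [h', ← add_assoc m N 1, Nat.factorial_succ (m + N), add_right_comm m 1 N,
      Nat.factorial_succ (m + N), Real.exp_neg]
    have := Real.exp_pos t
    push_cast
    field_simp
    ring

/-- Kummer's function `₁F₁(1; m+2; t)` is a normalized incomplete Gamma function. -/
lemma hasSum_kummer (m : ℕ) {t : ℝ} (ht : 0 ≤ t) :
    HasSum (fun j : ℕ => ((m + 1).factorial : ℝ) / ((m + 1 + j).factorial : ℝ) * t ^ j)
      (Real.exp t * ((m + 1) * gammaQuot m t)) := by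
  rw [hasSum_iff_tendsto_nat_of_nonneg (fun j => by positivity)]
  have hrem : Filter.Tendsto (fun N : ℕ => t ^ N * ((m + 1).factorial / (m + N).factorial *
      (Real.exp t * gammaQuot (m + N) t))) Filter.atTop (nhds 0) := by
    have h0 := (FloorSemiring.tendsto_pow_div_factorial_atTop t).const_mul
      ((m + 1).factorial * Real.exp t)
    rw [mul_zero] at h0
    refine squeeze_zero (fun N => ?_) (fun N => ?_) h0
    · have := gammaQuot_nonneg (m + N) t
      positivity
    · have h1 := gammaQuot_nonneg (m + N) t
      have h2 := gammaQuot_le_one (m + N) ht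
      have h3 : (N.factorial : ℝ) ≤ (m + N).factorial := by
        exact_mod_cast Nat.factorial_le (Nat.le_add_left N m)
      calc _ ≤ t ^ N * ((m + 1).factorial / N.factorial * (Real.exp t * 1)) := by gcongr
        _ = _ := by ring
  have := (tendsto_const_nhds (x := Real.exp t * ((m + 1) * gammaQuot m t))).sub hrem
  rw [sub_zero] at this
  refine this.congr fun N => ?_
  rw [exp_mul_gammaQuot_eq_sum m N t]
  ring

lemma kummer_one_eq (m : ℕ) {t : ℝ} (ht : 0 ≤ t) :
    kummer 1 ((m : ℝ) + 2) t = Real.exp t * ((m + 1) * gammaQuot m t) := by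
  rw [kummer, ← tsum_mul_left, ← (hasSum_kummer m ht).tsum_eq]
  exact tsum_congr fun j => kummer_term m j t

/-! ### The primitives `e^{-|z|²} H_{k-1,m}` -/

/-- The function `e^{-|z|²} H_{k-1,m}(z, z̄)`. -/
def gaussHermite : ℕ → ℕ → ℂ → ℂ
  | 0, m, z => -(gammaQuot m (‖z‖ ^ 2) • star z ^ (m + 1))
  | k + 1, m, z => Real.exp (-‖z‖ ^ 2) • complexHermite k m z

lemma hasFDerivAt_comp_norm_sq {f : ℝ → ℝ} {f' : ℝ} {g : ℂ → ℂ} {a b z : ℂ}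
    (hf : HasDerivAt f f' (‖z‖ ^ 2)) (hg : HasFDerivAt g (wirtinger a b) z) :
    HasFDerivAt (fun z => f (‖z‖ ^ 2) • g z)
      (wirtinger (f (‖z‖ ^ 2) * a + f' * star z * g z) (f (‖z‖ ^ 2) * b + f' * z * g z)) z := by
  have h := (hf.comp_hasFDerivAt z (hasStrictFDerivAt_norm_sq (F := ℂ) z).hasFDerivAt).smul hg
  refine h.congr_fderiv (ContinuousLinearMap.ext fun v => ?_)
  have h2 : (2 : ℂ) * ((inner ℝ z v : ℝ) : ℂ) = star z * v + z * star v := by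
    rw [Complex.inner]
    have := Complex.add_conj (star z * v)
    simp only [map_mul] at this
    rw [mul_comm v] at *
    push_cast at this
    simp only [Complex.star_def, Complex.conj_conj] at *
    rw [← this]
  simp only [Function.comp_apply, add_apply, smul_apply, wirtinger_apply,
    ContinuousLinearMap.smulRight_apply, innerSL_apply_apply, smul_eq_mul, Complex.real_smul,
    nsmul_eq_mul]
  push_cast
  linear_combination f' * g z * h2

lemma hasFDerivAt_gaussHermite (k m : ℕ) (z : ℂ) : HasFDerivAt (gaussHermite k m)
    (wirtinger (-gaussHermite k (m + 1) z) (-gaussHermite (k + 1) m z)) z := by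
  have hz : (z : ℂ) * star z = ((‖z‖ ^ 2 : ℝ) : ℂ) := by
    rw [Complex.star_def, Complex.mul_conj, Complex.normSq_eq_norm_sq]
  rcases k with _ | k
  · have h1 : HasFDerivAt (complexHermite 0 (m + 1))
        (wirtinger 0 ((m + 1) * star z ^ m)) z := by
      convert! hasFDerivAt_complexHermite 0 (m + 1) z using 1
      simp
    have h2 := (hasFDerivAt_comp_norm_sq (hasDerivAt_gammaQuot m (‖z‖ ^ 2)) h1).neg
    have e : gaussHermite 0 m = -fun z => gammaQuot m (‖z‖ ^ 2) • complexHermite 0 (m + 1) z := by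
      ext z; simp [gaussHermite]
    rw [e]
    refine h2.congr_fderiv (ContinuousLinearMap.ext fun v => ?_)
    have h3 := congrArg (Complex.ofReal) (mul_gammaQuot_succ m (‖z‖ ^ 2))
    push_cast at h3 hz
    simp only [neg_apply, wirtinger_apply, gaussHermite, complexHermite_zero_left,
      Complex.real_smul]
    push_cast
    linear_combination star v * star z ^ m * h3 +
      star v * star z ^ m * (gammaQuot (m + 1) (‖z‖ ^ 2) : ℂ) * hz
  · have h1 : HasDerivAt (fun t : ℝ => Real.exp (-t)) (-Real.exp (-‖z‖ ^ 2)) (‖z‖ ^ 2) := by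
      simpa using (hasDerivAt_neg (‖z‖ ^ 2)).exp
    have h2 := hasFDerivAt_comp_norm_sq h1 (hasFDerivAt_complexHermite k m z)
    refine h2.congr_fderiv (ContinuousLinearMap.ext fun v => ?_)
    simp only [wirtinger_apply, gaussHermite, Complex.real_smul, complexHermite_succ_left k m,
      complexHermite_succ_right k m]
    push_cast
    ring

lemma continuous_gaussHermite (k m : ℕ) : Continuous (gaussHermite k m) :=
  continuous_iff_continuousAt.2 fun z => (hasFDerivAt_gaussHermite k m z).continuousAt

lemma star_gaussHermite (k m : ℕ) (z : ℂ) :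
    star (gaussHermite k m z) = gaussHermite k m (star z) := by
  rcases k with _ | k
  · simp [gaussHermite]
  · simp only [gaussHermite, star_smul, star_trivial, norm_star, star_complexHermite,
      complexHermite_star]

lemma exists_norm_gaussHermite_le (k m j : ℕ) (hj : j ≤ k + m + 1) :
    ∃ C : ℝ, 0 ≤ C ∧ ∀ z, ‖gaussHermite k m z‖ ≤ C / (1 + ‖z‖) ^ j := by
  rcases k with _ | k
  · refine ⟨2 ^ j * m.factorial, by positivity, fun z => ?_⟩
    have h0 := norm_nonneg z
    rw [le_div_iff₀ (by positivity), gaussHermite, norm_neg, norm_smul, norm_pow, norm_star,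
      Real.norm_of_nonneg (gammaQuot_nonneg _ _)]
    have hg := gammaQuot_nonneg m (‖z‖ ^ 2)
    have hg1 := gammaQuot_le_one m (sq_nonneg ‖z‖)
    have hm : (1 : ℝ) ≤ m.factorial := by exact_mod_cast Nat.factorial_pos m
    rcases le_total ‖z‖ 1 with h | h
    · calc gammaQuot m (‖z‖ ^ 2) * ‖z‖ ^ (m + 1) * (1 + ‖z‖) ^ j ≤ 1 * 1 * 2 ^ j := by
            gcongr
            · exact pow_le_one₀ h0 h
            · linarith
        _ ≤ _ := by rw [one_mul, one_mul]; exact le_mul_of_one_le_right (by positivity) hm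
    · have h1 := pow_mul_gammaQuot_le m (sq_nonneg ‖z‖)
      calc gammaQuot m (‖z‖ ^ 2) * ‖z‖ ^ (m + 1) * (1 + ‖z‖) ^ j
          ≤ gammaQuot m (‖z‖ ^ 2) * ‖z‖ ^ (m + 1) * (2 * ‖z‖) ^ j := by gcongr; linarith
        _ = 2 ^ j * (‖z‖ ^ (m + 1 + j) * gammaQuot m (‖z‖ ^ 2)) := by ring
        _ ≤ 2 ^ j * (‖z‖ ^ (2 * (m + 1)) * gammaQuot m (‖z‖ ^ 2)) := by
            gcongr
            · omega
        _ ≤ _ := by rw [pow_mul]; gcongr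
  · obtain ⟨C, hC, h⟩ := exists_norm_complexHermite_mul_exp_le k m j
    refine ⟨C, hC, fun z => ?_⟩
    rw [gaussHermite, norm_smul, Real.norm_of_nonneg (Real.exp_pos _).le, mul_comm]
    exact h z

/-! ### The Cauchy–Pompeiu formula on the plane -/

lemma integrable_div_one_add_sq (C : ℝ) : Integrable fun r : ℝ => C / (1 + ‖r‖) ^ 2 := by
  have h : Integrable (fun r : ℝ => (1 + ‖r‖) ^ (-(2 : ℝ))) :=
    integrable_one_add_norm (by simp)
  refine (h.const_mul C).congr (Filter.Eventually.of_forall fun r => ?_)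
  have : 0 < 1 + ‖r‖ := by positivity
  simp only [Real.rpow_neg this.le, Real.rpow_ofNat]
  rfl

lemma hasDerivAt_exp_mul_I (t : ℝ) :
    HasDerivAt (fun t : ℝ => Complex.exp (t * Complex.I))
      (Complex.exp (t * Complex.I) * Complex.I) t := by
  have : HasDerivAt (fun t : ℝ => (t : ℂ) * Complex.I) Complex.I t := by
    simpa using (hasDerivAt_id t).ofReal_comp.mul_const Complex.I
  exact this.cexp

lemma star_exp_mul_I (t : ℝ) :
    star (Complex.exp (t * Complex.I)) = Complex.exp (-(t * Complex.I)) := by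
  rw [Complex.star_def, ← Complex.exp_conj]
  simp

lemma cauchyPompeiu_zero {φ a b : ℂ → ℂ} (ha : Continuous a) (hb : Continuous b)
    (hφ : ∀ z, HasFDerivAt φ (wirtinger (a z) (b z)) z) {C : ℝ}
    (hCa : ∀ z, ‖a z‖ ≤ C / (1 + ‖z‖) ^ 2) (hCb : ∀ z, ‖b z‖ ≤ C / (1 + ‖z‖) ^ 2)
    (hlim : Filter.Tendsto φ (Filter.cocompact ℂ) (nhds 0)) :
    ∫ z, b z * z⁻¹ = -(Real.pi * φ 0) := by
  set e : ℝ → ℂ := fun t => Complex.exp (t * Complex.I) with he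
  have hce : Continuous e := by fun_prop
  have hne : ∀ t, ‖e t‖ = 1 := fun t => Complex.norm_exp_ofReal_mul_I t
  have hee : ∀ t, e t * star (e t) = 1 := fun t => by
    simp only [he, star_exp_mul_I, ← Complex.exp_add, add_neg_cancel, Complex.exp_zero]
  set ν : Measure (ℝ × ℝ) := (volume.restrict (Set.Ioi 0)).prod
    (volume.restrict (Set.Ioo (-Real.pi) Real.pi)) with hν
  have hνeq : volume.restrict (polarCoord.target) = ν := by
    rw [polarCoord_target, hν, Measure.prod_restrict]; rfl
  have hpos : ∀ᵐ p ∂ν, 0 < p.1 := by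
    rw [← hνeq]
    refine (ae_restrict_mem polarCoord.open_target.measurableSet).mono fun p hp => ?_
    rw [polarCoord_target] at hp
    exact hp.1
  have hdom : Integrable (fun p : ℝ × ℝ => C / (1 + ‖p.1‖) ^ 2) ν :=
    ((integrable_div_one_add_sq C).restrict).comp_fst _
  have hnorm : ∀ p : ℝ × ℝ, ‖(p.1 : ℂ) * e p.2‖ = ‖p.1‖ := fun p => by
    rw [norm_mul, hne, mul_one, Complex.norm_real]
  have hA : Integrable (fun p : ℝ × ℝ => a (p.1 * e p.2) * e p.2) ν := by
    refine hdom.mono' (by fun_prop) (Filter.Eventually.of_forall fun p => ?_)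
    rw [norm_mul, hne, mul_one, ← hnorm]
    exact hCa _
  have hB : Integrable (fun p : ℝ × ℝ => b (p.1 * e p.2) * star (e p.2)) ν := by
    refine hdom.mono' (by fun_prop) (Filter.Eventually.of_forall fun p => ?_)
    rw [norm_mul, norm_star, hne, mul_one, ← hnorm]
    exact hCb _
  have hpolar : ∫ z, b z * z⁻¹ = ∫ p, b (p.1 * e p.2) * star (e p.2) ∂ν := by
    rw [← Complex.integral_comp_polarCoord_symm, hνeq]
    refine integral_congr_ae (hpos.mono fun p hp => ?_)
    have h1 : Complex.polarCoord.symm p = p.1 * e p.2 := by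
      simp only [he]; rw [Complex.polarCoord_symm_apply, Complex.exp_mul_I]; push_cast; rfl
    have h2 : (e p.2)⁻¹ = star (e p.2) := by
      rw [inv_eq_of_mul_eq_one_right (hee p.2)]
    have h3 : (p.1 : ℂ) ≠ 0 := by exact_mod_cast hp.ne'
    simp only [h1, Complex.real_smul, mul_inv, h2]
    field_simp
  have hradial : ∀ t, ∫ r in Set.Ioi (0 : ℝ), (a (r * e t) * e t + b (r * e t) * star (e t)) =
      -φ 0 := by
    intro t
    have hd : ∀ r ∈ Set.Ici (0 : ℝ), HasDerivAt (fun r : ℝ => φ (r * e t))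
        (a (r * e t) * e t + b (r * e t) * star (e t)) r := by
      intro r _
      have h1 : HasDerivAt (fun r : ℝ => (r : ℂ) * e t) (e t) r := by
        simpa using (hasDerivAt_id r).ofReal_comp.mul_const (e t)
      have := (hφ (r * e t)).comp_hasDerivAt r h1
      rwa [wirtinger_apply] at this
    have hint : IntegrableOn (fun r : ℝ => a (r * e t) * e t + b (r * e t) * star (e t))
        (Set.Ioi 0) := by
      refine (((integrable_div_one_add_sq C).add (integrable_div_one_add_sq C)).mono'
        (by fun_prop) (Filter.Eventually.of_forall fun r => ?_)).integrableOn
      have h1 := hnorm (r, t)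
      refine (norm_add_le _ _).trans ?_
      rw [norm_mul, norm_mul, norm_star, hne, mul_one, mul_one, Pi.add_apply, ← h1]
      exact add_le_add (hCa _) (hCb _)
    have ht : Filter.Tendsto (fun r : ℝ => φ (r * e t)) Filter.atTop (nhds 0) := by
      refine hlim.comp ?_
      rw [← Metric.cobounded_eq_cocompact, ← tendsto_norm_atTop_iff_cobounded]
      refine Filter.tendsto_abs_atTop_atTop.congr fun r => ?_
      rw [hnorm (r, t), Real.norm_eq_abs]
    rw [integral_Ioi_of_hasDerivAt_of_tendsto' hd hint ht]
    simp
  have hangular : ∀ r : ℝ, 0 < r → ∫ t in Set.Ioo (-Real.pi) Real.pi,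
      (b (r * e t) * star (e t) - a (r * e t) * e t) = 0 := by
    intro r hr
    have hr' : (r : ℂ) ≠ 0 := by exact_mod_cast hr.ne'
    rw [← integral_Ioc_eq_integral_Ioo, ← intervalIntegral.integral_of_le
      (by linarith [Real.pi_pos])]
    have hd : ∀ t ∈ Set.uIcc (-Real.pi) Real.pi,
        HasDerivAt (fun t : ℝ => (Complex.I / r) * φ (r * e t))
        (b (r * e t) * star (e t) - a (r * e t) * e t) t := by
      intro t _
      have h1 := (hasDerivAt_exp_mul_I t).const_mul (r : ℂ)
      have h2 := ((hφ (r * e t)).comp_hasDerivAt t h1).const_mul (Complex.I / r)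
      refine h2.congr_deriv ?_
      have hs1 : star (r : ℂ) = r := Complex.conj_ofReal r
      have hs2 : star Complex.I = -Complex.I := Complex.conj_I
      rw [wirtinger_apply, star_mul', star_mul', hs1, hs2]
      change Complex.I / r * (a (r * e t) * (r * (e t * Complex.I)) +
        b (r * e t) * (r * (star (e t) * -Complex.I))) = _
      field_simp
      linear_combination (a (r * e t) * e t - b (r * e t) * star (e t)) * Complex.I_sq
    rw [intervalIntegral.integral_eq_sub_of_hasDerivAt hd
      (Continuous.intervalIntegrable (by fun_prop) _ _)]
    have h1 : e (-Real.pi) = e Real.pi := by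
      simp only [he]
      rw [Complex.exp_pi_mul_I]
      push_cast
      rw [neg_mul, Complex.exp_neg, Complex.exp_pi_mul_I]
      norm_num
    rw [h1, sub_self]
  have h1 : ∫ p, (a (p.1 * e p.2) * e p.2 + b (p.1 * e p.2) * star (e p.2)) ∂ν =
      2 * Real.pi * -φ 0 := by
    rw [hν, integral_prod_symm (fun p : ℝ × ℝ => a (p.1 * e p.2) * e p.2 +
      b (p.1 * e p.2) * star (e p.2)) (hA.add hB)]
    simp only [hradial]
    rw [setIntegral_const]
    simp [Measure.real, Real.volume_Ioo, Real.pi_pos.le]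
    exact Or.inl (by ring)
  have h2 : ∫ p, (b (p.1 * e p.2) * star (e p.2) - a (p.1 * e p.2) * e p.2) ∂ν = 0 := by
    rw [hν, integral_prod (fun p : ℝ × ℝ => b (p.1 * e p.2) * star (e p.2) -
      a (p.1 * e p.2) * e p.2) (hB.sub hA)]
    refine setIntegral_eq_zero_of_forall_eq_zero fun r hr => hangular r hr
  rw [integral_add hA hB] at h1
  rw [integral_sub hB hA] at h2
  rw [hpolar]
  linear_combination (h1 + h2) / 2

/-- The **Cauchy–Pompeiu formula** for functions that vanish at infinity. -/
theorem cauchyPompeiu {φ a b : ℂ → ℂ} (ha : Continuous a) (hb : Continuous b)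
    (hφ : ∀ z, HasFDerivAt φ (wirtinger (a z) (b z)) z) {C : ℝ}
    (hCa : ∀ z, ‖a z‖ ≤ C / (1 + ‖z‖) ^ 2) (hCb : ∀ z, ‖b z‖ ≤ C / (1 + ‖z‖) ^ 2)
    (hlim : Filter.Tendsto φ (Filter.cocompact ℂ) (nhds 0)) (w : ℂ) :
    ∫ z, b z * (z - w)⁻¹ = -(Real.pi * φ w) := by
  have hbound : ∀ c : ℂ → ℂ, (∀ z, ‖c z‖ ≤ C / (1 + ‖z‖) ^ 2) →
      ∀ z, ‖c (z + w)‖ ≤ C * (1 + ‖w‖) ^ 2 / (1 + ‖z‖) ^ 2 := by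
    intro c hc z
    have hC : 0 ≤ C := by
      have := (norm_nonneg _).trans (hc 0)
      simpa using this
    have hz := norm_nonneg z
    have hw := norm_nonneg w
    have hzw := norm_nonneg (z + w)
    refine (hc _).trans ?_
    rw [div_le_div_iff₀ (by positivity) (by positivity), mul_assoc, ← mul_pow]
    have h1 : ‖z‖ ≤ ‖z + w‖ + ‖w‖ := by simpa using norm_sub_le (z + w) w
    gcongr
    nlinarith [mul_nonneg hw hzw]
  have h := cauchyPompeiu_zero (φ := fun z => φ (z + w)) (a := fun z => a (z + w))
    (b := fun z => b (z + w)) (by fun_prop) (by fun_prop)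
    (fun z => (hasFDerivAt_comp_add_right w).2 (hφ (z + w))) (hbound a hCa) (hbound b hCb)
    (hlim.comp (Homeomorph.addRight w).isClosedEmbedding.tendsto_cocompact)
  rw [zero_add] at h
  rw [← h, ← integral_add_right_eq_self (fun z => b z * (z - w)⁻¹) w]
  simp

/-- The planar Cauchy transform of `e^{-|z|²} H_{k,m}` is `e^{-|w|²} H_{k-1,m}`. -/
theorem integral_complexHermite_cauchy (k m : ℕ) (w : ℂ) :
    ∫ z, Real.exp (-‖z‖ ^ 2) • (complexHermite k m z * (z - w)⁻¹) =
      Real.pi * gaussHermite k m w := by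
  obtain ⟨C, hC, hb⟩ := exists_norm_gaussHermite_le k (m + 1) 2 (by omega)
  obtain ⟨D, hD, hd⟩ := exists_norm_gaussHermite_le (k + 1) m 2 (by omega)
  obtain ⟨E, hE, he⟩ := exists_norm_gaussHermite_le k m 1 (by omega)
  have hlim : Filter.Tendsto (gaussHermite k m) (Filter.cocompact ℂ) (nhds 0) := by
    refine squeeze_zero_norm he ?_
    have h1 : Filter.Tendsto (fun z : ℂ => (1 + ‖z‖) ^ 1) (Filter.cocompact ℂ) Filter.atTop := by
      simp only [pow_one]
      exact Filter.tendsto_atTop_add_const_left _ _ (tendsto_norm_cocompact_atTop)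
    exact h1.const_div_atTop E
  have h := cauchyPompeiu (φ := gaussHermite k m)
    (a := fun z => -gaussHermite k (m + 1) z) (b := fun z => -gaussHermite (k + 1) m z)
    (continuous_gaussHermite _ _).neg (continuous_gaussHermite _ _).neg
    (hasFDerivAt_gaussHermite k m) (C := max C D)
    (fun z => by
      rw [norm_neg]; refine (hb z).trans ?_; gcongr; exact le_max_left _ _)
    (fun z => by
      rw [norm_neg]; refine (hd z).trans ?_; gcongr; exact le_max_right _ _) hlim w
  simp only [neg_mul, integral_neg, neg_inj] at h
  rw [← h]
  refine integral_congr_ae (Filter.Eventually.of_forall fun z => ?_)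
  simp only [gaussHermite, smul_mul_assoc]

/-! ### Orthogonality -/

lemma integrable_of_norm_le_div_pow {f : ℂ → ℂ} (hf : Continuous f) {C : ℝ}
    (h : ∀ z, ‖f z‖ ≤ C / (1 + ‖z‖) ^ 4) : Integrable f := by
  have h0 : Integrable (fun r : ℂ => (1 + ‖r‖) ^ (-(4 : ℝ))) :=
    integrable_one_add_norm (by rw [Complex.finrank_real_complex]; norm_num)
  refine (h0.const_mul C).mono' hf.aestronglyMeasurable
    (Filter.Eventually.of_forall fun z => (h z).trans (le_of_eq ?_))
  have : 0 < 1 + ‖z‖ := by positivity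
  rw [Real.rpow_neg this.le, Real.rpow_ofNat]
  rfl

lemma integrable_gaussHermite_mul (k m a b : ℕ) :
    Integrable fun z => gaussHermite (k + 1) m z * complexHermite a b z := by
  obtain ⟨C, hC, h⟩ := norm_complexHermite_le_mul_pow a b
  obtain ⟨D, hD, h'⟩ := exists_norm_complexHermite_mul_exp_le k m (4 + (a + b))
  refine integrable_of_norm_le_div_pow (C := D * C)
    ((continuous_gaussHermite _ _).mul (continuous_complexHermite _ _)) fun z => ?_
  rw [norm_mul, gaussHermite, norm_smul, Real.norm_of_nonneg (Real.exp_pos _).le, mul_comm (Real.exp _)]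
  have h0 : 0 < 1 + ‖z‖ := by positivity
  calc _ ≤ D / (1 + ‖z‖) ^ (4 + (a + b)) * (C * (1 + ‖z‖) ^ (a + b)) := by
        gcongr
        · exact h' z
        · exact h z
    _ = _ := by rw [pow_add]; field_simp

lemma integral_dbar_parts {f g f₁ f₂ g₁ g₂ : ℂ → ℂ}
    (hf : ∀ z, HasFDerivAt f (wirtinger (f₁ z) (f₂ z)) z)
    (hg : ∀ z, HasFDerivAt g (wirtinger (g₁ z) (g₂ z)) z)
    (hfg : Integrable fun z => f z * g z)
    (h1 : Integrable fun z => f₁ z * g z) (h2 : Integrable fun z => f₂ z * g z)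
    (h3 : Integrable fun z => f z * g₁ z) (h4 : Integrable fun z => f z * g₂ z) :
    ∫ z, f z * g₂ z = -∫ z, f₂ z * g z := by
  have key : ∀ v : ℂ, (∫ z, f z * g₁ z) * v + (∫ z, f z * g₂ z) * star v =
      -((∫ z, f₁ z * g z) * v + (∫ z, f₂ z * g z) * star v) := by
    intro v
    have e1 : ∀ z, f z * (wirtinger (g₁ z) (g₂ z) v) = (f z * g₁ z) * v + (f z * g₂ z) * star v :=
      fun z => by rw [wirtinger_apply]; ring
    have e2 : ∀ z, (wirtinger (f₁ z) (f₂ z) v) * g z = (f₁ z * g z) * v + (f₂ z * g z) * star v :=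
      fun z => by rw [wirtinger_apply]; ring
    have i1 := (h3.mul_const v).fun_add (h4.mul_const (star v))
    have i2 := (h1.mul_const v).fun_add (h2.mul_const (star v))
    have := integral_bilinear_hasFDerivAt_right_eq_neg_left_of_integrable (μ := volume)
      (f := f) (g := g) (v := v) (B := ContinuousLinearMap.mul ℝ ℂ)
      (f' := fun z => wirtinger (f₁ z) (f₂ z)) (g' := fun z => wirtinger (g₁ z) (g₂ z))
      (by simpa only [ContinuousLinearMap.mul_apply', e2] using i2)
      (by simpa only [ContinuousLinearMap.mul_apply', e1] using i1)
      (by simpa only [ContinuousLinearMap.mul_apply'] using hfg)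
      (fun z _ => hf z) (fun z _ => hg z)
    simp only [ContinuousLinearMap.mul_apply', e1, e2] at this
    rwa [integral_add (h3.mul_const v) (h4.mul_const _),
      integral_add (h1.mul_const v) (h2.mul_const _), integral_mul_const, integral_mul_const,
      integral_mul_const, integral_mul_const] at this
  have k1 := key 1
  have k2 := key Complex.I
  simp only [star_one, mul_one, Complex.star_def, Complex.conj_I] at k1 k2
  have k3 : ((∫ z, f z * g₂ z) + ∫ z, f₂ z * g z) * 2 = 0 := by
    linear_combination k1 + Complex.I * k2 -
      (-(∫ z, f z * g₂ z) + (∫ z, f z * g₁ z) + (∫ z, f₁ z * g z) - ∫ z, f₂ z * g z) * Complex.I_sq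
  have := (mul_eq_zero.1 k3).resolve_right two_ne_zero
  linear_combination this

lemma integral_hermite_pairing_succ (k m a b : ℕ) :
    ∫ z, gaussHermite (k + 2) m z * complexHermite a b z =
      b * ∫ z, gaussHermite (k + 1) m z * complexHermite a (b - 1) z := by
  have h := integral_dbar_parts (hasFDerivAt_gaussHermite (k + 1) m)
    (hasFDerivAt_complexHermite a b) (integrable_gaussHermite_mul k m a b)
    (by simpa only [neg_mul] using (integrable_gaussHermite_mul k (m + 1) a b).fun_neg)
    (by simpa only [neg_mul] using (integrable_gaussHermite_mul (k + 1) m a b).fun_neg)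
    (by simpa only [mul_left_comm] using
      (integrable_gaussHermite_mul k m (a - 1) b).const_mul (a : ℂ))
    (by simpa only [mul_left_comm] using
      (integrable_gaussHermite_mul k m a (b - 1)).const_mul (b : ℂ))
  simp only [neg_mul, integral_neg, neg_neg] at h
  rw [← h, ← integral_const_mul]
  simp only [mul_left_comm]

lemma integral_hermite_pairing_symm (k m a b : ℕ) :
    ∫ z, gaussHermite (k + 1) m z * complexHermite a b z =
      star (∫ z, gaussHermite (m + 1) k z * complexHermite b a z) := by
  rw [Complex.star_def, ← integral_conj]
  congr 1
  ext z
  rw [map_mul, ← Complex.star_def, star_complexHermite, gaussHermite, gaussHermite, star_smul,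
    star_complexHermite, star_trivial]

lemma integral_gaussian_complex : ∫ z : ℂ, Real.exp (-‖z‖ ^ 2) = Real.pi := by
  have := GaussianFourier.integral_rexp_neg_mul_sq_norm (V := ℂ) (b := 1) one_pos
  simpa [Complex.finrank_real_complex] using this

/-- Orthogonality of the Itô–Hermite polynomials for the Gaussian measure. -/
theorem integral_complexHermite_mul (m n k : ℕ) :
    ∫ z, Real.exp (-‖z‖ ^ 2) • (complexHermite k m z * complexHermite n k z) =
      if m = n then (Real.pi * m.factorial * k.factorial : ℂ) else 0 := by
  have h0 : ∀ m n k, ∫ z, Real.exp (-‖z‖ ^ 2) • (complexHermite k m z * complexHermite n k z) =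
      ∫ z, gaussHermite (k + 1) m z * complexHermite n k z := fun m n k => by
    simp only [gaussHermite, smul_mul_assoc]
  rw [h0]
  have hk : ∫ z, gaussHermite (k + 1) m z * complexHermite n k z =
      k.factorial * ∫ z, gaussHermite 1 m z * complexHermite n 0 z := by
    induction k with
    | zero => simp
    | succ k ih =>
      rw [integral_hermite_pairing_succ, Nat.add_sub_cancel, ih, Nat.factorial_succ]
      push_cast
      ring
  have hm : ∀ m n, ∫ z, gaussHermite 1 m z * complexHermite n 0 z =
      if m = n then (Real.pi * m.factorial : ℂ) else 0 := by
    intro m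
    induction m with
    | zero =>
      intro n
      rcases n with _ | n
      · simp only [gaussHermite, complexHermite_zero_left, pow_zero, Complex.real_smul, mul_one,
          if_true, Nat.factorial_zero, Nat.cast_one]
        rw [show ∫ z : ℂ, (Real.exp (-‖z‖ ^ 2) : ℂ) = Real.pi by
          rw [← integral_gaussian_complex]; exact integral_ofReal]
      · have e : ∀ z, gaussHermite 1 0 z * complexHermite (n + 1) 0 z =
            gaussHermite (n + 2) 0 z * complexHermite 0 0 z := fun z => by
          simp [gaussHermite]
        simp only [e]
        rw [integral_hermite_pairing_succ]
        simp
    | succ m ih =>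
      intro n
      rw [integral_hermite_pairing_symm, integral_hermite_pairing_succ, star_mul',
        ← integral_hermite_pairing_symm]
      rcases n with _ | n
      · simp
      · rw [Nat.add_sub_cancel, ih]
        by_cases h : m = n
        · subst h
          simp [Nat.factorial_succ]
          ring
        · simp [h]
  rw [hk, hm]
  split_ifs <;> ring

/-! ### Slices -/

lemma norm_unit {I : ℍ[ℝ]} (hI : I * I = -1) : ‖I‖ = 1 := by
  have h : ‖I‖ * ‖I‖ = 1 := by rw [← norm_mul, hI, norm_neg, norm_one]
  nlinarith [norm_nonneg I]

lemma star_unit {I : ℍ[ℝ]} (hI : I * I = -1) : star I = -I := by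
  have h0 : I ≠ 0 := by rintro rfl; simp at hI
  have h1 : I * star I = 1 := by
    rw [Quaternion.self_mul_star, Quaternion.normSq_eq_norm_mul_self, norm_unit hI]; simp
  have h2 : I * (star I + I) = 0 := by rw [mul_add, h1, hI]; simp
  exact eq_neg_of_add_eq_zero_left ((mul_eq_zero.1 h2).resolve_left h0)

/-- The embedding of `ℂ` onto the slice `ℂ_I`. -/
def sliceHom (I : ℍ[ℝ]) (hI : I * I = -1) : ℂ →ₐ[ℝ] ℍ[ℝ] := Complex.lift ⟨I, hI⟩

lemma sliceHom_apply {I : ℍ[ℝ]} (hI : I * I = -1) (z : ℂ) :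
    sliceHom I hI z = (z.re : ℍ[ℝ]) + z.im • I := Complex.liftAux_apply I hI z

lemma star_sliceHom {I : ℍ[ℝ]} (hI : I * I = -1) (z : ℂ) :
    star (sliceHom I hI z) = sliceHom I hI (star z) := by
  simp [sliceHom_apply, star_unit hI]

lemma norm_sliceHom {I : ℍ[ℝ]} (hI : I * I = -1) (z : ℂ) : ‖sliceHom I hI z‖ = ‖z‖ := by
  have h : sliceHom I hI z * star (sliceHom I hI z) = sliceHom I hI ((‖z‖ ^ 2 : ℝ) : ℂ) := by
    rw [star_sliceHom, ← map_mul, Complex.star_def, Complex.mul_conj, Complex.normSq_eq_norm_sq]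
  have h2 := congrArg norm h
  rw [norm_mul, norm_star, sliceHom_apply hI ((‖z‖ ^ 2 : ℝ) : ℂ)] at h2
  simp only [Complex.ofReal_re, Complex.ofReal_im, zero_smul, add_zero, Quaternion.norm_coe,
    norm_pow, norm_norm] at h2
  rw [← sq] at h2
  exact (sq_eq_sq₀ (norm_nonneg _) (norm_nonneg _)).1 h2

/-- The embedding of `ℂ` onto the slice `ℂ_I`, as a continuous linear map. -/
def sliceCLM (I : ℍ[ℝ]) (hI : I * I = -1) : ℂ →L[ℝ] ℍ[ℝ] :=
  LinearMap.toContinuousLinearMap (sliceHom I hI).toLinearMap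

@[simp] lemma sliceCLM_apply {I : ℍ[ℝ]} (hI : I * I = -1) (z : ℂ) :
    sliceCLM I hI z = sliceHom I hI z := rfl

lemma sliceHom_ofReal {I : ℍ[ℝ]} (hI : I * I = -1) (x : ℝ) : sliceHom I hI x = x := by
  simp

lemma continuous_sliceHom {I : ℍ[ℝ]} (hI : I * I = -1) : Continuous (sliceHom I hI) :=
  (sliceCLM I hI).continuous

lemma sliceHom_ne_zero {I : ℍ[ℝ]} (hI : I * I = -1) {z : ℂ} (hz : z ≠ 0) :
    sliceHom I hI z ≠ 0 := by
  rwa [ne_eq, map_eq_zero]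

lemma mem_slicePlane_iff {I : ℍ[ℝ]} (hI : I * I = -1) (q : ℍ[ℝ]) :
    q ∈ slicePlane I ↔ ∃ z, q = sliceHom I hI z := by
  constructor
  · rintro ⟨x, y, rfl⟩
    exact ⟨⟨x, y⟩, by rw [sliceHom_apply]⟩
  · rintro ⟨z, rfl⟩
    exact ⟨z.re, z.im, sliceHom_apply hI z⟩

lemma exists_slice (q : ℍ[ℝ]) :
    ∃ (I : ℍ[ℝ]) (hI : I * I = -1) (z : ℂ), q = sliceHom I hI z := by
  by_cases h : q.im = 0
  · obtain ⟨I, hI⟩ : ∃ I : ℍ[ℝ], I * I = -1 :=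
      ⟨((Complex.I : ℂ) : ℍ[ℝ]), by rw [← Quaternion.coeComplex_mul, Complex.I_mul_I]; ext <;> simp⟩
    refine ⟨I, hI, q.re, ?_⟩
    rw [sliceHom_ofReal]
    conv_lhs => rw [← Quaternion.re_add_im q, h, add_zero]
  · have hn : ‖q.im‖ ≠ 0 := norm_ne_zero_iff.2 h
    have hI : (‖q.im‖⁻¹ • q.im) * (‖q.im‖⁻¹ • q.im) = -1 := by
      have h1 : q.im * q.im = -((‖q.im‖ * ‖q.im‖ : ℝ) : ℍ[ℝ]) := by
        rw [← Quaternion.normSq_eq_norm_mul_self, ← Quaternion.self_mul_star, Quaternion.star_im]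
        simp
      rw [smul_mul_smul_comm, h1]
      rw [smul_neg, ← Quaternion.coe_smul, smul_eq_mul]
      field_simp
      simp
    refine ⟨_, hI, ⟨q.re, ‖q.im‖⟩, ?_⟩
    rw [sliceHom_apply, smul_smul, mul_inv_cancel₀ hn, one_smul, Quaternion.re_add_im]

lemma itoHermite_sliceHom {I : ℍ[ℝ]} (hI : I * I = -1) (m n : ℕ) (z : ℂ) :
    itoHermite m n (sliceHom I hI z) = sliceHom I hI (complexHermite m n z) := by
  simp only [itoHermite, complexHermite, map_sum, map_smul, map_mul, map_pow, star_sliceHom]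

lemma star_itoHermite (m n : ℕ) (q : ℍ[ℝ]) : star (itoHermite m n q) = itoHermite n m q := by
  obtain ⟨I, hI, z, rfl⟩ := exists_slice q
  rw [itoHermite_sliceHom, star_sliceHom, star_complexHermite, itoHermite_sliceHom]

lemma continuous_itoHermite (m n : ℕ) : Continuous (itoHermite m n) := by
  unfold itoHermite
  have : Continuous (fun q : ℍ[ℝ] => star q) := continuous_star
  fun_prop

lemma exp_smul_itoHermitePred {I : ℍ[ℝ]} (hI : I * I = -1) (k m : ℕ) (z : ℂ) :
    Real.exp (-‖sliceHom I hI z‖ ^ 2) • itoHermitePred k m (sliceHom I hI z) =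
      sliceHom I hI (gaussHermite k m z) := by
  rw [norm_sliceHom]
  rcases k with _ | k
  · rw [itoHermitePred, gaussHermite, norm_sliceHom, kummer_one_eq m (sq_nonneg _), map_neg,
      map_smul, map_pow, star_sliceHom, smul_smul, ← neg_smul, Real.exp_neg]
    congr 1
    have : (m : ℝ) + 1 ≠ 0 := by positivity
    field_simp
  · rw [itoHermitePred, gaussHermite, map_smul, itoHermite_sliceHom]

/-! ### The Cauchy kernel in slice coordinates -/

lemma norm_half_one_add_mul_le {I J : ℍ[ℝ]} (hI : I * I = -1) (hJ : J * J = -1) :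
    ‖(1 / 2 : ℝ) • (1 - J * I)‖ ≤ 1 ∧ ‖(1 / 2 : ℝ) • (1 + J * I)‖ ≤ 1 := by
  have h : ‖J * I‖ = 1 := by rw [norm_mul, norm_unit hI, norm_unit hJ, one_mul]
  constructor
  · have := norm_sub_le 1 (J * I)
    rw [norm_smul, Real.norm_of_nonneg (by norm_num)]
    rw [h, norm_one] at this
    linarith
  · have := norm_add_le 1 (J * I)
    rw [norm_smul, Real.norm_of_nonneg (by norm_num)]
    rw [h, norm_one] at this
    linarith

/-- The representation formula for the slices of an intrinsic function. -/
lemma sliceHom_representation {I J : ℍ[ℝ]} (hI : I * I = -1) (hJ : J * J = -1) (z : ℂ) :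
    sliceHom J hJ z * ((1 / 2 : ℝ) • (1 - J * I)) +
      sliceHom J hJ (star z) * ((1 / 2 : ℝ) • (1 + J * I)) = sliceHom I hI z := by
  have h : J * (J * I) = -I := by rw [← mul_assoc, hJ, neg_one_mul]
  simp only [sliceHom_apply, Complex.star_def, Complex.conj_re, Complex.conj_im, mul_smul_comm,
    add_mul, Quaternion.coe_mul_eq_smul, mul_sub, mul_add, mul_one, smul_mul_assoc, h, smul_sub, smul_add]
  rw [← mul_one (z.re : ℍ[ℝ]), Quaternion.coe_mul_eq_smul]
  module

lemma cauchyKernel_sliceHom {I J : ℍ[ℝ]} (hI : I * I = -1) (hJ : J * J = -1) {z w : ℂ}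
    (h1 : z ≠ w) (h2 : z ≠ star w) :
    cauchyKernel (sliceHom J hJ z) (sliceHom I hI w) =
      sliceHom J hJ ((z - w)⁻¹) * ((1 / 2 : ℝ) • (1 - J * I)) +
      sliceHom J hJ ((z - star w)⁻¹) * ((1 / 2 : ℝ) • (1 + J * I)) := by
  set a := (1 / 2 : ℝ) • (1 - J * I) with ha
  set b := (1 / 2 : ℝ) • (1 + J * I) with hb
  have hab : a + b = 1 := by rw [ha, hb]; module
  have h1' := sub_ne_zero.2 h1
  have h2' := sub_ne_zero.2 h2
  set P := sliceHom J hJ ((z - w) * (z - star w)) with hP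
  have hP0 : P ≠ 0 := sliceHom_ne_zero hJ (mul_ne_zero h1' h2')
  set q := sliceHom J hJ z with hq
  set p := sliceHom I hI w with hp
  have hw := sliceHom_representation hI hJ w
  have hws := sliceHom_representation hI hJ (star w)
  rw [star_star] at hws
  have hX : q - star p = sliceHom J hJ (z - star w) * a + sliceHom J hJ (z - w) * b := by
    rw [hp, star_sliceHom, ← hws, map_sub, map_sub, sub_mul, sub_mul]
    calc q - _ = q * (a + b) - _ := by rw [hab, mul_one]
      _ = _ := by rw [mul_add]; abel
  have hPX : q * (q - star p) - (q - star p) * p = P := by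
    have e1 : star p + p = sliceHom J hJ (w + star w) := by
      have h3 : w + star w = ((2 * w.re : ℝ) : ℂ) := Complex.add_conj w
      rw [hp, star_sliceHom, ← map_add, add_comm, h3, sliceHom_ofReal, sliceHom_ofReal]
    have e2 : star p * p = sliceHom J hJ (w * star w) := by
      have h3 : w * star w = ((‖w‖ ^ 2 : ℝ) : ℂ) := by
        rw [Complex.star_def, Complex.mul_conj, Complex.normSq_eq_norm_sq]
      rw [hp, star_sliceHom, ← map_mul, mul_comm, h3, sliceHom_ofReal, sliceHom_ofReal]
    calc q * (q - star p) - (q - star p) * p = q * q - q * (star p + p) + star p * p := by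
          noncomm_ring
      _ = P := by
        rw [e1, e2, hP, hq, ← map_mul, ← map_mul, ← map_sub, ← map_add]
        congr 1
        ring
  have hX0 : q - star p ≠ 0 := by
    intro h
    rw [h] at hPX
    exact hP0 (by rw [← hPX]; simp)
  have hN : (q - star p)⁻¹ * q * (q - star p) - p = (q - star p)⁻¹ * P := by
    rw [← hPX, mul_sub (q - star p)⁻¹, ← mul_assoc, ← mul_assoc, inv_mul_cancel₀ hX0, one_mul]
  rw [cauchyKernel, hN, mul_inv_rev, inv_inv, inv_mul_eq_iff_eq_mul₀ hP0, hX, mul_add,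
    ← mul_assoc, ← mul_assoc, hP, ← map_mul, ← map_mul]
  congr 4 <;> field_simp

lemma enorm_cauchyKernel_le {I J : ℍ[ℝ]} (hI : I * I = -1) (hJ : J * J = -1) (z w : ℂ) :
    ‖cauchyKernel (sliceHom J hJ z) (sliceHom I hI w)‖ₑ ≤
      ‖z - w‖ₑ⁻¹ + ‖z - star w‖ₑ⁻¹ := by
  by_cases h1 : z = w
  · simp [h1]
  by_cases h2 : z = star w
  · simp [h2]
  rw [cauchyKernel_sliceHom hI hJ h1 h2, ← enorm_inv (sub_ne_zero.2 h1),
    ← enorm_inv (sub_ne_zero.2 h2)]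
  have key : ∀ (u : ℂ) (c : ℍ[ℝ]), ‖c‖ ≤ 1 → ‖sliceHom J hJ u * c‖ₑ ≤ ‖u‖ₑ := fun u c hc => by
    rw [enorm_le_iff_norm_le, norm_mul, norm_sliceHom]
    exact mul_le_of_le_one_right (norm_nonneg _) hc
  obtain ⟨ha, hb⟩ := norm_half_one_add_mul_le hI hJ
  exact (enorm_add_le _ _).trans (add_le_add (key _ _ ha) (key _ _ hb))

lemma measurable_cauchyKernel : Measurable (Function.uncurry cauchyKernel) := by
  unfold cauchyKernel Function.uncurry
  have : Measurable (fun q : ℍ[ℝ] => star q) := continuous_star.measurable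
  fun_prop

/-! ### The Gaussian slice measure in slice coordinates -/

/-- The Gaussian measure of a slice, on `ℂ`. -/
def complexGaussian : Measure ℂ :=
  volume.withDensity fun z => ENNReal.ofReal (Real.exp (-‖z‖ ^ 2))

lemma measurable_gaussian_density :
    Measurable fun z : ℂ => ENNReal.ofReal (Real.exp (-‖z‖ ^ 2)) := by fun_prop

lemma lintegral_complexGaussian {f : ℂ → ℝ≥0∞} (hf : Measurable f) :
    ∫⁻ z, f z ∂complexGaussian = ∫⁻ z, ENNReal.ofReal (Real.exp (-‖z‖ ^ 2)) * f z :=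
  lintegral_withDensity_eq_lintegral_mul _ measurable_gaussian_density hf

lemma integral_complexGaussian {E : Type*} [NormedAddCommGroup E] [NormedSpace ℝ E] (f : ℂ → E) :
    ∫ z, f z ∂complexGaussian = ∫ z, Real.exp (-‖z‖ ^ 2) • f z := by
  rw [complexGaussian, integral_withDensity_eq_integral_toReal_smul measurable_gaussian_density
    (Filter.Eventually.of_forall fun z => ENNReal.ofReal_lt_top)]
  simp only [ENNReal.toReal_ofReal (Real.exp_pos _).le]

lemma integrable_gaussian : Integrable fun z : ℂ => Real.exp (-‖z‖ ^ 2) := by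
  by_contra h
  have := integral_undef h
  rw [integral_gaussian_complex] at this
  exact Real.pi_ne_zero this

instance : IsFiniteMeasure complexGaussian :=
  isFiniteMeasure_withDensity_ofReal integrable_gaussian.2

lemma planeGaussian_eq_map :
    planeGaussian = complexGaussian.map Complex.measurableEquivRealProd := by
  refine Measure.ext_of_lintegral _ fun f hf => ?_
  have hd : Measurable fun z : ℝ × ℝ => ENNReal.ofReal (Real.exp (-(z.1 ^ 2 + z.2 ^ 2))) := by
    fun_prop
  rw [lintegral_map hf Complex.measurableEquivRealProd.measurable,
    lintegral_complexGaussian (f := fun z => f (Complex.measurableEquivRealProd z))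
      (hf.comp Complex.measurableEquivRealProd.measurable), planeGaussian,
    lintegral_withDensity_eq_lintegral_mul _ hd hf,
    ← Complex.volume_preserving_equiv_real_prod.lintegral_comp (hd.mul hf)]
  refine lintegral_congr fun z => ?_
  simp only [Pi.mul_apply, Complex.measurableEquivRealProd_apply]
  rw [← Complex.normSq_eq_norm_sq, Complex.normSq_apply, sq, sq]

instance : IsProbabilityMeasure hemisphereMeasure := by
  refine ⟨?_⟩
  have hπ := Real.pi_pos
  have hm : MeasurableSet (Set.Ioo 0 Real.pi ×ˢ Set.Ioo 0 Real.pi : Set (ℝ × ℝ)) :=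
    measurableSet_Ioo.prod measurableSet_Ioo
  have hint : IntegrableOn (fun a : ℝ × ℝ => Real.sin a.1 / (2 * Real.pi))
      (Set.Ioo 0 Real.pi ×ˢ Set.Ioo 0 Real.pi) := by
    refine (Continuous.integrableOn_Icc (f := fun a : ℝ × ℝ => Real.sin a.1 / (2 * Real.pi))
      (by fun_prop) (a := (0, 0)) (b := (Real.pi, Real.pi))).mono_set ?_
    rw [← Set.Icc_prod_Icc]
    exact Set.prod_mono Set.Ioo_subset_Icc_self Set.Ioo_subset_Icc_self
  rw [hemisphereMeasure, withDensity_apply _ MeasurableSet.univ, Measure.restrict_univ,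
    ← ofReal_integral_eq_lintegral_ofReal hint]
  · have h1 : ∫ a in Set.Ioo 0 Real.pi ×ˢ Set.Ioo 0 Real.pi, Real.sin a.1 / (2 * Real.pi) =
        (∫ x in Set.Ioo 0 Real.pi, Real.sin x / (2 * Real.pi)) * ∫ x in Set.Ioo 0 Real.pi, 1 := by
      rw [← setIntegral_prod_mul]
      simp only [mul_one]
      rfl
    rw [h1, ← integral_Ioc_eq_integral_Ioo, ← intervalIntegral.integral_of_le hπ.le,
      intervalIntegral.integral_div, integral_sin, setIntegral_const]
    simp [Measure.real, hπ.le]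
    field_simp
    norm_num
  · refine (ae_restrict_mem hm).mono fun a ha => ?_
    have := Real.sin_nonneg_of_nonneg_of_le_pi ha.1.1.le ha.1.2.le
    simp only [Pi.zero_apply]
    positivity

lemma unitDir_mul_self (φ ψ : ℝ) : unitDir φ ψ * unitDir φ ψ = -1 := by
  have h1 := Real.sin_sq_add_cos_sq φ
  have h2 := Real.sin_sq_add_cos_sq ψ
  have e0 : (unitDir φ ψ).re = 0 := rfl
  have e1 : (unitDir φ ψ).imI = Real.cos φ := rfl
  have e2 : (unitDir φ ψ).imJ = Real.sin φ * Real.cos ψ := rfl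
  have e3 : (unitDir φ ψ).imK = Real.sin φ * Real.sin ψ := rfl
  ext
  · simp only [Quaternion.re_mul, e0, e1, e2, e3, Quaternion.re_neg, Quaternion.re_one]
    linear_combination (-Real.sin φ ^ 2) * h2 - h1
  · simp only [Quaternion.imI_mul, e0, e1, e2, e3, Quaternion.imI_neg, Quaternion.imI_one]
    ring
  · simp only [Quaternion.imJ_mul, e0, e1, e2, e3, Quaternion.imJ_neg, Quaternion.imJ_one]
    ring
  · simp only [Quaternion.imK_mul, e0, e1, e2, e3, Quaternion.imK_neg, Quaternion.imK_one]
    ring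

/-- The point of `ℍ` with slice coordinates `(I, z)`. -/
def slicePoint (t : (ℝ × ℝ) × ℂ) : ℍ[ℝ] :=
  sliceHom (unitDir t.1.1 t.1.2) (unitDir_mul_self _ _) t.2

lemma continuous_unitDir : Continuous fun a : ℝ × ℝ => unitDir a.1 a.2 := by
  have h : (fun a : ℝ × ℝ => unitDir a.1 a.2) = fun a => Real.cos a.1 • unitDir 0 0 +
      ((Real.sin a.1 * Real.cos a.2) • unitDir (Real.pi / 2) 0 +
        (Real.sin a.1 * Real.sin a.2) • unitDir (Real.pi / 2) (Real.pi / 2)) := by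
    funext a
    ext <;> simp only [Quaternion.re_add, Quaternion.imI_add, Quaternion.imJ_add,
      Quaternion.imK_add, Quaternion.re_smul, Quaternion.imI_smul, Quaternion.imJ_smul,
      Quaternion.imK_smul] <;> simp [unitDir]
  rw [h]
  fun_prop

lemma continuous_slicePoint : Continuous slicePoint := by
  have h : slicePoint = fun t => (t.2.re : ℍ[ℝ]) + t.2.im • unitDir t.1.1 t.1.2 := by
    funext t
    rw [slicePoint, sliceHom_apply]
  rw [h]
  have h1 := continuous_unitDir.comp (continuous_fst (X := ℝ × ℝ) (Y := ℂ))
  have h2 : Continuous fun t : (ℝ × ℝ) × ℂ => (t.2.re : ℍ[ℝ]) :=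
    Quaternion.continuous_coe.comp (by fun_prop)
  have h3 : Continuous fun t : (ℝ × ℝ) × ℂ => t.2.im := by fun_prop
  exact h2.add (h3.smul h1)

lemma gaussMeasure_eq_map :
    gaussMeasure = (hemisphereMeasure.prod complexGaussian).map slicePoint := by
  have h1 : hemisphereMeasure.prod planeGaussian = (hemisphereMeasure.prod complexGaussian).map
      (Prod.map id Complex.measurableEquivRealProd) := by
    rw [← Measure.map_prod_map _ _ measurable_id Complex.measurableEquivRealProd.measurable,
      Measure.map_id, planeGaussian_eq_map]
  have h2 : Measurable fun t : (ℝ × ℝ) × (ℝ × ℝ) =>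
      (t.2.1 : ℍ[ℝ]) + t.2.2 • unitDir t.1.1 t.1.2 := by
    have h1 := continuous_unitDir.comp (continuous_fst (X := ℝ × ℝ) (Y := ℝ × ℝ))
    have h2 : Continuous fun t : (ℝ × ℝ) × (ℝ × ℝ) => (t.2.1 : ℍ[ℝ]) :=
      Quaternion.continuous_coe.comp (by fun_prop)
    have h3 : Continuous fun t : (ℝ × ℝ) × (ℝ × ℝ) => t.2.2 := by fun_prop
    exact (h2.add (h3.smul h1)).measurable
  rw [gaussMeasure, h1, Measure.map_map h2
    (measurable_id.prodMap Complex.measurableEquivRealProd.measurable)]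
  congr 1

instance : IsFiniteMeasure gaussMeasure := by
  rw [gaussMeasure_eq_map]
  infer_instance

lemma lintegral_gaussMeasure {f : ℍ[ℝ] → ℝ≥0∞} (hf : Measurable f) :
    ∫⁻ q, f q ∂gaussMeasure =
      ∫⁻ a, ∫⁻ z, f (slicePoint (a, z)) ∂complexGaussian ∂hemisphereMeasure := by
  rw [gaussMeasure_eq_map, lintegral_map hf continuous_slicePoint.measurable,
    lintegral_prod (fun t => f (slicePoint t))
      (hf.comp continuous_slicePoint.measurable).aemeasurable]

lemma integral_gaussMeasure {f : ℍ[ℝ] → ℍ[ℝ]} (hf : Integrable f gaussMeasure) :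
    ∫ q, f q ∂gaussMeasure =
      ∫ a, ∫ z, f (slicePoint (a, z)) ∂complexGaussian ∂hemisphereMeasure := by
  rw [gaussMeasure_eq_map] at hf ⊢
  have hm := continuous_slicePoint.measurable.aemeasurable
    (μ := hemisphereMeasure.prod complexGaussian)
  rw [integral_map hm hf.1, integral_prod]
  exact (integrable_map_measure hf.1 hm).1 hf

/-- If the slice integrals do not depend on the slice, they compute the integral. -/
lemma integral_gaussMeasure_eq {f : ℍ[ℝ] → ℍ[ℝ]} (hf : Integrable f gaussMeasure) {c : ℍ[ℝ]}
    (h : ∀ (J : ℍ[ℝ]) (hJ : J * J = -1), ∫ z, f (sliceHom J hJ z) ∂complexGaussian = c) :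
    ∫ q, f q ∂gaussMeasure = c := by
  rw [integral_gaussMeasure hf]
  calc _ = ∫ _, c ∂hemisphereMeasure := by
        congr 1
        funext a
        exact h (unitDir a.1 a.2) (unitDir_mul_self a.1 a.2)
    _ = c := by simp

lemma lintegral_gaussMeasure_le {f : ℍ[ℝ] → ℝ≥0∞} (hf : Measurable f) {c : ℝ≥0∞}
    (h : ∀ (J : ℍ[ℝ]) (hJ : J * J = -1), ∫⁻ z, f (sliceHom J hJ z) ∂complexGaussian ≤ c) :
    ∫⁻ q, f q ∂gaussMeasure ≤ c := by
  rw [lintegral_gaussMeasure hf]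
  calc _ ≤ ∫⁻ _, c ∂hemisphereMeasure := lintegral_mono fun a => h (unitDir a.1 a.2) (unitDir_mul_self a.1 a.2)
    _ = c := by simp

/-! ### Integrals of the Cauchy kernel -/

lemma lintegral_inv_enorm_ball_lt_top :
    ∫⁻ z in Metric.ball (0 : ℂ) 1, ‖z‖ₑ⁻¹ < ∞ := by
  rw [← lintegral_indicator Metric.isOpen_ball.measurableSet,
    ← Complex.lintegral_comp_polarCoord_symm]
  have h : ∀ p ∈ polarCoord.target, ENNReal.ofReal p.1 •
      (Metric.ball (0 : ℂ) 1).indicator (fun z => ‖z‖ₑ⁻¹) (Complex.polarCoord.symm p) ≤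
      (Set.Ioo (0 : ℝ) 1 ×ˢ Set.Ioo (-Real.pi) Real.pi).indicator (fun _ => 1) p := by
    intro p hp
    rw [polarCoord_target] at hp
    have hp1 : 0 < p.1 := hp.1
    have hn : ‖Complex.polarCoord.symm p‖ = p.1 := by
      rw [Complex.norm_polarCoord_symm, abs_of_pos hp1]
    by_cases h1 : p.1 < 1
    · rw [Set.indicator_of_mem (by rwa [mem_ball_zero_iff, hn]),
        Set.indicator_of_mem (show p ∈ Set.Ioo (0 : ℝ) 1 ×ˢ Set.Ioo (-Real.pi) Real.pi from
          ⟨⟨hp1, h1⟩, hp.2⟩), ← ofReal_norm, hn, smul_eq_mul,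
        ENNReal.mul_inv_cancel (by simpa using hp1) ENNReal.ofReal_ne_top]
    · rw [Set.indicator_of_notMem (by rwa [mem_ball_zero_iff, hn])]
      simp
  refine (setLIntegral_mono' polarCoord.open_target.measurableSet h).trans_lt ?_
  refine (setLIntegral_le_lintegral _ _).trans_lt ?_
  rw [lintegral_indicator (measurableSet_Ioo.prod measurableSet_Ioo), setLIntegral_one,
    Measure.volume_eq_prod, Measure.prod_prod]
  simp

lemma lintegral_mul_inv_enorm_sub_le {g : ℂ → ℝ≥0∞} {D : ℝ≥0∞}
    (hD : ∀ z, g z ≤ D) (w : ℂ) :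
    ∫⁻ z, g z * ‖z - w‖ₑ⁻¹ ≤
      D * (∫⁻ z in Metric.ball (0 : ℂ) 1, ‖z‖ₑ⁻¹) + ∫⁻ z, g z := by
  have hm : Measurable fun z : ℂ => (Metric.ball (0 : ℂ) 1).indicator (fun z => ‖z‖ₑ⁻¹) (z - w) :=
    ((by fun_prop : Measurable fun z : ℂ => ‖z‖ₑ⁻¹).indicator
      Metric.isOpen_ball.measurableSet).comp (measurable_id.sub_const w)
  calc ∫⁻ z, g z * ‖z - w‖ₑ⁻¹ ≤
      ∫⁻ z, (D * (Metric.ball (0 : ℂ) 1).indicator (fun z => ‖z‖ₑ⁻¹) (z - w) + g z) := by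
        refine lintegral_mono fun z => ?_
        by_cases h : ‖z - w‖ < 1
        · rw [Set.indicator_of_mem (by simpa using h)]
          exact le_add_right (by gcongr; exact hD z)
        · refine le_add_left ?_
          refine mul_le_of_le_one_right' ?_
          rw [ENNReal.inv_le_one, ← ofReal_norm, ENNReal.one_le_ofReal]
          exact not_lt.1 h
    _ = _ := by
        rw [lintegral_add_left (hm.const_mul D), lintegral_const_mul _ hm,
          lintegral_sub_right_eq_self
            (fun z : ℂ => (Metric.ball (0 : ℂ) 1).indicator (fun z => ‖z‖ₑ⁻¹) z) w,
          lintegral_indicator Metric.isOpen_ball.measurableSet]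

lemma exists_lintegral_hermite_mul_inv_le (k m : ℕ) : ∃ C : ℝ≥0∞, C < ∞ ∧ ∀ w : ℂ,
    ∫⁻ z, ‖complexHermite k m z‖ₑ * ‖z - w‖ₑ⁻¹ ∂complexGaussian ≤ C := by
  obtain ⟨D, hD, h⟩ := exists_norm_complexHermite_mul_exp_le k m 0
  have hc := (continuous_complexHermite k m).measurable
  have hcG := (continuous_gaussHermite (k + 1) m).measurable
  have hI : Integrable (gaussHermite (k + 1) m) := by
    simpa using integrable_gaussHermite_mul k m 0 0
  have he : ∀ z, ENNReal.ofReal (Real.exp (-‖z‖ ^ 2)) * ‖complexHermite k m z‖ₑ =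
      ‖gaussHermite (k + 1) m z‖ₑ := fun z => by
    rw [gaussHermite, enorm_smul, Real.enorm_of_nonneg (Real.exp_pos _).le]
  refine ⟨ENNReal.ofReal D * (∫⁻ z in Metric.ball (0 : ℂ) 1, ‖z‖ₑ⁻¹) +
    ∫⁻ z, ‖gaussHermite (k + 1) m z‖ₑ, ?_, fun w => ?_⟩
  · exact ENNReal.add_lt_top.2 ⟨ENNReal.mul_lt_top ENNReal.ofReal_lt_top
      lintegral_inv_enorm_ball_lt_top, hI.2⟩
  · rw [lintegral_complexGaussian (by fun_prop)]
    simp only [← mul_assoc, he]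
    refine lintegral_mul_inv_enorm_sub_le (fun z => ?_) w
    rw [← ofReal_norm]
    refine ENNReal.ofReal_le_ofReal ?_
    rw [gaussHermite, norm_smul, Real.norm_of_nonneg (Real.exp_pos _).le, mul_comm]
    simpa using h z

lemma exists_lintegral_hermite_mul_cauchyKernel_le (k m : ℕ) : ∃ C : ℝ≥0∞, C < ∞ ∧ ∀ p : ℍ[ℝ],
    ∫⁻ q, ‖itoHermite k m q‖ₑ * ‖cauchyKernel q p‖ₑ ∂gaussMeasure ≤ C := by
  obtain ⟨C, hC, h⟩ := exists_lintegral_hermite_mul_inv_le k m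
  refine ⟨C + C, ENNReal.add_lt_top.2 ⟨hC, hC⟩, fun p => ?_⟩
  obtain ⟨I, hI, w, rfl⟩ := exists_slice p
  have hm := (continuous_itoHermite k m).measurable
  have hc := (continuous_complexHermite k m).measurable
  have hN : Measurable fun q => cauchyKernel q (sliceHom I hI w) :=
    measurable_cauchyKernel.of_uncurry_right
  refine lintegral_gaussMeasure_le (f := fun q => ‖itoHermite k m q‖ₑ *
    ‖cauchyKernel q (sliceHom I hI w)‖ₑ) (hm.enorm.mul hN.enorm) fun J hJ => ?_
  calc _ ≤ ∫⁻ z, (‖complexHermite k m z‖ₑ * ‖z - w‖ₑ⁻¹ +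
        ‖complexHermite k m z‖ₑ * ‖z - star w‖ₑ⁻¹) ∂complexGaussian := by
        refine lintegral_mono fun z => ?_
        rw [itoHermite_sliceHom, ← mul_add]
        gcongr
        · rw [enorm_le_iff_norm_le, norm_sliceHom]
        · exact enorm_cauchyKernel_le hI hJ z w
    _ ≤ _ := by
        rw [lintegral_add_left (by fun_prop)]
        exact add_le_add (h w) (h (star w))

/-- Both families of integrals in the Schur test for the Cauchy kernel are bounded. -/
lemma exists_lintegral_cauchyKernel_le : ∃ C : ℝ≥0∞, C < ∞ ∧
    (∀ p, ∫⁻ q, ‖cauchyKernel q p‖ₑ ∂gaussMeasure ≤ C) ∧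
    (∀ q, ∫⁻ p, ‖cauchyKernel q p‖ₑ ∂gaussMeasure ≤ C) := by
  obtain ⟨C, hC, h⟩ := exists_lintegral_hermite_mul_cauchyKernel_le 0 0
  obtain ⟨D, hD, h'⟩ := exists_lintegral_hermite_mul_inv_le 0 0
  refine ⟨max C (D + D), max_lt hC (ENNReal.add_lt_top.2 ⟨hD, hD⟩),
    fun p => (le_of_eq ?_).trans ((h p).trans (le_max_left _ _)), fun q => ?_⟩
  · simp [itoHermite]
  · refine le_trans ?_ (le_max_right _ _)
    obtain ⟨J, hJ, z, rfl⟩ := exists_slice q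
    have hN : Measurable fun p => cauchyKernel (sliceHom J hJ z) p :=
      measurable_cauchyKernel.of_uncurry_left
    refine lintegral_gaussMeasure_le hN.enorm fun I hI => ?_
    have e1 : ∀ w, ‖z - w‖ₑ = ‖w - z‖ₑ := fun w => by
      rw [← enorm_neg, neg_sub]
    have e2 : ∀ w, ‖z - star w‖ₑ = ‖w - star z‖ₑ := fun w => by
      rw [← enorm_neg, neg_sub, ← ofReal_norm, ← ofReal_norm, ← norm_star, star_sub, star_star]
    calc _ ≤ ∫⁻ w, (‖w - z‖ₑ⁻¹ + ‖w - star z‖ₑ⁻¹) ∂complexGaussian := by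
          refine lintegral_mono fun w => ?_
          rw [← e1, ← e2]
          exact enorm_cauchyKernel_le hI hJ z w
      _ ≤ D + D := by
          rw [lintegral_add_left (by fun_prop)]
          refine add_le_add ((le_of_eq ?_).trans (h' z)) ((le_of_eq ?_).trans (h' (star z))) <;> simp

lemma integrable_hermite_mul_cauchyKernel (k m : ℕ) (p : ℍ[ℝ]) :
    Integrable (fun q => itoHermite k m q * cauchyKernel q p) gaussMeasure := by
  obtain ⟨C, hC, h⟩ := exists_lintegral_hermite_mul_cauchyKernel_le k m
  have hN : Measurable fun q => cauchyKernel q p := measurable_cauchyKernel.of_uncurry_right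
  refine ⟨((continuous_itoHermite k m).measurable.mul hN).aestronglyMeasurable, ?_⟩
  rw [hasFiniteIntegral_iff_enorm]
  simp only [enorm_mul]
  exact (h p).trans_lt hC

lemma integrable_complexHermite_mul_inv (k m : ℕ) (w : ℂ) :
    Integrable (fun z => complexHermite k m z * (z - w)⁻¹) complexGaussian := by
  obtain ⟨C, hC, h⟩ := exists_lintegral_hermite_mul_inv_le k m
  have hc := (continuous_complexHermite k m).measurable
  refine ⟨(by fun_prop : Measurable _).aestronglyMeasurable, ?_⟩
  rw [hasFiniteIntegral_iff_enorm]
  refine (lintegral_mono fun z => ?_).trans_lt ((h w).trans_lt hC)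
  rw [enorm_mul]
  gcongr
  by_cases hz : z - w = 0
  · simp [hz]
  · rw [enorm_inv hz]

/-- The Cauchy kernel pairs the Itô–Hermite polynomials with the Hermite functions. -/
theorem integral_itoHermite_mul_cauchyKernel (k m : ℕ) (p : ℍ[ℝ]) :
    ∫ q, itoHermite k m q * cauchyKernel q p ∂gaussMeasure =
      Real.pi • (Real.exp (-‖p‖ ^ 2) • itoHermitePred k m p) := by
  obtain ⟨I, hI, w, rfl⟩ := exists_slice p
  refine integral_gaussMeasure_eq (integrable_hermite_mul_cauchyKernel k m _) fun J hJ => ?_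
  set a := (1 / 2 : ℝ) • (1 - J * I) with ha
  set b := (1 / 2 : ℝ) • (1 + J * I) with hb
  have hae : ∀ᵐ z ∂complexGaussian, z ≠ w ∧ z ≠ star w := by
    refine (withDensity_absolutelyContinuous _ _).ae_le ?_
    exact (Measure.ae_ne volume w).and (Measure.ae_ne volume (star w))
  have h1 : ∫ z, itoHermite k m (sliceHom J hJ z) *
      cauchyKernel (sliceHom J hJ z) (sliceHom I hI w) ∂complexGaussian =
      ∫ z, (sliceCLM J hJ (complexHermite k m z * (z - w)⁻¹) * a +
        sliceCLM J hJ (complexHermite k m z * (z - star w)⁻¹) * b) ∂complexGaussian := by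
    refine integral_congr_ae (hae.mono fun z hz => ?_)
    simp only [itoHermite_sliceHom, cauchyKernel_sliceHom hI hJ hz.1 hz.2, sliceCLM_apply, map_mul,
      mul_add, mul_assoc]
    rfl
  have hi := fun v => (sliceCLM J hJ).integrable_comp (integrable_complexHermite_mul_inv k m v)
  have h2 : ∀ v, ∫ z, sliceCLM J hJ (complexHermite k m z * (z - v)⁻¹) ∂complexGaussian =
      Real.pi • sliceHom J hJ (gaussHermite k m v) := fun v => by
    rw [ContinuousLinearMap.integral_comp_comm _ (integrable_complexHermite_mul_inv k m v),
      integral_complexGaussian, integral_complexHermite_cauchy, ← Complex.real_smul, map_smul]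
    rfl
  rw [h1, integral_add ((hi w).mul_const a) ((hi (star w)).mul_const b), integral_mul_const_of_integrable (hi w),
    integral_mul_const_of_integrable (hi _), h2, h2, ← star_gaussHermite, smul_mul_assoc, smul_mul_assoc, ← smul_add,
    sliceHom_representation hI hJ, exp_smul_itoHermitePred]

lemma integrable_itoHermite_mul (k m n l : ℕ) :
    Integrable (fun q => itoHermite k m q * itoHermite n l q) gaussMeasure := by
  have hc := (continuous_itoHermite k m)
  have hc' := (continuous_itoHermite n l)
  refine ⟨(hc.mul hc').aestronglyMeasurable, ?_⟩
  rw [hasFiniteIntegral_iff_enorm]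
  refine (lintegral_gaussMeasure_le
    (f := fun q => ‖itoHermite k m q * itoHermite n l q‖ₑ) (hc.mul hc').enorm.measurable
    (c := ∫⁻ z, ‖gaussHermite (k + 1) m z * complexHermite n l z‖ₑ) fun J hJ => le_of_eq ?_).trans_lt
    (hasFiniteIntegral_iff_enorm.1 (integrable_gaussHermite_mul k m n l).2)
  have h1 : ∀ z, ‖itoHermite k m (sliceHom J hJ z) * itoHermite n l (sliceHom J hJ z)‖ₑ =
      ‖complexHermite k m z * complexHermite n l z‖ₑ := fun z => by
    rw [itoHermite_sliceHom, itoHermite_sliceHom, ← map_mul, ← ofReal_norm, norm_sliceHom,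
      ofReal_norm]
  have hd := (continuous_complexHermite k m)
  have hd' := (continuous_complexHermite n l)
  simp only [h1]
  rw [lintegral_complexGaussian (by fun_prop)]
  refine lintegral_congr fun z => ?_
  rw [gaussHermite, smul_mul_assoc, enorm_smul, Real.enorm_of_nonneg (Real.exp_pos _).le]

/-- The Itô–Hermite polynomials are orthogonal in every slice. -/
theorem integral_star_itoHermite_mul (m n k : ℕ) :
    ∫ q, star (itoHermite m k q) * itoHermite n k q ∂gaussMeasure =
      if m = n then ((Real.pi * m.factorial * k.factorial : ℝ) : ℍ[ℝ]) else 0 := by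
  simp only [star_itoHermite]
  refine integral_gaussMeasure_eq (integrable_itoHermite_mul k m n k) fun J hJ => ?_
  have hi : Integrable (fun z => complexHermite k m z * complexHermite n k z) complexGaussian := by
    have hd := (continuous_complexHermite k m)
    have hd' := (continuous_complexHermite n k)
    refine ⟨(hd.mul hd').aestronglyMeasurable, ?_⟩
    rw [hasFiniteIntegral_iff_enorm, lintegral_complexGaussian (by fun_prop)]
    refine lt_of_eq_of_lt (lintegral_congr fun z => ?_)
      (hasFiniteIntegral_iff_enorm.1 (integrable_gaussHermite_mul k m n k).2)
    rw [gaussHermite, smul_mul_assoc, enorm_smul, Real.enorm_of_nonneg (Real.exp_pos _).le]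
  have h1 : ∀ z, itoHermite k m (sliceHom J hJ z) * itoHermite n k (sliceHom J hJ z) =
      sliceCLM J hJ (complexHermite k m z * complexHermite n k z) := fun z => by
    rw [itoHermite_sliceHom, itoHermite_sliceHom, sliceCLM_apply, map_mul]
  simp only [h1]
  rw [ContinuousLinearMap.integral_comp_comm _ hi, integral_complexGaussian,
    integral_complexHermite_mul]
  split_ifs
  · rw [sliceCLM_apply, ← sliceHom_ofReal hJ]
    push_cast
    rfl
  · simp

/-! ### The Schur test -/

lemma lintegral_mul_sq_le {α : Type*} [MeasurableSpace α] {μ : Measure α} {f g : α → ℝ≥0∞}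
    (hf : AEMeasurable f μ) (hg : AEMeasurable g μ) :
    (∫⁻ a, f a * g a ∂μ) ^ 2 ≤ (∫⁻ a, f a ^ 2 ∂μ) * ∫⁻ a, g a ^ 2 ∂μ := by
  have h := ENNReal.lintegral_mul_le_Lp_mul_Lq μ Real.HolderConjugate.two_two hf hg
  simp only [Pi.mul_apply, ENNReal.rpow_two] at h
  refine (pow_le_pow_left' h 2).trans (le_of_eq ?_)
  rw [mul_pow, ← ENNReal.rpow_two, ← ENNReal.rpow_two, ← ENNReal.rpow_mul, ← ENNReal.rpow_mul]
  norm_num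

/-- The **Schur test** with constant weights. -/
lemma lintegral_schur_le {α : Type*} [MeasurableSpace α] {μ : Measure α} [SFinite μ]
    {κ : α → α → ℝ≥0∞} (hκ : Measurable (Function.uncurry κ)) {C : ℝ≥0∞}
    (h1 : ∀ p, ∫⁻ q, κ q p ∂μ ≤ C) (h2 : ∀ q, ∫⁻ p, κ q p ∂μ ≤ C) {f : α → ℝ≥0∞}
    (hf : AEMeasurable f μ) :
    ∫⁻ q, (∫⁻ p, κ q p * f p ∂μ) ^ 2 ∂μ ≤ C ^ 2 * ∫⁻ p, f p ^ 2 ∂μ := by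
  have hpt : ∀ q, (∫⁻ p, κ q p * f p ∂μ) ^ 2 ≤ C * ∫⁻ p, κ q p * f p ^ 2 ∂μ := by
    intro q
    have hκq : Measurable (κ q) := hκ.of_uncurry_left
    have h3 : ∀ x : ℝ≥0∞, x ^ (1 / 2 : ℝ) * x ^ (1 / 2 : ℝ) = x := fun x => by
      rw [← ENNReal.rpow_add_of_nonneg _ _ (by norm_num) (by norm_num)]; norm_num
    have h := lintegral_mul_sq_le (μ := μ) (f := fun p => κ q p ^ (1 / 2 : ℝ))
      (g := fun p => κ q p ^ (1 / 2 : ℝ) * f p) (by fun_prop) (by fun_prop)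
    simp only [← mul_assoc, mul_pow, sq (_ ^ (1 / 2 : ℝ)), h3] at h
    exact h.trans (by gcongr; exact h2 q)
  have hm : AEMeasurable (Function.uncurry fun q p => κ q p * f p ^ 2) (μ.prod μ) :=
    hκ.aemeasurable.mul ((hf.comp_snd (μ := μ)).pow_const 2)
  calc _ ≤ ∫⁻ q, C * ∫⁻ p, κ q p * f p ^ 2 ∂μ ∂μ := lintegral_mono hpt
    _ = C * ∫⁻ p, ∫⁻ q, κ q p * f p ^ 2 ∂μ ∂μ := by
        rw [lintegral_const_mul'' C (f := fun q => ∫⁻ p, κ q p * f p ^ 2 ∂μ)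
          hm.lintegral_prod_right', lintegral_lintegral_swap hm]
    _ ≤ C * ∫⁻ p, C * f p ^ 2 ∂μ := by
        gcongr with p
        rw [lintegral_mul_const _ (hκ.of_uncurry_right)]
        gcongr
        exact h1 p
    _ = _ := by rw [lintegral_const_mul'' _ (hf.pow_const 2)]; ring

lemma memLp_two_iff {α E : Type*} [MeasurableSpace α] {μ : Measure α} [NormedAddCommGroup E]
    {f : α → E} : MemLp f 2 μ ↔ AEStronglyMeasurable f μ ∧ ∫⁻ a, ‖f a‖ₑ ^ 2 ∂μ < ∞ := by
  rw [MemLp, eLpNorm_lt_top_iff_lintegral_rpow_enorm_lt_top two_ne_zero ENNReal.ofNat_ne_top]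
  simp

lemma lintegral_enorm_sq_lt_top {α E : Type*} [MeasurableSpace α] {μ : Measure α}
    [NormedAddCommGroup E] {f : α → E} (hf : MemLp f 2 μ) : ∫⁻ a, ‖f a‖ₑ ^ 2 ∂μ < ∞ :=
  (memLp_two_iff.1 hf).2

variable {f : ℍ[ℝ] → ℍ[ℝ]}

lemma aestronglyMeasurable_cauchyKernel_mul (hf : MemLp f 2 gaussMeasure) :
    AEStronglyMeasurable (fun t : ℍ[ℝ] × ℍ[ℝ] => cauchyKernel t.1 t.2 * f t.2)
      (gaussMeasure.prod gaussMeasure) :=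
  measurable_cauchyKernel.aestronglyMeasurable.mul hf.1.comp_snd

/-- The bound of the Schur test for the weighted Cauchy transform. -/
lemma exists_lintegral_cauchyKernel_mul_le : ∃ C : ℝ≥0∞, C < ∞ ∧ ∀ f : ℍ[ℝ] → ℍ[ℝ],
    MemLp f 2 gaussMeasure →
    ∫⁻ q, (∫⁻ p, ‖cauchyKernel q p‖ₑ * ‖f p‖ₑ ∂gaussMeasure) ^ 2 ∂gaussMeasure ≤
      C * ∫⁻ p, ‖f p‖ₑ ^ 2 ∂gaussMeasure := by
  obtain ⟨C, hC, h1, h2⟩ := exists_lintegral_cauchyKernel_le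
  exact ⟨C ^ 2, ENNReal.pow_lt_top hC, fun f hf =>
    lintegral_schur_le (κ := fun q p => ‖cauchyKernel q p‖ₑ) measurable_cauchyKernel.enorm h1 h2
      hf.1.enorm⟩

lemma ae_integrable_cauchyKernel_mul (hf : MemLp f 2 gaussMeasure) :
    ∀ᵐ q ∂gaussMeasure, Integrable (fun p => cauchyKernel q p * f p) gaussMeasure := by
  obtain ⟨C, hC, h⟩ := exists_lintegral_cauchyKernel_mul_le
  have hm := aestronglyMeasurable_cauchyKernel_mul hf
  have hm2 : AEMeasurable (fun q => ∫⁻ p, ‖cauchyKernel q p‖ₑ * ‖f p‖ₑ ∂gaussMeasure)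
      gaussMeasure := by
    simp only [← enorm_mul]
    exact hm.enorm.lintegral_prod_right'
  have hlt := (h f hf).trans_lt (ENNReal.mul_lt_top hC (lintegral_enorm_sq_lt_top hf))
  filter_upwards [ae_lt_top' (hm2.pow_const 2) hlt.ne] with q hq
  have hN : Measurable fun p => cauchyKernel q p := measurable_cauchyKernel.of_uncurry_left
  refine ⟨hN.aestronglyMeasurable.mul hf.1, ?_⟩
  rw [hasFiniteIntegral_iff_enorm]
  simp only [enorm_mul]
  by_contra hcon
  rw [not_lt_top_iff.1 hcon] at hq
  simp at hq

lemma memLp_cauchyTransform (hf : MemLp f 2 gaussMeasure) :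
    MemLp (cauchyTransform f) 2 gaussMeasure := by
  obtain ⟨C, hC, h⟩ := exists_lintegral_cauchyKernel_mul_le
  have hmem : MemLp (fun q => ∫ p, cauchyKernel q p * f p ∂gaussMeasure) 2 gaussMeasure := ?_
  · exact hmem.const_smul (1 / Real.pi)
  refine memLp_two_iff.2 ⟨(aestronglyMeasurable_cauchyKernel_mul hf).integral_prod_right', ?_⟩
  refine (lintegral_mono fun q => ?_).trans_lt
    ((h f hf).trans_lt (ENNReal.mul_lt_top hC (lintegral_enorm_sq_lt_top hf)))
  refine pow_le_pow_left' ((enorm_integral_le_lintegral_enorm _).trans_eq ?_) 2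
  simp only [enorm_mul]

/-- The bilinear bound for the Cauchy kernel. -/
lemma exists_lintegral_bilinear_cauchyKernel_le : ∃ C : ℝ≥0∞, C < ∞ ∧ ∀ f h : ℍ[ℝ] → ℍ[ℝ],
    MemLp f 2 gaussMeasure → MemLp h 2 gaussMeasure →
    (∫⁻ q, ∫⁻ p, ‖h q * (cauchyKernel q p * f p)‖ₑ ∂gaussMeasure ∂gaussMeasure) ^ 2 ≤
      C * (∫⁻ p, ‖f p‖ₑ ^ 2 ∂gaussMeasure) * ∫⁻ p, ‖h p‖ₑ ^ 2 ∂gaussMeasure := by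
  obtain ⟨C, hC, hb⟩ := exists_lintegral_cauchyKernel_mul_le
  refine ⟨C, hC, fun f h hf hh => ?_⟩
  have hm := aestronglyMeasurable_cauchyKernel_mul hf
  have hm2 : AEMeasurable (fun q => ∫⁻ p, ‖cauchyKernel q p‖ₑ * ‖f p‖ₑ ∂gaussMeasure)
      gaussMeasure := by
    simp only [← enorm_mul]
    exact hm.enorm.lintegral_prod_right'
  have e : ∀ q, ∫⁻ p, ‖h q * (cauchyKernel q p * f p)‖ₑ ∂gaussMeasure =
      ‖h q‖ₑ * ∫⁻ p, ‖cauchyKernel q p‖ₑ * ‖f p‖ₑ ∂gaussMeasure := fun q => by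
    have hN : Measurable fun p => cauchyKernel q p := measurable_cauchyKernel.of_uncurry_left
    rw [← lintegral_const_mul'' _ (f := fun p => ‖cauchyKernel q p‖ₑ * ‖f p‖ₑ)
      (hN.enorm.aemeasurable.mul hf.1.enorm)]
    simp only [enorm_mul]
  simp only [e]
  refine (lintegral_mul_sq_le hh.1.enorm hm2).trans ?_
  rw [mul_comm]
  gcongr
  exact hb f hf

lemma integrable_bilinear_cauchyKernel {h : ℍ[ℝ] → ℍ[ℝ]} (hf : MemLp f 2 gaussMeasure)
    (hh : MemLp h 2 gaussMeasure) :
    Integrable (Function.uncurry fun q p => h q * (cauchyKernel q p * f p))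
      (gaussMeasure.prod gaussMeasure) := by
  obtain ⟨C, hC, hb⟩ := exists_lintegral_bilinear_cauchyKernel_le
  have hm : AEStronglyMeasurable (Function.uncurry fun q p => h q * (cauchyKernel q p * f p))
      (gaussMeasure.prod gaussMeasure) :=
    hh.1.comp_fst.mul (aestronglyMeasurable_cauchyKernel_mul hf)
  refine ⟨hm, ?_⟩
  rw [hasFiniteIntegral_iff_enorm, lintegral_prod _ hm.enorm]
  by_contra hcon
  have h1 := hb f h hf hh
  simp only [Function.uncurry_apply_pair] at hcon
  rw [not_lt_top_iff.1 hcon] at h1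
  have h2 := ENNReal.mul_lt_top (ENNReal.mul_lt_top hC (lintegral_enorm_sq_lt_top hf))
    (lintegral_enorm_sq_lt_top hh)
  simp at h1
  exact h2.ne h1

/-! ### The Itô–Hermite polynomials in `L²` -/

lemma inner_eq_re_star_mul (a b : ℍ[ℝ]) : inner ℝ a b = (star a * b).re := by
  rw [Quaternion.inner_def]
  simp only [Quaternion.re_mul, Quaternion.re_star, Quaternion.imI_star, Quaternion.imJ_star,
    Quaternion.imK_star]
  ring

lemma re_integral {g : ℍ[ℝ] → ℍ[ℝ]} (hg : Integrable g gaussMeasure) :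
    (∫ q, g q ∂gaussMeasure).re = ∫ q, (g q).re ∂gaussMeasure := by
  have h := (innerSL ℝ (1 : ℍ[ℝ])).integral_comp_comm hg
  simpa [inner_eq_re_star_mul] using h.symm

lemma integrable_star_itoHermite_mul (m n k : ℕ) :
    Integrable (fun q => star (itoHermite m k q) * itoHermite n k q) gaussMeasure := by
  simpa only [star_itoHermite] using integrable_itoHermite_mul k m n k

lemma star_mul_self_eq_coe (a : ℍ[ℝ]) : star a * a = ((‖a‖ ^ 2 : ℝ) : ℍ[ℝ]) := by
  rw [Quaternion.star_mul_self, Quaternion.normSq_eq_norm_mul_self, sq]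

lemma integral_norm_sq_itoHermite (m k : ℕ) :
    ∫ q, ‖itoHermite m k q‖ ^ 2 ∂gaussMeasure = Real.pi * m.factorial * k.factorial := by
  have h := congrArg (fun a : ℍ[ℝ] => a.re) (integral_star_itoHermite_mul m m k)
  simp only [if_true] at h
  rw [re_integral (integrable_star_itoHermite_mul m m k), Quaternion.re_coe] at h
  simpa only [star_mul_self_eq_coe, Quaternion.re_coe] using h

lemma lintegral_enorm_sq_itoHermite (m k : ℕ) :
    ∫⁻ q, ‖itoHermite m k q‖ₑ ^ 2 ∂gaussMeasure =
      ENNReal.ofReal (Real.pi * m.factorial * k.factorial) := by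
  have hi : Integrable (fun q => ‖itoHermite m k q‖ ^ 2) gaussMeasure := by
    refine (integrable_star_itoHermite_mul m m k).norm.congr
      (Filter.Eventually.of_forall fun q => ?_)
    simp only [norm_mul, norm_star, sq]
  rw [← integral_norm_sq_itoHermite, ofReal_integral_eq_lintegral_ofReal hi
    (Filter.Eventually.of_forall fun q => by positivity)]
  refine lintegral_congr fun q => ?_
  rw [ENNReal.ofReal_pow (norm_nonneg _), ofReal_norm]

lemma memLp_itoHermite (m k : ℕ) : MemLp (itoHermite m k) 2 gaussMeasure := by
  refine memLp_two_iff.2 ⟨(continuous_itoHermite m k).aestronglyMeasurable, ?_⟩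
  rw [lintegral_enorm_sq_itoHermite]
  exact ENNReal.ofReal_lt_top

/-- The function `H_{k-1,m}(p, p̄) e^{-|p|²}` on the quaternions. -/
def hermiteWeight (k m : ℕ) (p : ℍ[ℝ]) : ℍ[ℝ] := Real.exp (-‖p‖ ^ 2) • itoHermitePred k m p

lemma hermiteWeight_eq (k m : ℕ) (p : ℍ[ℝ]) : hermiteWeight k m p =
    (1 / Real.pi) • ∫ q, star (itoHermite m k q) * cauchyKernel q p ∂gaussMeasure := by
  simp only [star_itoHermite]
  rw [integral_itoHermite_mul_cauchyKernel, smul_smul, one_div, inv_mul_cancel₀ Real.pi_ne_zero,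
    one_smul, hermiteWeight]

lemma memLp_star_itoHermite (m k : ℕ) :
    MemLp (fun q => star (itoHermite m k q)) 2 gaussMeasure := by
  simpa only [star_itoHermite] using memLp_itoHermite k m

/-- The adjoint relation between the Cauchy transform and the Hermite functions. -/
theorem integral_star_itoHermite_mul_cauchyTransform (hf : MemLp f 2 gaussMeasure) (m k : ℕ) :
    ∫ q, star (itoHermite m k q) * cauchyTransform f q ∂gaussMeasure =
      ∫ p, hermiteWeight k m p * f p ∂gaussMeasure := by
  have hi := integrable_bilinear_cauchyKernel hf (memLp_star_itoHermite m k)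
  have h1 : ∀ᵐ q ∂gaussMeasure, star (itoHermite m k q) * cauchyTransform f q =
      (1 / Real.pi) • ∫ p, star (itoHermite m k q) * (cauchyKernel q p * f p) ∂gaussMeasure := by
    filter_upwards [ae_integrable_cauchyKernel_mul hf] with q hq
    rw [integral_const_mul_of_integrable hq, cauchyTransform, mul_smul_comm]
  have hc : ∀ p, Integrable (fun q => star (itoHermite m k q) * cauchyKernel q p) gaussMeasure :=
    fun p => by
      simpa only [star_itoHermite] using integrable_hermite_mul_cauchyKernel k m p
  rw [integral_congr_ae h1, integral_smul, integral_integral_swap hi, ← integral_smul]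
  congr 1
  funext p
  simp only [← mul_assoc]
  rw [integral_mul_const_of_integrable (hc p), hermiteWeight_eq, smul_mul_assoc]

lemma exists_integral_hermiteWeight_mul_le (hf : MemLp f 2 gaussMeasure) (k : ℕ) :
    ∃ K : ℝ, ∀ m, Integrable (fun p => hermiteWeight k m p * f p) gaussMeasure ∧
      ∫ p, ‖hermiteWeight k m p * f p‖ ∂gaussMeasure ≤ K * √(m.factorial : ℝ) := by
  obtain ⟨C, hC, hb⟩ := exists_lintegral_bilinear_cauchyKernel_le
  set A := C * ∫⁻ p, ‖f p‖ₑ ^ 2 ∂gaussMeasure with hA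
  have hA' : A < ∞ := ENNReal.mul_lt_top hC (lintegral_enorm_sq_lt_top hf)
  refine ⟨√(A.toReal * (Real.pi * k.factorial)) / Real.pi, fun m => ?_⟩
  have hmeas : AEStronglyMeasurable (fun p => hermiteWeight k m p * f p) gaussMeasure := by
    refine AEStronglyMeasurable.mul ?_ hf.1
    have h1 : AEStronglyMeasurable (Function.uncurry fun p q =>
        star (itoHermite m k q) * cauchyKernel q p) (gaussMeasure.prod gaussMeasure) :=
      (((continuous_itoHermite m k).star.measurable.comp measurable_snd).mul
        (measurable_cauchyKernel.comp measurable_swap)).aestronglyMeasurable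
    have h2 := h1.integral_prod_right'.const_smul (1 / Real.pi)
    refine h2.congr (Filter.Eventually.of_forall fun p => ?_)
    simp only [hermiteWeight_eq, Pi.smul_apply, Function.uncurry_apply_pair]
  set B := ∫⁻ q, ∫⁻ p, ‖star (itoHermite m k q) * (cauchyKernel q p * f p)‖ₑ ∂gaussMeasure
    ∂gaussMeasure with hB
  have hB2 : B ^ 2 ≤ A * ENNReal.ofReal (Real.pi * m.factorial * k.factorial) := by
    refine (hb f _ hf (memLp_star_itoHermite m k)).trans (le_of_eq ?_)
    have : ∀ q : ℍ[ℝ], ‖star (itoHermite m k q)‖ₑ = ‖itoHermite m k q‖ₑ := fun q => by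
      rw [← ofReal_norm, norm_star, ofReal_norm]
    simp only [this, lintegral_enorm_sq_itoHermite, hA]
  have hB' : B < ∞ := by
    by_contra hcon
    rw [not_lt_top_iff.1 hcon] at hB2
    have h2 := ENNReal.mul_lt_top hA' (ENNReal.ofReal_lt_top (r := Real.pi * m.factorial * k.factorial))
    simp at hB2
    exact h2.ne hB2
  have hle : ∫⁻ p, ‖hermiteWeight k m p * f p‖ₑ ∂gaussMeasure ≤ ENNReal.ofReal (1 / Real.pi) * B := by
    have hi := integrable_bilinear_cauchyKernel hf (memLp_star_itoHermite m k)
    rw [hB, lintegral_lintegral_swap hi.1.enorm, ← lintegral_const_mul' _ _ ENNReal.ofReal_ne_top]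
    refine lintegral_mono fun p => ?_
    have hN : Measurable fun q => cauchyKernel q p := measurable_cauchyKernel.of_uncurry_right
    have hH := (continuous_itoHermite m k).star.measurable
    calc ‖hermiteWeight k m p * f p‖ₑ
        ≤ (ENNReal.ofReal (1 / Real.pi) *
          ∫⁻ q, ‖star (itoHermite m k q) * cauchyKernel q p‖ₑ ∂gaussMeasure) * ‖f p‖ₑ := by
          rw [enorm_mul, hermiteWeight_eq, enorm_smul, Real.enorm_of_nonneg (by positivity)]
          gcongr
          exact enorm_integral_le_lintegral_enorm _
      _ = _ := by
          rw [mul_assoc, ← lintegral_mul_const _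
            (f := fun q => ‖star (itoHermite m k q) * cauchyKernel q p‖ₑ) (hH.mul hN).enorm]
          simp only [← mul_assoc, enorm_mul]
  have hfin : ∫⁻ p, ‖hermiteWeight k m p * f p‖ₑ ∂gaussMeasure < ∞ :=
    hle.trans_lt (ENNReal.mul_lt_top ENNReal.ofReal_lt_top hB')
  refine ⟨⟨hmeas, hasFiniteIntegral_iff_enorm.2 hfin⟩, ?_⟩
  have h1 : ∫ p, ‖hermiteWeight k m p * f p‖ ∂gaussMeasure ≤ 1 / Real.pi * B.toReal := by
    rw [integral_norm_eq_lintegral_enorm hmeas]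
    refine (ENNReal.toReal_mono (ENNReal.mul_lt_top ENNReal.ofReal_lt_top hB').ne hle).trans ?_
    rw [ENNReal.toReal_mul, ENNReal.toReal_ofReal (by positivity)]
  have h2 : B.toReal ≤ √(A.toReal * (Real.pi * k.factorial)) * √(m.factorial : ℝ) := by
    rw [← Real.sqrt_mul (by positivity)]
    refine Real.le_sqrt_of_sq_le ?_
    have := ENNReal.toReal_mono (ENNReal.mul_lt_top hA' ENNReal.ofReal_lt_top).ne hB2
    rw [ENNReal.toReal_pow, ENNReal.toReal_mul, ENNReal.toReal_ofReal (by positivity)] at this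
    refine this.trans (le_of_eq (by ring))
  refine h1.trans ?_
  calc 1 / Real.pi * B.toReal ≤ 1 / Real.pi *
      (√(A.toReal * (Real.pi * k.factorial)) * √(m.factorial : ℝ)) := by gcongr
    _ = _ := by ring

lemma integrable_mul_of_memLp {g h : ℍ[ℝ] → ℍ[ℝ]} (hg : MemLp g 2 gaussMeasure)
    (hh : MemLp h 2 gaussMeasure) : Integrable (fun q => g q * h q) gaussMeasure := by
  refine ⟨hg.1.mul hh.1, ?_⟩
  have h1 := lintegral_mul_sq_le hg.1.enorm hh.1.enorm
  rw [hasFiniteIntegral_iff_enorm]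
  simp only [enorm_mul]
  by_contra hcon
  rw [not_lt_top_iff.1 hcon] at h1
  have h2 := ENNReal.mul_lt_top (lintegral_enorm_sq_lt_top hg) (lintegral_enorm_sq_lt_top hh)
  simp at h1
  exact h2.ne h1

lemma exists_integral_star_itoHermite_mul_le (hf : MemLp f 2 gaussMeasure) (k : ℕ) :
    ∃ K : ℝ, ∀ m, Integrable (fun p => star (itoHermite m k p) * f p) gaussMeasure ∧
      ∫ p, ‖star (itoHermite m k p) * f p‖ ∂gaussMeasure ≤ K * √(m.factorial : ℝ) := by
  set A := ∫⁻ p, ‖f p‖ₑ ^ 2 ∂gaussMeasure with hA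
  have hA' : A < ∞ := lintegral_enorm_sq_lt_top hf
  refine ⟨√(A.toReal * (Real.pi * k.factorial)), fun m => ?_⟩
  have hi := integrable_mul_of_memLp (memLp_star_itoHermite m k) hf
  refine ⟨hi, ?_⟩
  rw [integral_norm_eq_lintegral_enorm hi.1, ← Real.sqrt_mul (by positivity)]
  refine Real.le_sqrt_of_sq_le ?_
  have h1 := lintegral_mul_sq_le (memLp_star_itoHermite m k).1.enorm hf.1.enorm
  have : ∀ q : ℍ[ℝ], ‖star (itoHermite m k q)‖ₑ = ‖itoHermite m k q‖ₑ := fun q => by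
    rw [← ofReal_norm, norm_star, ofReal_norm]
  simp only [this, lintegral_enorm_sq_itoHermite] at h1
  simp only [enorm_mul, this]
  have h2 := ENNReal.toReal_mono (ENNReal.mul_lt_top ENNReal.ofReal_lt_top hA').ne h1
  rw [ENNReal.toReal_pow, ENNReal.toReal_mul, ENNReal.toReal_ofReal (by positivity)] at h2
  refine h2.trans (le_of_eq (by ring))

/-! ### Convergence of the kernels -/

lemma summable_pow_div_sqrt_factorial (a : ℝ) :
    Summable fun m : ℕ => a ^ m / √(m.factorial : ℝ) := by
  have h1 : Summable fun m : ℕ => (1 / 2 : ℝ) ^ m := summable_geometric_two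
  have h2 : Summable fun m : ℕ => (2 * a ^ 2) ^ m / (m.factorial : ℝ) :=
    Real.summable_pow_div_factorial _
  refine Summable.of_norm_bounded (h1.add h2) fun m => ?_
  have hs : 0 < √(m.factorial : ℝ) := Real.sqrt_pos.2 (by positivity)
  set x := |a| ^ m / √(m.factorial : ℝ) with hx
  have e1 : ‖a ^ m / √(m.factorial : ℝ)‖ = x := by
    rw [norm_div, norm_pow, Real.norm_eq_abs, Real.norm_of_nonneg hs.le]
  have e2 : (2 * a ^ 2) ^ m / (m.factorial : ℝ) = 2 ^ m * x ^ 2 := by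
    rw [hx, div_pow, Real.sq_sqrt (by positivity), mul_pow, ← pow_mul, ← pow_mul, mul_comm m 2,
      pow_mul |a|, sq_abs, ← pow_mul]
    ring
  have e3 : (1 / 2 : ℝ) ^ m * 2 ^ m = 1 := by rw [← mul_pow]; norm_num
  rw [e1, e2]
  have h0 : 0 < (1 / 2 : ℝ) ^ m := by positivity
  have h3 : 0 < (2 : ℝ) ^ m := by positivity
  nlinarith [sq_nonneg (2 ^ m * x - 1 / 2), sq_nonneg ((2:ℝ) ^ m * x - 1)]

lemma exists_norm_itoHermite_le (k : ℕ) (q : ℍ[ℝ]) :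
    ∃ B R : ℝ, 0 ≤ B ∧ 0 ≤ R ∧ ∀ m, ‖itoHermite m k q‖ ≤ B * R ^ m :=
  ⟨_, _, by positivity, by positivity, fun m => norm_itoHermite_le m k q⟩

lemma exists_norm_hermiteWeight_le (k : ℕ) (p : ℍ[ℝ]) :
    ∃ B R : ℝ, 0 ≤ B ∧ 0 ≤ R ∧ ∀ m, ‖hermiteWeight k m p‖ ≤ B * R ^ m := by
  rcases k with _ | k
  · obtain ⟨I, hI, z, rfl⟩ := exists_slice p
    refine ⟨‖z‖, ‖z‖, by positivity, by positivity, fun m => ?_⟩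
    rw [hermiteWeight, exp_smul_itoHermitePred, norm_sliceHom, gaussHermite, norm_neg, norm_smul,
      norm_pow, norm_star, Real.norm_of_nonneg (gammaQuot_nonneg _ _), ← pow_succ']
    exact mul_le_of_le_one_left (by positivity) (gammaQuot_le_one m (sq_nonneg _))
  · have h : ∃ B R : ℝ, 0 ≤ B ∧ 0 ≤ R ∧ ∀ m, ‖itoHermite k m p‖ ≤ B * R ^ m := by
      obtain ⟨B, R, hB, hR, h⟩ := exists_norm_itoHermite_le k p
      exact ⟨B, R, hB, hR, fun m => by rw [← star_itoHermite, norm_star]; exact h m⟩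
    obtain ⟨B, R, hB, hR, h⟩ := h
    refine ⟨B, R, hB, hR, fun m => ?_⟩
    rw [hermiteWeight, itoHermitePred, norm_smul, Real.norm_of_nonneg (Real.exp_pos _).le]
    refine (mul_le_of_le_one_left (norm_nonneg _) ?_).trans (h m)
    exact Real.exp_le_one_iff.2 (by nlinarith [sq_nonneg ‖p‖])

/-- The coefficient `1 / (π m! k!)`. -/
def kernelCoeff (k m : ℕ) : ℝ := 1 / (Real.pi * (m.factorial : ℝ) * (k.factorial : ℝ))

lemma kernelCoeff_pos (k m : ℕ) : 0 < kernelCoeff k m := by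
  have := Real.pi_pos
  unfold kernelCoeff
  positivity

lemma kernelCoeff_le (k m : ℕ) : kernelCoeff k m ≤ 1 / (m.factorial : ℝ) := by
  have h1 : (1 : ℝ) ≤ k.factorial := by exact_mod_cast Nat.factorial_pos k
  have h2 : (1 : ℝ) ≤ Real.pi := by linarith [Real.pi_gt_three]
  have h3 : (0 : ℝ) < m.factorial := by positivity
  unfold kernelCoeff
  gcongr
  calc (m.factorial : ℝ) = 1 * m.factorial * 1 := by ring
    _ ≤ _ := by gcongr

lemma summable_kernelCoeff_mul {k : ℕ} (q : ℍ[ℝ]) {b : ℕ → ℍ[ℝ]} {B R : ℝ}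
    (hb : ∀ m, ‖b m‖ ≤ B * R ^ m) :
    Summable fun m => kernelCoeff k m • (itoHermite m k q * b m) := by
  obtain ⟨B', R', hB', hR', h⟩ := exists_norm_itoHermite_le k q
  refine Summable.of_norm_bounded
    ((Real.summable_pow_div_factorial (R' * R)).mul_left (B' * B)) fun m => ?_
  rw [norm_smul, norm_mul, Real.norm_of_nonneg (kernelCoeff_pos k m).le]
  calc _ ≤ 1 / (m.factorial : ℝ) * ((B' * R' ^ m) * (B * R ^ m)) := by
        gcongr
        · exact kernelCoeff_le k m
        · exact h m
        · exact hb m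
    _ = _ := by rw [mul_pow]; ring

lemma star_bargmannKernelTerm (k : ℕ) (q p : ℍ[ℝ]) (m : ℕ) :
    star (bargmannKernelTerm k p q m) =
      kernelCoeff k m • (itoHermite m k q * star (itoHermite m k p)) := by
  rw [bargmannKernelTerm, Quaternion.star_smul, star_mul, star_star, kernelCoeff]

lemma projKernelTerm_eq (k : ℕ) (q p : ℍ[ℝ]) (m : ℕ) :
    projKernelTerm k q p m = kernelCoeff k m • (itoHermite m k q * hermiteWeight k m p) := by
  rw [projKernelTerm, hermiteWeight, mul_smul_comm, smul_smul, kernelCoeff]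
  congr 1
  ring

lemma summable_projKernelTerm (k : ℕ) (q p : ℍ[ℝ]) : Summable (projKernelTerm k q p) := by
  obtain ⟨B, R, hB, hR, h⟩ := exists_norm_hermiteWeight_le k p
  simpa only [← projKernelTerm_eq] using summable_kernelCoeff_mul (k := k) q h

lemma summable_star_bargmannKernelTerm (k : ℕ) (q p : ℍ[ℝ]) :
    Summable fun m => star (bargmannKernelTerm k p q m) := by
  obtain ⟨B, R, hB, hR, h⟩ := exists_norm_itoHermite_le k p
  simpa only [← star_bargmannKernelTerm] using summable_kernelCoeff_mul (k := k) q
    (b := fun m => star (itoHermite m k p)) (fun m => by rw [norm_star]; exact h m)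

lemma summable_bargmannKernelTerm (k : ℕ) (q p : ℍ[ℝ]) : Summable (bargmannKernelTerm k q p) := by
  simpa only [star_star] using (summable_star_bargmannKernelTerm k p q).star

/-! ### Exchange of sums and integrals -/

/-- Termwise integration of a series whose terms are integrable with summable `L¹` norms. -/
lemma integrable_tsum_and_hasSum {g : ℕ → ℍ[ℝ] → ℍ[ℝ]} (hg : ∀ m, Integrable (g m) gaussMeasure)
    (hp : ∀ p, Summable fun m => g m p)
    (hs : Summable fun m => ∫ p, ‖g m p‖ ∂gaussMeasure) :
    Integrable (fun p => ∑' m, g m p) gaussMeasure ∧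
      HasSum (fun m => ∫ p, g m p ∂gaussMeasure) (∫ p, ∑' m, g m p ∂gaussMeasure) := by
  refine ⟨⟨?_, ?_⟩, hasSum_integral_of_summable_integral_norm hg hs⟩
  · refine aestronglyMeasurable_of_tendsto_ae Filter.atTop
      (f := fun n p => ∑ m ∈ Finset.range n, g m p) (fun n => ?_)
      (Filter.Eventually.of_forall fun p => (hp p).hasSum.tendsto_sum_nat)
    exact Finset.aestronglyMeasurable_fun_sum _ fun m _ => (hg m).1
  · rw [hasFiniteIntegral_iff_enorm]
    calc _ ≤ ∫⁻ p, ∑' m, ‖g m p‖ₑ ∂gaussMeasure :=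
          lintegral_mono fun p => enorm_tsum_le_tsum_enorm
      _ = ∑' m, ∫⁻ p, ‖g m p‖ₑ ∂gaussMeasure := lintegral_tsum fun m => (hg m).1.enorm
      _ = ∑' m, ENNReal.ofReal (∫ p, ‖g m p‖ ∂gaussMeasure) := by
          congr 1
          funext m
          rw [ofReal_integral_norm_eq_lintegral_enorm (hg m)]
      _ < ∞ := hs.tsum_ofReal_lt_top

lemma kernel_expansion {k : ℕ} (q : ℍ[ℝ]) {F : ℕ → ℍ[ℝ] → ℍ[ℝ]} {f : ℍ[ℝ] → ℍ[ℝ]} {K : ℝ}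
    (hF : ∀ m, Integrable (fun p => F m p * f p) gaussMeasure ∧
      ∫ p, ‖F m p * f p‖ ∂gaussMeasure ≤ K * √(m.factorial : ℝ))
    (hp : ∀ p, Summable fun m => kernelCoeff k m • (itoHermite m k q * F m p)) :
    Integrable (fun p => (∑' m, kernelCoeff k m • (itoHermite m k q * F m p)) * f p)
      gaussMeasure ∧
    HasSum (fun m => kernelCoeff k m • (itoHermite m k q * ∫ p, F m p * f p ∂gaussMeasure))
      (∫ p, (∑' m, kernelCoeff k m • (itoHermite m k q * F m p)) * f p ∂gaussMeasure) := by
  have h := integrable_tsum_and_hasSum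
    (g := fun m p => kernelCoeff k m • (itoHermite m k q * (F m p * f p)))
    (fun m => ((hF m).1.const_mul (itoHermite m k q)).fun_smul (kernelCoeff k m))
    (fun p => by simpa only [smul_mul_assoc, mul_assoc] using (hp p).mul_right (f p)) ?_
  · have e1 : ∀ p, ∑' m, kernelCoeff k m • (itoHermite m k q * (F m p * f p)) =
        (∑' m, kernelCoeff k m • (itoHermite m k q * F m p)) * f p := fun p => by
      rw [← tsum_mul_right]
      simp only [smul_mul_assoc, mul_assoc]
    have e2 : ∀ m, ∫ p, kernelCoeff k m • (itoHermite m k q * (F m p * f p)) ∂gaussMeasure =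
        kernelCoeff k m • (itoHermite m k q * ∫ p, F m p * f p ∂gaussMeasure) := fun m => by
      rw [integral_smul, integral_const_mul_of_integrable (hF m).1]
    simpa only [e1, e2] using h
  · obtain ⟨B, R, hB, hR, hb⟩ := exists_norm_itoHermite_le k q
    refine Summable.of_nonneg_of_le (fun m => by positivity) (fun m => ?_)
      ((summable_pow_div_sqrt_factorial R).mul_left (B * K))
    have hc := (kernelCoeff_pos k m).le
    have hn : ∀ p, ‖kernelCoeff k m • (itoHermite m k q * (F m p * f p))‖ =
        (kernelCoeff k m * ‖itoHermite m k q‖) * ‖F m p * f p‖ := fun p => by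
      rw [norm_smul, norm_mul (itoHermite m k q), Real.norm_of_nonneg hc, mul_assoc]
    simp only [hn]
    rw [integral_const_mul]
    have h0 : 0 < √(m.factorial : ℝ) := Real.sqrt_pos.2 (by positivity)
    have hint : 0 ≤ ∫ p, ‖F m p * f p‖ ∂gaussMeasure :=
      integral_nonneg fun p => norm_nonneg (F m p * f p)
    have hK : 0 ≤ K * √(m.factorial : ℝ) := hint.trans (hF m).2
    have hm : (m.factorial : ℝ) = √(m.factorial : ℝ) * √(m.factorial : ℝ) :=
      (Real.mul_self_sqrt (by positivity)).symm
    calc _ ≤ 1 / (m.factorial : ℝ) * (B * R ^ m) * (K * √(m.factorial : ℝ)) := by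
          gcongr
          · exact kernelCoeff_le k m
          · exact hb m
          · exact (hF m).2
      _ = _ := by
          rw [hm, Real.sqrt_mul_self h0.le]
          field_simp

variable {f : ℍ[ℝ] → ℍ[ℝ]}

lemma star_bargmannKernel (k : ℕ) (q p : ℍ[ℝ]) : star (bargmannKernel k p q) =
    ∑' m, kernelCoeff k m • (itoHermite m k q * star (itoHermite m k p)) := by
  rw [bargmannKernel, tsum_star]
  simp only [star_bargmannKernelTerm]

lemma bergmanProj_expansion (hf : MemLp f 2 gaussMeasure) (k : ℕ) (q : ℍ[ℝ]) :
    Integrable (fun p => star (bargmannKernel k p q) * f p) gaussMeasure ∧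
    HasSum (fun m => kernelCoeff k m •
      (itoHermite m k q * ∫ p, star (itoHermite m k p) * f p ∂gaussMeasure))
      (bergmanProj k f q) := by
  obtain ⟨K, hK⟩ := exists_integral_star_itoHermite_mul_le hf k
  have h := kernel_expansion (k := k) q (F := fun m p => star (itoHermite m k p)) hK
    (fun p => by simpa only [star_bargmannKernelTerm] using summable_star_bargmannKernelTerm k q p)
  simp only [← star_bargmannKernel] at h
  exact h

lemma projKernel_expansion (hf : MemLp f 2 gaussMeasure) (k : ℕ) (q : ℍ[ℝ]) :
    Integrable (fun p => projKernel k q p * f p) gaussMeasure ∧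
    HasSum (fun m => kernelCoeff k m •
      (itoHermite m k q * ∫ p, hermiteWeight k m p * f p ∂gaussMeasure))
      (∫ p, projKernel k q p * f p ∂gaussMeasure) := by
  obtain ⟨K, hK⟩ := exists_integral_hermiteWeight_mul_le hf k
  have h := kernel_expansion (k := k) q (F := fun m p => hermiteWeight k m p) hK
    (fun p => by simpa only [← projKernelTerm_eq] using summable_projKernelTerm k q p)
  simp only [← projKernelTerm_eq] at h
  exact h

theorem bergmanProj_cauchyTransform_eq (hf : MemLp f 2 gaussMeasure) (k : ℕ) (q : ℍ[ℝ]) :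
    bergmanProj k (cauchyTransform f) q = ∫ p, projKernel k q p * f p ∂gaussMeasure := by
  refine (bergmanProj_expansion (memLp_cauchyTransform hf) k q).2.unique ?_
  simp only [integral_star_itoHermite_mul_cauchyTransform hf]
  exact (projKernel_expansion hf k q).2

/-! ### The Bergman projection is an orthogonal projection -/

/-- The Hilbert space `L²(ℍ, ℍ; μ)`. -/
abbrev GaussL2 : Type := Lp ℍ[ℝ] 2 gaussMeasure

lemma inner_toLp {h g : ℍ[ℝ] → ℍ[ℝ]} (hh : MemLp h 2 gaussMeasure) (hg : MemLp g 2 gaussMeasure) :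
    inner ℝ (hh.toLp : GaussL2) (hg.toLp : GaussL2) = (∫ q, star (h q) * g q ∂gaussMeasure).re := by
  have hs : MemLp (fun q => star (h q)) 2 gaussMeasure := hh.star
  rw [L2.inner_def, re_integral (integrable_mul_of_memLp hs hg)]
  refine integral_congr_ae ?_
  filter_upwards [hh.coeFn_toLp, hg.coeFn_toLp] with q h1 h2
  rw [h1, h2, inner_eq_re_star_mul]

/-- The normalized Itô–Hermite polynomials. -/
def normHermite (k m : ℕ) (q : ℍ[ℝ]) : ℍ[ℝ] := √(kernelCoeff k m) • itoHermite m k q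

lemma memLp_normHermite (k m : ℕ) : MemLp (normHermite k m) 2 gaussMeasure :=
  (memLp_itoHermite m k).const_smul (√(kernelCoeff k m))

lemma memLp_normHermite_mul (k m : ℕ) (α : ℍ[ℝ]) :
    MemLp (fun q => normHermite k m q * α) 2 gaussMeasure :=
  (memLp_normHermite k m).mul_const α

lemma integral_star_normHermite_mul (k m n : ℕ) :
    ∫ q, star (normHermite k m q) * normHermite k n q ∂gaussMeasure = if m = n then 1 else 0 := by
  have h := integral_star_itoHermite_mul m n k
  have e : ∀ q, star (normHermite k m q) * normHermite k n q =
      (√(kernelCoeff k m) * √(kernelCoeff k n)) •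
        (star (itoHermite m k q) * itoHermite n k q) := fun q => by
    rw [normHermite, normHermite, Quaternion.star_smul, smul_mul_smul_comm]
  simp only [e]
  rw [integral_smul, h]
  split_ifs with hmn
  · subst hmn
    rw [Real.mul_self_sqrt (kernelCoeff_pos k m).le, ← Quaternion.coe_smul, smul_eq_mul,
      kernelCoeff, one_div, inv_mul_cancel₀ (by have := Real.pi_pos; positivity),
      Quaternion.coe_one]
  · rw [smul_zero]

lemma integral_star_mul_normHermite (k m : ℕ) (α : ℍ[ℝ]) {g : ℍ[ℝ] → ℍ[ℝ]}
    (hg : MemLp g 2 gaussMeasure) :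
    ∫ q, star (normHermite k m q * α) * g q ∂gaussMeasure =
      star α * ∫ q, star (normHermite k m q) * g q ∂gaussMeasure := by
  have hi := integrable_mul_of_memLp (memLp_normHermite k m).star hg
  simp only [Pi.star_apply] at hi
  rw [← integral_const_mul_of_integrable hi]
  simp only [star_mul, mul_assoc]

lemma inner_normHermite_mul (k m : ℕ) (α : ℍ[ℝ]) {g : ℍ[ℝ] → ℍ[ℝ]}
    (hg : MemLp g 2 gaussMeasure) :
    inner ℝ ((memLp_normHermite_mul k m α).toLp : GaussL2) (hg.toLp : GaussL2) =
      inner ℝ α (∫ q, star (normHermite k m q) * g q ∂gaussMeasure) := by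
  rw [inner_toLp, integral_star_mul_normHermite k m α hg, inner_eq_re_star_mul]

lemma inner_normHermite_mul_mul (k m n : ℕ) (α β : ℍ[ℝ]) :
    inner ℝ ((memLp_normHermite_mul k m α).toLp : GaussL2)
      ((memLp_normHermite_mul k n β).toLp : GaussL2) = if m = n then inner ℝ α β else 0 := by
  have hi := integrable_mul_of_memLp (memLp_normHermite k m).star (memLp_normHermite k n)
  simp only [Pi.star_apply] at hi
  rw [inner_normHermite_mul]
  simp only [← mul_assoc]
  rw [integral_mul_const_of_integrable hi, integral_star_normHermite_mul]
  split_ifs <;> simp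

/-- The isometric embedding `α ↦ H_{m,k} α / ‖H_{m,k}‖` of the quaternions into `L²`. -/
def hermiteIsometry (k m : ℕ) : ℍ[ℝ] →ₗᵢ[ℝ] GaussL2 where
  toFun α := (memLp_normHermite_mul k m α).toLp
  map_add' α β := by
    rw [← MemLp.toLp_add]
    congr 1
    funext q
    simp [mul_add]
  map_smul' c α := by
    rw [RingHom.id_apply, ← MemLp.toLp_const_smul]
    congr 1
    funext q
    simp
  norm_map' α := by
    change ‖((memLp_normHermite_mul k m α).toLp : GaussL2)‖ = ‖α‖
    have h := inner_normHermite_mul_mul k m m α α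
    rw [if_pos rfl, real_inner_self_eq_norm_sq, real_inner_self_eq_norm_sq] at h
    exact (sq_eq_sq₀ (norm_nonneg _) (norm_nonneg _)).1 h

lemma hermiteIsometry_apply (k m : ℕ) (α : ℍ[ℝ]) :
    hermiteIsometry k m α = (memLp_normHermite_mul k m α).toLp := rfl

lemma orthogonalFamily_hermiteIsometry (k : ℕ) :
    OrthogonalFamily ℝ (fun _ : ℕ => ℍ[ℝ]) (hermiteIsometry k) := by
  intro m n hmn α β
  rw [hermiteIsometry_apply, hermiteIsometry_apply, inner_normHermite_mul_mul, if_neg hmn]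

/-- Square summable Itô–Hermite series converge in `L²`. -/
lemma hasSum_hermiteIsometry {k : ℕ} {β : ℕ → ℍ[ℝ]} (hβ : Summable fun m => ‖β m‖ ^ 2)
    {h : ℍ[ℝ] → ℍ[ℝ]} (hs : ∀ q, HasSum (fun m => normHermite k m q * β m) (h q)) :
    ∃ hh : MemLp h 2 gaussMeasure,
      HasSum (fun m => hermiteIsometry k m (β m)) (hh.toLp : GaussL2) := by
  have hsum : Summable fun m => hermiteIsometry k m (β m) :=
    ((orthogonalFamily_hermiteIsometry k).summable_iff_norm_sq_summable β).2 hβ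
  set S : GaussL2 := ∑' m, hermiteIsometry k m (β m) with hS
  have ht : Filter.Tendsto (fun n => ∑ m ∈ Finset.range n, hermiteIsometry k m (β m))
      Filter.atTop (nhds S) := hsum.hasSum.tendsto_sum_nat
  have hpart : ∀ n, (∑ m ∈ Finset.range n, hermiteIsometry k m (β m) : GaussL2) =ᵐ[gaussMeasure]
      fun q => ∑ m ∈ Finset.range n, normHermite k m q * β m := by
    intro n
    refine (Lp.coeFn_finsetSum _ _).trans ?_
    have : ∀ᵐ q ∂gaussMeasure, ∀ m, (hermiteIsometry k m (β m) : ℍ[ℝ] → ℍ[ℝ]) q =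
        normHermite k m q * β m :=
      ae_all_iff.2 fun m => (memLp_normHermite_mul k m (β m)).coeFn_toLp
    filter_upwards [this] with q hq
    simp [hq]
  obtain ⟨ns, hns, hae⟩ := (tendstoInMeasure_of_tendsto_Lp ht).exists_seq_tendsto_ae
  have hSh : S =ᵐ[gaussMeasure] h := by
    filter_upwards [hae, ae_all_iff.2 hpart] with q h1 h2
    simp only [h2] at h1
    exact tendsto_nhds_unique h1 ((hs q).tendsto_sum_nat.comp hns.tendsto_atTop)
  have hh : MemLp h 2 gaussMeasure := (memLp_congr_ae hSh).1 (Lp.memLp S)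
  refine ⟨hh, ?_⟩
  have : hh.toLp = S := by
    rw [← Lp.toLp_coeFn S (Lp.memLp S)]
    exact MemLp.toLp_congr _ _ hSh.symm
  rw [this]
  exact hsum.hasSum

/-- **Bessel's inequality** for the Itô–Hermite polynomials. -/
lemma summable_norm_sq_coeff (k : ℕ) {g : ℍ[ℝ] → ℍ[ℝ]} (hg : MemLp g 2 gaussMeasure) :
    Summable fun m => ‖∫ q, star (normHermite k m q) * g q ∂gaussMeasure‖ ^ 2 := by
  set β := fun m => ∫ q, star (normHermite k m q) * g q ∂gaussMeasure with hβ
  refine summable_of_sum_le (c := ‖(hg.toLp : GaussL2)‖ ^ 2) (fun m => by positivity) fun s => ?_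
  set w : GaussL2 := ∑ m ∈ s, hermiteIsometry k m (β m) with hw
  have h1 : ‖w‖ ^ 2 = ∑ m ∈ s, ‖β m‖ ^ 2 := (orthogonalFamily_hermiteIsometry k).norm_sum β s
  have h2 : inner ℝ w (hg.toLp : GaussL2) = ∑ m ∈ s, ‖β m‖ ^ 2 := by
    rw [hw, sum_inner]
    refine Finset.sum_congr rfl fun m _ => ?_
    rw [hermiteIsometry_apply, inner_normHermite_mul, ← real_inner_self_eq_norm_sq]
  have h3 := real_inner_le_norm w (hg.toLp : GaussL2)
  rw [h2, ← h1] at h3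
  rw [← h1]
  have h4 := norm_nonneg w
  have h5 := norm_nonneg (hg.toLp : GaussL2)
  rcases h4.eq_or_lt with h0 | h0
  · rw [← h0, zero_pow two_ne_zero]; positivity
  · have : ‖w‖ ≤ ‖(hg.toLp : GaussL2)‖ := by
      rw [sq] at h3; exact le_of_mul_le_mul_left h3 h0
    gcongr

lemma normHermite_mul_eq (k m : ℕ) (q α : ℍ[ℝ]) :
    normHermite k m q * ((√(kernelCoeff k m))⁻¹ • α) = itoHermite m k q * α := by
  have : √(kernelCoeff k m) ≠ 0 := (Real.sqrt_pos.2 (kernelCoeff_pos k m)).ne'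
  rw [normHermite, smul_mul_smul_comm, mul_inv_cancel₀ this, one_smul]

lemma bargmannSpace_hasSum {k : ℕ} {h : ℍ[ℝ] → ℍ[ℝ]} (hh : h ∈ bargmannSpace k) :
    ∃ β : ℕ → ℍ[ℝ], ∃ hm : MemLp h 2 gaussMeasure,
      HasSum (fun m => hermiteIsometry k m (β m)) (hm.toLp : GaussL2) := by
  obtain ⟨α, hα, hs⟩ := hh
  refine ⟨fun m => (√(kernelCoeff k m))⁻¹ • α m, hasSum_hermiteIsometry ?_ ?_⟩
  · refine (hα.mul_left (Real.pi * k.factorial)).congr fun m => ?_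
    have := Real.pi_pos
    rw [norm_smul, norm_inv, Real.norm_of_nonneg (Real.sqrt_nonneg _), mul_pow, inv_pow,
      Real.sq_sqrt (kernelCoeff_pos k m).le, kernelCoeff]
    field_simp
  · simpa only [normHermite_mul_eq] using hs

lemma mul_const_mem_bargmannSpace {k : ℕ} {h : ℍ[ℝ] → ℍ[ℝ]} (hh : h ∈ bargmannSpace k)
    (c : ℍ[ℝ]) : (fun q => h q * c) ∈ bargmannSpace k := by
  obtain ⟨α, hα, hs⟩ := hh
  refine ⟨fun m => α m * c, (hα.mul_right (‖c‖ ^ 2)).congr fun m => ?_, fun q => ?_⟩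
  · rw [norm_mul]; ring
  · simpa only [mul_assoc] using (hs q).mul_right c

lemma kernelCoeff_smul_eq (k m : ℕ) (q : ℍ[ℝ]) {g : ℍ[ℝ] → ℍ[ℝ]} :
    kernelCoeff k m • (itoHermite m k q * ∫ p, star (itoHermite m k p) * g p ∂gaussMeasure) =
      normHermite k m q * ∫ p, star (normHermite k m p) * g p ∂gaussMeasure := by
  have e : ∀ p, star (normHermite k m p) * g p =
      √(kernelCoeff k m) • (star (itoHermite m k p) * g p) := fun p => by
    rw [normHermite, Quaternion.star_smul, smul_mul_assoc]
  simp only [e]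
  rw [integral_smul, normHermite, smul_mul_smul_comm, Real.mul_self_sqrt (kernelCoeff_pos k m).le]

variable {g : ℍ[ℝ] → ℍ[ℝ]}

lemma bergmanProj_hasSum (hg : MemLp g 2 gaussMeasure) (k : ℕ) :
    ∃ hm : MemLp (bergmanProj k g) 2 gaussMeasure,
      HasSum (fun m => hermiteIsometry k m (∫ p, star (normHermite k m p) * g p ∂gaussMeasure))
        (hm.toLp : GaussL2) :=
  hasSum_hermiteIsometry (summable_norm_sq_coeff k hg) fun q => by
    simpa only [kernelCoeff_smul_eq] using (bergmanProj_expansion hg k q).2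

theorem bergmanProj_mem_bargmannSpace (hg : MemLp g 2 gaussMeasure) (k : ℕ) :
    bergmanProj k g ∈ bargmannSpace k := by
  refine ⟨fun m => kernelCoeff k m • ∫ p, star (itoHermite m k p) * g p ∂gaussMeasure, ?_,
    fun q => by simpa only [mul_smul_comm] using (bergmanProj_expansion hg k q).2⟩
  refine ((summable_norm_sq_coeff k hg).mul_left (1 / (Real.pi * k.factorial))).congr fun m => ?_
  have e : ∀ p, star (normHermite k m p) * g p =
      √(kernelCoeff k m) • (star (itoHermite m k p) * g p) := fun p => by
    rw [normHermite, Quaternion.star_smul, smul_mul_assoc]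
  have hπ := Real.pi_pos
  simp only [e]
  rw [integral_smul, norm_smul, norm_smul, Real.norm_of_nonneg (Real.sqrt_nonneg _),
    Real.norm_of_nonneg (kernelCoeff_pos k m).le, mul_pow, mul_pow,
    Real.sq_sqrt (kernelCoeff_pos k m).le, kernelCoeff]
  field_simp

lemma inner_toLp_bargmannSpace_sub (hg : MemLp g 2 gaussMeasure) {k : ℕ} {h : ℍ[ℝ] → ℍ[ℝ]}
    (hh : h ∈ bargmannSpace k) (hm : MemLp h 2 gaussMeasure)
    (hP : MemLp (bergmanProj k g) 2 gaussMeasure) :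
    inner ℝ (hm.toLp : GaussL2) ((hg.sub hP).toLp : GaussL2) = 0 := by
  obtain ⟨β, hm', hs⟩ := bargmannSpace_hasSum hh
  obtain ⟨hP', hPs⟩ := bergmanProj_hasSum hg k
  rw [MemLp.toLp_sub]
  refine (hs.mapL ((innerSL ℝ).flip (hg.toLp - hP.toLp : GaussL2))).unique ?_
  convert! hasSum_zero using 2 with m
  rw [ContinuousLinearMap.flip_apply, innerSL_apply_apply, inner_sub_right, sub_eq_zero,
    hermiteIsometry_apply, inner_normHermite_mul]
  refine HasSum.unique ?_ (hPs.mapL (innerSL ℝ (hermiteIsometry k m (β m))))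
  convert! hasSum_ite_eq m (inner ℝ (β m)
    (∫ p, star (normHermite k m p) * g p ∂gaussMeasure)) using 2 with n
  rw [innerSL_apply_apply, hermiteIsometry_apply, hermiteIsometry_apply,
    inner_normHermite_mul_mul]
  by_cases hmn : n = m
  · subst hmn; simp
  · rw [if_neg hmn, if_neg (Ne.symm hmn)]

/-- The Bergman projection is the orthogonal projection onto the Bargmann space. -/
theorem bergmanProj_orthogonal (hg : MemLp g 2 gaussMeasure) {k : ℕ} {h : ℍ[ℝ] → ℍ[ℝ]}
    (hh : h ∈ bargmannSpace k) : MemLp h 2 gaussMeasure ∧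
      ∫ q, star (h q) * (g q - bergmanProj k g q) ∂gaussMeasure = 0 := by
  obtain ⟨-, hm, -⟩ := bargmannSpace_hasSum hh
  obtain ⟨hP, -⟩ := bergmanProj_hasSum hg k
  refine ⟨hm, ?_⟩
  set X := ∫ q, star (h q) * (g q - bergmanProj k g q) ∂gaussMeasure with hX
  have h1 := inner_toLp_bargmannSpace_sub hg (mul_const_mem_bargmannSpace hh X)
    (hm.mul_const X) hP
  rw [inner_toLp] at h1
  simp only [star_mul, mul_assoc, Pi.sub_apply] at h1
  have hi := integrable_mul_of_memLp hm.star (hg.sub hP)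
  simp only [Pi.star_apply, Pi.sub_apply] at hi
  rw [integral_const_mul_of_integrable hi, ← hX, star_mul_self_eq_coe, Quaternion.re_coe] at h1
  simpa using h1

/-! ### The complex closed form -/

/-- The terms of the series `∑_m H_{m,a}(z) H_{b,m}(w) / m!`. -/
def pairingTerm (a b : ℕ) (z w : ℂ) (m : ℕ) : ℂ :=
  complexHermite m a z * complexHermite b m w / m.factorial

lemma hasSum_of_factorial_shift {u : ℕ → ℂ} {s : ℂ}
    (h : HasSum (fun m => u (m + 1) / (m.factorial : ℂ)) s) :
    HasSum (fun m : ℕ => m * u m / (m.factorial : ℂ)) s := by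
  have h2 := (hasSum_nat_add_iff (f := fun m : ℕ => m * u m / (m.factorial : ℂ)) 1
    (g := s)).1 ?_
  · simpa using h2
  · refine h.congr_fun fun m => ?_
    have h1 : (m.factorial : ℂ) ≠ 0 := by exact_mod_cast m.factorial_ne_zero
    have h2 : (m : ℂ) + 1 ≠ 0 := by exact_mod_cast m.succ_ne_zero
    rw [Nat.factorial_succ]
    push_cast
    field_simp

/-- The bilinear generating series of the Itô–Hermite polynomials. -/
theorem hasSum_pairingTerm (a b : ℕ) (z w : ℂ) : HasSum (pairingTerm a b z w)
    ((-1) ^ b * Complex.exp (z * star w) * complexHermite b a (z - w)) := by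
  induction a generalizing b with
  | zero =>
    induction b with
    | zero =>
      have h := NormedSpace.expSeries_div_hasSum_exp (z * star w)
      rw [← Complex.exp_eq_exp_ℂ] at h
      have e : pairingTerm 0 0 z w = fun n => (z * star w) ^ n / (n.factorial : ℂ) := by
        funext n
        simp [pairingTerm, mul_pow]
      rw [e]
      simpa using h
    | succ b ih =>
      have h1 : HasSum (fun m : ℕ => m * (complexHermite m 0 z * complexHermite b (m - 1) w) /
          (m.factorial : ℂ)) (z * ((-1) ^ b * Complex.exp (z * star w) *
            complexHermite b 0 (z - w))) := by
        refine hasSum_of_factorial_shift ((ih.mul_left z).congr_fun fun m => ?_)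
        simp only [pairingTerm, complexHermite_zero_right, Nat.add_sub_cancel]
        ring
      convert! (ih.mul_left w).sub h1 using 1
      · funext m
        simp only [pairingTerm, complexHermite_succ_left b m]
        ring
      · simp only [complexHermite_zero_right]
        ring
  | succ a ih =>
    have h1 : HasSum (fun m : ℕ => m * (complexHermite (m - 1) a z * complexHermite b m w) /
        (m.factorial : ℂ)) (star w * ((-1) ^ b * Complex.exp (z * star w) *
          complexHermite b a (z - w)) - b * ((-1) ^ (b - 1) * Complex.exp (z * star w) *
          complexHermite (b - 1) a (z - w))) := by
      refine hasSum_of_factorial_shift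
        ((((ih b).mul_left (star w)).sub ((ih (b - 1)).mul_left (b : ℂ))).congr_fun fun m => ?_)
      simp only [pairingTerm, Nat.add_sub_cancel, complexHermite_succ_right b m]
      ring
    convert! ((ih b).mul_left (star z)).sub h1 using 1
    · funext m
      simp only [pairingTerm, complexHermite_succ_right m a]
      ring
    · rw [complexHermite_succ_right, star_sub]
      have hb : (b : ℂ) * (-1) ^ b = -(b * (-1) ^ (b - 1)) := by
        rcases b with _ | b
        · simp
        · rw [Nat.add_sub_cancel, pow_succ]; ring
      linear_combination (-Complex.exp (z * star w) * complexHermite (b - 1) a (z - w)) * hb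

lemma projKernel_sliceHom {I : ℍ[ℝ]} (hI : I * I = -1) (k : ℕ) (z w : ℂ) :
    projKernel (k + 1) (sliceHom I hI z) (sliceHom I hI w) =
      (Real.exp (-‖w‖ ^ 2) / (Real.pi * ((k + 1).factorial : ℝ))) • sliceHom I hI
        ((-1) ^ k * Complex.exp (z * star w) * complexHermite k (k + 1) (z - w)) := by
  have h := ((hasSum_pairingTerm (k + 1) k z w).mapL (sliceCLM I hI)).const_smul
    (Real.exp (-‖w‖ ^ 2) / (Real.pi * ((k + 1).factorial : ℝ)))
  rw [sliceCLM_apply] at h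
  rw [projKernel, ← h.tsum_eq]
  refine tsum_congr fun m => ?_
  rw [projKernelTerm, itoHermitePred, itoHermite_sliceHom, itoHermite_sliceHom, norm_sliceHom,
    ← map_mul, sliceCLM_apply, ← map_smul, ← map_smul]
  congr 1
  simp only [pairingTerm, Complex.real_smul]
  push_cast
  field_simp

lemma exp_sliceHom {I : ℍ[ℝ]} (hI : I * I = -1) (z : ℂ) :
    NormedSpace.exp (sliceHom I hI z) = sliceHom I hI (Complex.exp z) := by
  rw [Complex.exp_eq_exp_ℂ]
  exact (NormedSpace.map_exp (sliceHom I hI) (continuous_sliceHom hI) z).symm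

lemma sliceClosedForm_sliceHom {I : ℍ[ℝ]} (hI : I * I = -1) (k : ℕ) (z w : ℂ) :
    sliceClosedForm (k + 1) (sliceHom I hI w) (sliceHom I hI z) =
      Real.exp (‖w‖ ^ 2) • projKernel (k + 1) (sliceHom I hI z) (sliceHom I hI w) := by
  rw [projKernel_sliceHom, sliceClosedForm, star_sliceHom, ← map_mul, exp_sliceHom, ← map_sub,
    Nat.add_sub_cancel, itoHermite_sliceHom, ← map_mul, smul_smul, ← map_smul, ← map_smul,
    Real.exp_neg]
  congr 1
  have h1 := (Real.exp_pos (‖w‖ ^ 2)).ne'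
  have h2 : Real.exp (‖w‖ ^ 2) * ((Real.exp (‖w‖ ^ 2))⁻¹ / (Real.pi * ((k + 1).factorial : ℝ))) =
      1 / (Real.pi * ((k + 1).factorial : ℝ)) := by
    field_simp
  rw [h2]
  simp only [Complex.real_smul]
  push_cast
  ring

/-! ### Slice functions -/

/-- Functions on `ℍ` that satisfy the representation formula. -/
def IsSliceFunction (f : ℍ[ℝ] → ℍ[ℝ]) : Prop :=
  ∀ (I : ℍ[ℝ]) (hI : I * I = -1) (J : ℍ[ℝ]) (hJ : J * J = -1) (z : ℂ),
    f (sliceHom J hJ z) = ((1 / 2 : ℝ) • (1 - J * I)) * f (sliceHom I hI z) +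
      ((1 / 2 : ℝ) • (1 + J * I)) * f (sliceHom I hI (star z))

lemma sliceHom_representation_left {I J : ℍ[ℝ]} (hI : I * I = -1) (hJ : J * J = -1) (z : ℂ) :
    sliceHom J hJ z = ((1 / 2 : ℝ) • (1 - J * I)) * sliceHom I hI z +
      ((1 / 2 : ℝ) • (1 + J * I)) * sliceHom I hI (star z) := by
  have h : J * I * I = -J := by rw [mul_assoc, hI, mul_neg_one]
  simp only [sliceHom_apply, Complex.star_def, Complex.conj_re, Complex.conj_im, mul_smul_comm,
    smul_mul_assoc, mul_add, Quaternion.mul_coe_eq_smul, sub_mul, add_mul, one_mul, h, smul_sub,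
    smul_add]
  rw [← mul_one (z.re : ℍ[ℝ]), Quaternion.coe_mul_eq_smul]
  module

lemma IsSliceFunction.of_intrinsic {g : ℍ[ℝ] → ℍ[ℝ]} {G : ℂ → ℂ}
    (hg : ∀ (I : ℍ[ℝ]) (hI : I * I = -1) (z : ℂ), g (sliceHom I hI z) = sliceHom I hI (G z))
    (hG : ∀ z, G (star z) = star (G z)) (c : ℍ[ℝ]) : IsSliceFunction fun q => g q * c := by
  intro I hI J hJ z
  simp only [hg, hG]
  rw [← mul_assoc, ← mul_assoc, ← add_mul, ← sliceHom_representation_left hI hJ]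

lemma IsSliceFunction.of_hasSum {ι : Type*} {f : ι → ℍ[ℝ] → ℍ[ℝ]} {F : ℍ[ℝ] → ℍ[ℝ]}
    (hf : ∀ n, IsSliceFunction (f n)) (hF : ∀ q, HasSum (fun n => f n q) (F q)) :
    IsSliceFunction F := by
  intro I hI J hJ z
  refine (hF _).unique ?_
  have h := ((hF (sliceHom I hI z)).mul_left ((1 / 2 : ℝ) • (1 - J * I))).add
    ((hF (sliceHom I hI (star z))).mul_left ((1 / 2 : ℝ) • (1 + J * I)))
  exact h.congr_fun fun n => (hf n I hI J hJ z)

lemma IsSliceFunction.const_smul {f : ℍ[ℝ] → ℍ[ℝ]} (hf : IsSliceFunction f) (c : ℝ) :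
    IsSliceFunction fun q => c • f q := by
  intro I hI J hJ z
  change c • f _ = _ * c • f _ + _ * c • f _
  rw [hf I hI J hJ z, smul_add, mul_smul_comm, mul_smul_comm]

/-- Slice functions are determined by their values on one slice. -/
lemma IsSliceFunction.eq_of_eqOn_slice {f g : ℍ[ℝ] → ℍ[ℝ]} (hf : IsSliceFunction f)
    (hg : IsSliceFunction g) {I : ℍ[ℝ]} (hI : I * I = -1)
    (h : ∀ z, f (sliceHom I hI z) = g (sliceHom I hI z)) (q : ℍ[ℝ]) : f q = g q := by
  obtain ⟨J, hJ, z, rfl⟩ := exists_slice q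
  rw [hf I hI J hJ, hg I hI J hJ, h, h]

lemma isSliceFunction_projKernel (k : ℕ) (p : ℍ[ℝ]) :
    IsSliceFunction fun q => projKernel k q p := by
  refine IsSliceFunction.of_hasSum (f := fun m q => projKernelTerm k q p m) (fun m => ?_)
    fun q => (summable_projKernelTerm k q p).hasSum
  simp only [projKernelTerm_eq]
  exact (IsSliceFunction.of_intrinsic (fun I hI z => itoHermite_sliceHom hI m k z)
    (fun z => by rw [complexHermite_star, star_complexHermite]) _).const_smul _

lemma isSliceFunction_value {F : SliceSeries} (hF : ∀ q, F.ConvergesAt q) :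
    IsSliceFunction F.value := by
  unfold SliceSeries.value
  have h : ∀ j : ℕ, IsSliceFunction fun q : ℍ[ℝ] =>
      star q ^ j * ∑' n : ℕ, q ^ n * PowerSeries.coeff n (Polynomial.coeff F j) := by
    intro j
    refine IsSliceFunction.of_hasSum (f := fun n q =>
      star q ^ j * q ^ n * PowerSeries.coeff n (Polynomial.coeff F j)) (fun n => ?_)
      fun q => by simpa only [mul_assoc] using (hF q j).hasSum.mul_left (star q ^ j)
    exact IsSliceFunction.of_intrinsic (G := fun z => star z ^ j * z ^ n)
      (fun I hI z => by rw [star_sliceHom, map_mul, map_pow, map_pow])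
      (fun z => by rw [star_mul', star_pow, star_pow, star_star]) _
  intro I hI J hJ z
  rw [Finset.mul_sum, Finset.mul_sum, ← Finset.sum_add_distrib]
  exact Finset.sum_congr rfl fun j _ => h j I hI J hJ z

/-! ### Convergence and values of star products -/

lemma commute_star_self (p : ℍ[ℝ]) : Commute (star p) p := IsStarNormal.star_comm_self

namespace SliceSeries

lemma convergesAt_iff {F : SliceSeries} {q : ℍ[ℝ]} : F.ConvergesAt q ↔
    ∀ j, Summable fun n : ℕ => ‖q‖ ^ n * ‖PowerSeries.coeff n (Polynomial.coeff F j)‖ := by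
  refine forall_congr' fun j => ?_
  rw [← summable_norm_iff]
  simp only [norm_mul, norm_pow]

lemma ConvergesAt.add {F G : SliceSeries} {q : ℍ[ℝ]} (hF : F.ConvergesAt q)
    (hG : G.ConvergesAt q) : (F + G).ConvergesAt q := fun j => by
  simpa only [Polynomial.coeff_add, map_add, mul_add] using (hF j).add (hG j)

lemma ConvergesAt.sub {F G : SliceSeries} {q : ℍ[ℝ]} (hF : F.ConvergesAt q)
    (hG : G.ConvergesAt q) : (F - G).ConvergesAt q := fun j => by
  simpa only [Polynomial.coeff_sub, map_sub, mul_sub] using (hF j).sub (hG j)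

lemma ConvergesAt.zsmul {F : SliceSeries} {q : ℍ[ℝ]} (hF : F.ConvergesAt q) (c : ℤ) :
    (c • F).ConvergesAt q := fun j => by
  simpa only [Polynomial.coeff_smul, map_zsmul, mul_smul_comm] using (hF j).const_smul c

lemma ConvergesAt.zero (q : ℍ[ℝ]) : (0 : SliceSeries).ConvergesAt q := fun j => by simp

lemma ConvergesAt.sum {ι : Type*} {s : Finset ι} {F : ι → SliceSeries} {q : ℍ[ℝ]}
    (hF : ∀ i ∈ s, (F i).ConvergesAt q) : (∑ i ∈ s, F i).ConvergesAt q :=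
  Finset.sum_induction F (fun G => G.ConvergesAt q) (fun _ _ h h' => h.add h')
    (ConvergesAt.zero q) hF

lemma coeff_varQ_mul (F : SliceSeries) (j : ℕ) :
    Polynomial.coeff (varQ * F) j = PowerSeries.X * Polynomial.coeff F j := by
  rw [varQ, Polynomial.coeff_C_mul]

lemma ConvergesAt.varQ_mul {F : SliceSeries} {q : ℍ[ℝ]} (hF : F.ConvergesAt q) :
    (varQ * F).ConvergesAt q := fun j => by
  refine (summable_nat_add_iff 1).1 ?_
  simpa only [coeff_varQ_mul, PowerSeries.coeff_succ_X_mul, pow_succ', mul_assoc] using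
    (hF j).mul_left q

lemma ConvergesAt.varQbar_mul {F : SliceSeries} {q : ℍ[ℝ]} (hF : F.ConvergesAt q) :
    (varQbar * F).ConvergesAt q := fun j => by
  rcases j with _ | j
  · simp [varQbar]
  · simpa only [varQbar, Polynomial.coeff_X_mul] using hF j

lemma coeff_constS_mul (c : ℍ[ℝ]) (F : SliceSeries) (j n : ℕ) :
    PowerSeries.coeff n (Polynomial.coeff (constS c * F) j) =
      c * PowerSeries.coeff n (Polynomial.coeff F j) := by
  rw [constS, Polynomial.coeff_C_mul, PowerSeries.coeff_C_mul]

lemma ConvergesAt.constS_mul {F : SliceSeries} {q : ℍ[ℝ]} (hF : F.ConvergesAt q) (c : ℍ[ℝ]) :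
    (constS c * F).ConvergesAt q := by
  rw [convergesAt_iff] at hF ⊢
  intro j
  simp only [coeff_constS_mul, norm_mul]
  exact ((hF j).mul_left ‖c‖).congr fun n => by ring

lemma value_eq_sum {F : SliceSeries} {s : Finset ℕ} (hs : F.support ⊆ s) (q : ℍ[ℝ]) :
    F.value q = ∑ j ∈ s,
      star q ^ j * ∑' n : ℕ, q ^ n * PowerSeries.coeff n (Polynomial.coeff F j) := by
  refine Finset.sum_subset hs fun j _ hj => ?_
  rw [Polynomial.notMem_support_iff.1 hj]
  simp

lemma value_add {F G : SliceSeries} {q : ℍ[ℝ]} (hF : F.ConvergesAt q) (hG : G.ConvergesAt q) :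
    (F + G).value q = F.value q + G.value q := by
  rw [value_eq_sum (Polynomial.support_add (p := F) (q := G)),
    value_eq_sum (Finset.subset_union_left (s₁ := F.support) (s₂ := G.support)),
    value_eq_sum (F := G) (Finset.subset_union_right (s₁ := F.support) (s₂ := G.support)),
    ← Finset.sum_add_distrib]
  refine Finset.sum_congr rfl fun j _ => ?_
  simp only [Polynomial.coeff_add, map_add, mul_add]
  rw [(hF j).tsum_add (hG j), mul_add]

lemma value_zsmul {F : SliceSeries} {q : ℍ[ℝ]} (hF : F.ConvergesAt q) (c : ℤ) :
    (c • F).value q = (c : ℝ) • F.value q := by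
  rw [value_eq_sum (Polynomial.support_smul c F), value, Finset.smul_sum]
  refine Finset.sum_congr rfl fun j _ => ?_
  have e : ∀ n, q ^ n * PowerSeries.coeff n (Polynomial.coeff (c • F) j) =
      (c : ℝ) • (q ^ n * PowerSeries.coeff n (Polynomial.coeff F j)) := fun n => by
    rw [Polynomial.coeff_smul, map_zsmul, mul_smul_comm, Int.cast_smul_eq_zsmul]
  simp only [e]
  rw [(hF j).tsum_const_smul, mul_smul_comm]

lemma value_sub {F G : SliceSeries} {q : ℍ[ℝ]} (hF : F.ConvergesAt q) (hG : G.ConvergesAt q) :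
    (F - G).value q = F.value q - G.value q := by
  have h := value_add hF (hG.zsmul (-1))
  rw [value_zsmul hG] at h
  simpa [sub_eq_add_neg] using h

lemma value_sum {ι : Type*} {s : Finset ι} {F : ι → SliceSeries} {q : ℍ[ℝ]}
    (hF : ∀ i ∈ s, (F i).ConvergesAt q) : (∑ i ∈ s, F i).value q = ∑ i ∈ s, (F i).value q := by
  classical
  induction s using Finset.induction_on with
  | empty => simp [value]
  | insert i s hi ih =>
    rw [Finset.sum_insert hi, Finset.sum_insert hi, value_add (hF i (Finset.mem_insert_self i s))
      (ConvergesAt.sum fun j hj => hF j (Finset.mem_insert_of_mem hj)),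
      ih fun j hj => hF j (Finset.mem_insert_of_mem hj)]

lemma value_varQ_mul {F : SliceSeries} {q : ℍ[ℝ]} (hF : F.ConvergesAt q) :
    (varQ * F).value q = q * F.value q := by
  have hs : (varQ * F).support ⊆ F.support := fun j hj => by
    rw [Polynomial.mem_support_iff, coeff_varQ_mul] at hj
    rw [Polynomial.mem_support_iff]
    exact right_ne_zero_of_mul hj
  rw [value_eq_sum hs, value, Finset.mul_sum]
  refine Finset.sum_congr rfl fun j _ => ?_
  have hc : Commute q (star q ^ j) := (commute_star_self q).symm.pow_right j
  rw [← mul_assoc, hc.eq, mul_assoc, ← (hF j).tsum_mul_left,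
    (hF.varQ_mul j).tsum_eq_zero_add]
  simp [coeff_varQ_mul, pow_succ', mul_assoc, PowerSeries.coeff_succ_X_mul]

lemma value_varQbar_mul {F : SliceSeries} {q : ℍ[ℝ]} :
    (varQbar * F).value q = star q * F.value q := by
  have h1 : F.support ⊆ Finset.range (F.natDegree + 1) := Polynomial.supp_subset_range_natDegree_succ
  have h2 : (varQbar * F).support ⊆ Finset.range (F.natDegree + 1 + 1) := by
    refine Polynomial.supp_subset_range ?_
    have : (varQbar * F).natDegree ≤ varQbar.natDegree + F.natDegree := Polynomial.natDegree_mul_le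
    have h3 : varQbar.natDegree ≤ 1 := Polynomial.natDegree_X_le
    omega
  rw [value_eq_sum h1, value_eq_sum h2, Finset.sum_range_succ', Finset.mul_sum]
  simp only [varQbar, Polynomial.coeff_X_mul, Polynomial.coeff_X_mul_zero, map_zero, mul_zero,
    tsum_zero, add_zero, pow_succ', mul_assoc]

lemma value_constS_mul {F : SliceSeries} {q c : ℍ[ℝ]} (hF : F.ConvergesAt q) (hc : Commute c q)
    (hc' : Commute c (star q)) : (constS c * F).value q = c * F.value q := by
  have hs : (constS c * F).support ⊆ F.support := fun j hj => by
    rw [Polynomial.mem_support_iff, constS, Polynomial.coeff_C_mul] at hj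
    rw [Polynomial.mem_support_iff]
    exact right_ne_zero_of_mul hj
  rw [value_eq_sum hs, value, Finset.mul_sum]
  refine Finset.sum_congr rfl fun j _ => ?_
  rw [← mul_assoc, (hc'.pow_right j).eq, mul_assoc, ← (hF j).tsum_mul_left]
  congr 1
  refine tsum_congr fun n => ?_
  rw [coeff_constS_mul, ← mul_assoc, ← mul_assoc, (hc.pow_right n).eq]

end SliceSeries

open SliceSeries

lemma convergesAt_starExp (b q : ℍ[ℝ]) : (starExp b).ConvergesAt q := by
  rw [convergesAt_iff]
  intro j
  rcases j with _ | j
  · refine (Real.summable_pow_div_factorial (‖q‖ * ‖b‖)).congr fun n => ?_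
    rw [starExp, Polynomial.coeff_C_zero, PowerSeries.coeff_mk, norm_smul, norm_pow, mul_pow,
      Real.norm_of_nonneg (by positivity)]
    ring
  · simp [starExp]

lemma value_starExp {b q : ℍ[ℝ]} (h : Commute q b) :
    (starExp b).value q = NormedSpace.exp (q * b) := by
  have hs : (starExp b).support ⊆ {0} := Polynomial.support_C_subset _
  rw [value_eq_sum hs, Finset.sum_singleton, pow_zero,
    one_mul, NormedSpace.exp_eq_tsum ℝ]
  refine tsum_congr fun n => ?_
  rw [starExp, Polynomial.coeff_C_zero, PowerSeries.coeff_mk, mul_smul_comm, h.mul_pow, one_div]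

lemma commute_starExp_constS (b c : ℍ[ℝ]) (h : Commute b c) :
    Commute (starExp b) (constS c) := by
  unfold starExp constS
  refine Commute.map (f := (Polynomial.C : PowerSeries ℍ[ℝ] →+* _)) ?_
  ext n : 1
  rw [PowerSeries.coeff_C_mul, PowerSeries.coeff_mul_C, PowerSeries.coeff_mk, smul_mul_assoc,
    mul_smul_comm, (h.pow_left n).eq]

lemma commute_starExp_varQ (b : ℍ[ℝ]) : Commute (starExp b) varQ :=
  Commute.map (f := (Polynomial.C : PowerSeries ℍ[ℝ] →+* _)) (PowerSeries.commute_X _)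

lemma commute_starExp_varQbar (b : ℍ[ℝ]) : Commute (starExp b) varQbar :=
  (Polynomial.commute_X _).symm

lemma starExp_mul_starHermite (m n : ℕ) (p : ℍ[ℝ]) :
    starExp (star p) * starHermite m n p = ∑ l ∈ Finset.range (min m n + 1),
      ((-1 : ℤ) ^ l * (l.factorial : ℤ) * (m.choose l : ℤ) * (n.choose l : ℤ)) •
        ((varQ - constS p) ^ (m - l) *
          ((varQbar - constS (star p)) ^ (n - l) * starExp (star p))) := by
  rw [starHermite, Finset.mul_sum]
  refine Finset.sum_congr rfl fun l _ => ?_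
  have h1 : Commute (starExp (star p)) (varQ - constS p) :=
    (commute_starExp_varQ _).sub_right (commute_starExp_constS _ _ (commute_star_self p))
  have h2 : Commute (starExp (star p)) (varQbar - constS (star p)) :=
    (commute_starExp_varQbar _).sub_right (commute_starExp_constS _ _ (Commute.refl _))
  rw [mul_smul_comm, ((h1.pow_right _).mul_right (h2.pow_right _)).eq,
    mul_assoc ((varQ - constS p) ^ (m - l))]

lemma convergesAt_star_power (p q : ℍ[ℝ]) (a b : ℕ) : ((varQ - constS p) ^ a *
    ((varQbar - constS (star p)) ^ b * starExp (star p))).ConvergesAt q := by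
  have h1 : ((varQbar - constS (star p)) ^ b * starExp (star p)).ConvergesAt q := by
    induction b with
    | zero => simpa using convergesAt_starExp (star p) q
    | succ b ih =>
      rw [pow_succ', mul_assoc, sub_mul]
      exact ih.varQbar_mul.sub (ih.constS_mul _)
  induction a with
  | zero => simpa using h1
  | succ a ih =>
    rw [pow_succ', mul_assoc, sub_mul]
    exact ih.varQ_mul.sub (ih.constS_mul _)

lemma convergesAt_starExp_mul_starHermite (m n : ℕ) (p q : ℍ[ℝ]) :
    (starExp (star p) * starHermite m n p).ConvergesAt q := by
  rw [starExp_mul_starHermite]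
  exact ConvergesAt.sum fun l _ => (convergesAt_star_power p q _ _).zsmul _

lemma value_star_power {p q : ℍ[ℝ]} (h : Commute q p) (h' : Commute q (star p)) (a b : ℕ) :
    ((varQ - constS p) ^ a * ((varQbar - constS (star p)) ^ b * starExp (star p))).value q =
      (q - p) ^ a * ((star q - star p) ^ b * NormedSpace.exp (q * star p)) := by
  have hs : Commute p (star q) := by simpa using h'.star_star.symm
  have h1 : ((varQbar - constS (star p)) ^ b * starExp (star p)).value q =
      (star q - star p) ^ b * NormedSpace.exp (q * star p) := by
    induction b with
    | zero => simpa using value_starExp h'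
    | succ b ih =>
      have hc := convergesAt_star_power p q 0 b
      rw [pow_zero, one_mul] at hc
      rw [pow_succ', mul_assoc, sub_mul, value_sub hc.varQbar_mul (hc.constS_mul _),
        value_varQbar_mul, value_constS_mul hc h'.symm h.star_star.symm, ih, pow_succ', mul_assoc,
        ← sub_mul]
  induction a with
  | zero => simpa using h1
  | succ a ih =>
    have hc := convergesAt_star_power p q a b
    rw [pow_succ', mul_assoc, sub_mul, value_sub hc.varQ_mul (hc.constS_mul _),
      value_varQ_mul hc, value_constS_mul hc h.symm hs, ih, pow_succ', mul_assoc, ← sub_mul]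

lemma value_starExp_mul_starHermite {I : ℍ[ℝ]} (hI : I * I = -1) (m n : ℕ) (z w : ℂ) :
    (starExp (star (sliceHom I hI w)) * starHermite m n (sliceHom I hI w)).value
      (sliceHom I hI z) =
      sliceHom I hI (Complex.exp (z * star w) * complexHermite m n (z - w)) := by
  have hc : ∀ u v, Commute (sliceHom I hI u) (sliceHom I hI v) := fun u v => by
    rw [Commute, SemiconjBy, ← map_mul, mul_comm, map_mul]
  rw [starExp_mul_starHermite, value_sum fun l _ => (convergesAt_star_power _ _ _ _).zsmul _,
    complexHermite, Finset.mul_sum, map_sum]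
  refine Finset.sum_congr rfl fun l _ => ?_
  rw [value_zsmul (convergesAt_star_power _ _ _ _),
    value_star_power (hc _ _) (by rw [star_sliceHom]; exact hc _ _), mul_smul_comm, map_smul,
    star_sliceHom, star_sliceHom, ← map_mul, exp_sliceHom, ← map_sub, ← map_sub, ← map_pow,
    ← map_pow, ← map_mul, ← map_mul, star_sub]
  push_cast
  congr 2
  ring

/-- The kernel `R_k` is a star product. -/
theorem projKernel_eq_value (k : ℕ) (q p : ℍ[ℝ]) : projKernel (k + 1) q p =
    ((-1 : ℝ) ^ k / (Real.pi * ((k + 1).factorial : ℝ)) * Real.exp (-‖p‖ ^ 2)) •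
      (starExp (star p) * starHermite k (k + 1) p).value q := by
  obtain ⟨I, hI, w, rfl⟩ := exists_slice p
  refine IsSliceFunction.eq_of_eqOn_slice (isSliceFunction_projKernel _ _)
    ((isSliceFunction_value fun q => convergesAt_starExp_mul_starHermite _ _ _ q).const_smul
      ((-1 : ℝ) ^ k / (Real.pi * ((k + 1).factorial : ℝ)) *
        Real.exp (-‖sliceHom I hI w‖ ^ 2))) hI (fun z => ?_) q
  rw [projKernel_sliceHom, value_starExp_mul_starHermite, norm_sliceHom, ← map_smul, ← map_smul]
  congr 1
  simp only [Complex.real_smul]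
  push_cast
  ring

lemma natDegree_starExp_mul_starHermite_le (m n : ℕ) (p : ℍ[ℝ]) :
    (starExp (star p) * starHermite m n p).natDegree ≤ n := by
  refine Polynomial.natDegree_mul_le_of_le (m := 0) (n := n) (Polynomial.natDegree_C _).le ?_ |>.trans
    (zero_add n).le
  refine Polynomial.natDegree_sum_le_of_forall_le _ _ fun l _ => ?_
  refine (Polynomial.natDegree_smul_le _ _).trans ?_
  have h1 : ((varQ - constS p) ^ (m - l)).natDegree ≤ 0 := by
    have : varQ - constS p = Polynomial.C (PowerSeries.X - PowerSeries.C p) := by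
      rw [varQ, constS, Polynomial.C_sub]
    rw [this, ← Polynomial.C_pow, Polynomial.natDegree_C]
  have h2 : ((varQbar - constS (star p)) ^ (n - l)).natDegree ≤ (n - l) * 1 :=
    Polynomial.natDegree_pow_le_of_le _ (Polynomial.natDegree_X_sub_C_le _)
  exact (Polynomial.natDegree_mul_le_of_le h1 h2).trans (by omega)

/-! ### Slice regular functions -/

lemma hasDerivAt_slice_re (v : ℍ[ℝ]) (x : ℝ) :
    HasDerivAt (fun s : ℝ => (s : ℍ[ℝ]) + v) 1 x := by
  have h := ((hasDerivAt_id x).smul_const (1 : ℍ[ℝ])).add_const v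
  rw [one_smul] at h
  refine h.congr_of_eventuallyEq (Filter.Eventually.of_forall fun s => ?_)
  simp [← Algebra.algebraMap_eq_smul_one, ← Quaternion.algebraMap_def]

lemma hasDerivAt_slice_im (v I : ℍ[ℝ]) (y : ℝ) :
    HasDerivAt (fun t : ℝ => v + t • I) I y := by
  have h := ((hasDerivAt_id y).smul_const I).const_add v
  rwa [one_smul] at h

/-- Slice regularity in terms of the real Fréchet derivative. -/
lemma isLeftSliceRegular_iff {f : ℍ[ℝ] → ℍ[ℝ]} : IsLeftSliceRegular f ↔
    Differentiable ℝ f ∧ ∀ (I : ℍ[ℝ]) (hI : I * I = -1) (z : ℂ),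
      fderiv ℝ f (sliceHom I hI z) 1 + I * fderiv ℝ f (sliceHom I hI z) I = 0 := by
  refine and_congr_right fun hf => ?_
  have key : ∀ (I : ℍ[ℝ]) (x y : ℝ),
      (1 / 2 : ℝ) • (deriv (fun s : ℝ => f ((s : ℍ[ℝ]) + y • I)) x +
        I * deriv (fun t : ℝ => f ((x : ℍ[ℝ]) + t • I)) y) = 0 ↔
      fderiv ℝ f ((x : ℍ[ℝ]) + y • I) 1 + I * fderiv ℝ f ((x : ℍ[ℝ]) + y • I) I = 0 := by
    intro I x y
    have h1 := (hf ((x : ℍ[ℝ]) + y • I)).hasFDerivAt.comp_hasDerivAt x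
      (hasDerivAt_slice_re (y • I) x)
    have h2 := (hf ((x : ℍ[ℝ]) + y • I)).hasFDerivAt.comp_hasDerivAt y
      (hasDerivAt_slice_im (x : ℍ[ℝ]) I y)
    have e1 := h1.deriv
    have e2 := h2.deriv
    simp only [Function.comp_def] at e1 e2
    rw [e1, e2, smul_eq_zero_iff_right (by norm_num)]
  constructor
  · intro h I hI z
    rw [sliceHom_apply]
    exact (key I _ _).1 (h I hI _ _)
  · intro h I hI x y
    have := h I hI ⟨x, y⟩
    rw [sliceHom_apply] at this
    exact (key I x y).2 this

/-- The derivative of `q ↦ q ^ n * c`. -/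
def powMulDeriv (n : ℕ) (c q : ℍ[ℝ]) : ℍ[ℝ] →L[ℝ] ℍ[ℝ] :=
  MulOpposite.op c • ∑ i ∈ Finset.range n,
    MulOpposite.op (q ^ i) • q ^ (n.pred - i) • ContinuousLinearMap.id ℝ ℍ[ℝ]

lemma hasFDerivAt_pow_mul (n : ℕ) (c q : ℍ[ℝ]) :
    HasFDerivAt (fun q : ℍ[ℝ] => q ^ n * c) (powMulDeriv n c q) q :=
  (hasFDerivAt_pow' n).mul_const' c

lemma powMulDeriv_apply (n : ℕ) (c q v : ℍ[ℝ]) :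
    powMulDeriv n c q v = ∑ i ∈ Finset.range n, q ^ (n.pred - i) * v * q ^ i * c := by
  simp [powMulDeriv, Finset.sum_mul]

lemma norm_powMulDeriv_le (n : ℕ) (c q : ℍ[ℝ]) :
    ‖powMulDeriv n c q‖ ≤ n * (‖q‖ ^ (n - 1) * ‖c‖) := by
  refine ContinuousLinearMap.opNorm_le_bound _ (by positivity) fun v => ?_
  rw [powMulDeriv_apply]
  refine (norm_sum_le_of_le (f := fun i => q ^ (n.pred - i) * v * q ^ i * c)
    (n := fun _ => ‖q‖ ^ (n - 1) * ‖c‖ * ‖v‖) _ fun i hi => ?_).trans ?_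
  · have hi := Finset.mem_range.1 hi
    rw [norm_mul, norm_mul, norm_mul, norm_pow, norm_pow, ← Nat.sub_one_add_one (by omega : n ≠ 0)]
    have e : n - 1 + 1 - 1 = (n - 1 - i) + i := by omega
    rw [e, pow_add, Nat.pred_succ]
    exact le_of_eq (by ring)
  · simp [mul_assoc]

lemma powMulDeriv_slice {I q : ℍ[ℝ]} (hI : I * I = -1) (h : Commute I q) (n : ℕ) (c : ℍ[ℝ]) :
    powMulDeriv n c q 1 + I * powMulDeriv n c q I = 0 := by
  rw [powMulDeriv_apply, powMulDeriv_apply, Finset.mul_sum, ← Finset.sum_add_distrib]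
  refine Finset.sum_eq_zero fun i _ => ?_
  have e : I * (q ^ (n.pred - i) * I) = -q ^ (n.pred - i) := by
    rw [← mul_assoc, (h.pow_right _).eq, mul_assoc, hI, mul_neg_one]
  rw [← mul_assoc, ← mul_assoc, e]
  simp

/-- Termwise differentiation of a series on a ball. -/
lemma exists_hasFDerivAt_tsum {E F : Type*} [NormedAddCommGroup E] [NormedSpace ℝ E]
    [NormedAddCommGroup F] [NormedSpace ℝ F] [CompleteSpace F] {f : ℕ → E → F}
    {f' : ℕ → E → E →L[ℝ] F} {u : ℕ → ℝ} {r : ℝ} {x : E} (hu : Summable u)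
    (hf : ∀ n x, HasFDerivAt (f n) (f' n x) x)
    (hb : ∀ n, ∀ y ∈ Metric.ball (0 : E) r, ‖f' n y‖ ≤ u n) (hx : x ∈ Metric.ball (0 : E) r)
    (hs : Summable fun n => f n x) : ∃ D : E →L[ℝ] F,
      HasFDerivAt (fun y => ∑' n, f n y) D x ∧ ∀ v, HasSum (fun n => f' n x v) (D v) :=
  ⟨∑' n, f' n x, hasFDerivAt_tsum_of_isPreconnected hu Metric.isOpen_ball
    (convex_ball _ _).isPreconnected (fun n x _ => hf n x) hb hx hs hx, fun v =>
    (Summable.of_norm_bounded hu fun n => hb n x hx).hasSum.mapL (ContinuousLinearMap.apply ℝ F v)⟩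

/-- Sums of everywhere convergent power series are slice regular. -/
lemma isLeftSliceRegular_tsum {c : ℕ → ℍ[ℝ]} (hc : ∀ q : ℍ[ℝ], Summable fun n => q ^ n * c n) :
    IsLeftSliceRegular fun q => ∑' n, q ^ n * c n := by
  have key : ∀ q : ℍ[ℝ], ∃ D : ℍ[ℝ] →L[ℝ] ℍ[ℝ],
      HasFDerivAt (fun q : ℍ[ℝ] => ∑' n, q ^ n * c n) D q ∧
      ∀ v, HasSum (fun n => powMulDeriv n (c n) q v) (D v) := by
    intro q
    obtain ⟨r, hr⟩ : ∃ r, r = ‖q‖ + 1 := ⟨_, rfl⟩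
    have hr1 : 1 ≤ r := by rw [hr]; linarith [norm_nonneg q]
    have hu : Summable fun n : ℕ => (n : ℝ) * (r ^ (n - 1) * ‖c n‖) := by
      refine (hc ((2 * r : ℝ) : ℍ[ℝ])).norm.of_nonneg_of_le (fun n => by positivity) fun n => ?_
      rw [norm_mul, norm_pow, Quaternion.norm_coe, Real.norm_of_nonneg (by positivity), mul_pow,
        mul_assoc]
      have h1 : (n : ℝ) ≤ 2 ^ n := by exact_mod_cast Nat.lt_two_pow_self.le
      have h2 : r ^ (n - 1) ≤ r ^ n := pow_le_pow_right₀ hr1 (Nat.sub_le n 1)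
      gcongr
    refine exists_hasFDerivAt_tsum (r := r) hu (fun n x => hasFDerivAt_pow_mul n (c n) x)
      (fun n x hx => ?_) (by rw [mem_ball_zero_iff, hr]; linarith) (hc q)
    rw [mem_ball_zero_iff] at hx
    refine (norm_powMulDeriv_le n (c n) x).trans ?_
    gcongr
  refine isLeftSliceRegular_iff.2 ⟨fun q => ?_, fun I hI z => ?_⟩
  · obtain ⟨D, hD, -⟩ := key q
    exact hD.differentiableAt
  · have hcomm : Commute I (sliceHom I hI z) := by
      have : sliceHom I hI Complex.I = I := by simp [sliceHom_apply]
      nth_rewrite 1 [← this]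
      rw [Commute, SemiconjBy, ← map_mul, mul_comm, map_mul]
    obtain ⟨D, hD, hs⟩ := key (sliceHom I hI z)
    rw [hD.fderiv]
    refine ((hs 1).add ((hs I).mul_left I)).unique ?_
    simp only [powMulDeriv_slice hI hcomm]
    exact hasSum_zero

lemma IsLeftSliceRegular.const_smul {f : ℍ[ℝ] → ℍ[ℝ]} (hf : IsLeftSliceRegular f) (c : ℝ) :
    IsLeftSliceRegular fun q => c • f q := by
  rw [isLeftSliceRegular_iff] at hf ⊢
  refine ⟨hf.1.const_smul c, fun I hI z => ?_⟩
  rw [fderiv_fun_const_smul (hf.1 _)]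
  simp only [smul_apply, mul_smul_comm, ← smul_add, hf.2 I hI z, smul_zero]

lemma IsLeftSliceRegular.sub {f g : ℍ[ℝ] → ℍ[ℝ]} (hf : IsLeftSliceRegular f)
    (hg : IsLeftSliceRegular g) : IsLeftSliceRegular fun q => f q - g q := by
  rw [isLeftSliceRegular_iff] at hf hg ⊢
  refine ⟨hf.1.sub hg.1, fun I hI z => ?_⟩
  rw [fderiv_fun_sub (hf.1 _) (hg.1 _), sub_apply,
    sub_apply, mul_sub, sub_add_sub_comm, hf.2 I hI z, hg.2 I hI z, sub_zero]

lemma isLeftSlicePolyregular_value {F : SliceSeries} {n : ℕ} (hn : F.natDegree < n)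
    (hF : ∀ q, F.ConvergesAt q) : IsLeftSlicePolyregular n F.value := by
  refine ⟨fun j q => ∑' m, q ^ m * PowerSeries.coeff m (Polynomial.coeff F j),
    fun j => isLeftSliceRegular_tsum fun q => hF q j, fun q => ?_⟩
  rw [SliceSeries.value_eq_sum (Polynomial.supp_subset_range hn), Finset.sum_range]

lemma IsLeftSlicePolyregular.const_smul {f : ℍ[ℝ] → ℍ[ℝ]} {n : ℕ}
    (hf : IsLeftSlicePolyregular n f) (c : ℝ) : IsLeftSlicePolyregular n fun q => c • f q := by
  obtain ⟨F, hF, h⟩ := hf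
  exact ⟨fun j q => c • F j q, fun j => (hF j).const_smul c, fun q => by
    simp only [h q, Finset.smul_sum, mul_smul_comm]⟩

lemma IsLeftSlicePolyregular.sub {f g : ℍ[ℝ] → ℍ[ℝ]} {n : ℕ} (hf : IsLeftSlicePolyregular n f)
    (hg : IsLeftSlicePolyregular n g) : IsLeftSlicePolyregular n fun q => f q - g q := by
  obtain ⟨F, hF, h⟩ := hf
  obtain ⟨G, hG, h'⟩ := hg
  exact ⟨fun j q => F j q - G j q, fun j => (hF j).sub (hG j), fun q => by
    simp only [h q, h' q, mul_sub, Finset.sum_sub_distrib]⟩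

/-! ### Uniqueness -/

lemma entire_eq_zero_of_line {h : ℂ → ℂ} (hh : Differentiable ℂ h) {a u : ℂ} (hu : u ≠ 0)
    (h0 : ∀ t : ℝ, h (a + t * u) = 0) (z : ℂ) : h z = 0 := by
  have han : AnalyticOnNhd ℂ h Set.univ := fun x _ => hh.analyticAt x
  have ht : Filter.Tendsto (fun t : ℝ => a + t * u) (nhdsWithin 0 {0}ᶜ) (nhdsWithin a {a}ᶜ) := by
    refine tendsto_nhdsWithin_iff.2 ⟨?_, ?_⟩
    · have hc : Continuous fun t : ℝ => a + t * u := by fun_prop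
      simpa using (hc.tendsto 0).mono_left nhdsWithin_le_nhds
    · filter_upwards [self_mem_nhdsWithin] with t ht
      simpa [hu] using ht
  have hf : ∃ᶠ x in nhdsWithin a {a}ᶜ, h x = 0 :=
    ht.frequently (Filter.Eventually.of_forall h0).frequently
  exact han.eqOn_zero_of_preconnected_of_frequently_eq_zero isPreconnected_univ (Set.mem_univ a) hf
    (Set.mem_univ z)

/-- The holomorphic components of a polyanalytic function are unique. -/
lemma polyanalytic_components_eq_zero {n : ℕ} {G : Fin n → ℂ → ℂ}
    (hG : ∀ j, Differentiable ℂ (G j)) (h : ∀ z, ∑ j : Fin n, star z ^ (j : ℕ) * G j z = 0) (j : Fin n)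
    (z : ℂ) : G j z = 0 := by
  have h1 : ∀ c : ℝ, ∑ j : Fin n, (c - z) ^ (j : ℕ) * G j z = 0 := fun c => by
    refine entire_eq_zero_of_line (h := fun z => ∑ j : Fin n, (c - z) ^ (j : ℕ) * G j z)
      (a := (c / 2 : ℝ)) (by fun_prop) Complex.I_ne_zero (fun t => ?_) z
    rw [← h ((c / 2 : ℝ) + t * Complex.I)]
    refine Finset.sum_congr rfl fun j _ => ?_
    congr 2
    apply Complex.ext <;> simp
    ring
  have h2 : (∑ j : Fin n, Polynomial.monomial (j : ℕ) (G j z)) = 0 := by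
    refine Polynomial.eq_zero_of_infinite_isRoot _ (Set.Infinite.mono ?_
      (Set.infinite_range_of_injective (f := fun c : ℝ => (c : ℂ) - z) fun a b hab => by
        simpa using hab))
    rintro _ ⟨c, rfl⟩
    rw [Set.mem_ofPred_eq, Polynomial.IsRoot, Polynomial.eval_finsetSum, ← h1 c]
    simp only [Polynomial.eval_monomial, mul_comm]
  have h3 := congrArg (fun p => Polynomial.coeff p j) h2
  simpa [Polynomial.finsetSum_coeff, Polynomial.coeff_monomial, Fin.val_inj] using h3

/-- The `ℂ_J`-linear projection of `ℍ` onto `ℂ_J ≅ ℂ`. -/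
def sliceCoord (J : ℍ[ℝ]) : ℍ[ℝ] →L[ℝ] ℂ :=
  LinearMap.toContinuousLinearMap
    { toFun := fun q => ⟨q.re, -(J * q).re⟩
      map_add' := fun p q => by apply Complex.ext <;> simp [mul_add]; ring
      map_smul' := fun c q => by apply Complex.ext <;> simp; ring }

lemma sliceCoord_apply (J q : ℍ[ℝ]) : sliceCoord J q = ⟨q.re, -(J * q).re⟩ := rfl

lemma sliceCoord_unit_mul {J : ℍ[ℝ]} (hJ : J * J = -1) (q : ℍ[ℝ]) :
    sliceCoord J (J * q) = Complex.I * sliceCoord J q := by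
  rw [sliceCoord_apply, sliceCoord_apply, ← mul_assoc, hJ]
  apply Complex.ext <;> simp

lemma sliceCoord_sliceHom_mul {J : ℍ[ℝ]} (hJ : J * J = -1) (z : ℂ) (q : ℍ[ℝ]) :
    sliceCoord J (sliceHom J hJ z * q) = z * sliceCoord J q := by
  rw [sliceHom_apply, add_mul, map_add, Quaternion.coe_mul_eq_smul, smul_mul_assoc, map_smul,
    map_smul, sliceCoord_unit_mul hJ, Complex.real_smul, Complex.real_smul, ← mul_assoc, ← add_mul,
    Complex.re_add_im]

lemma eq_zero_of_sliceCoord {J q : ℍ[ℝ]} (h : ∀ c, sliceCoord J (q * c) = 0) : q = 0 := by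
  have h1 := congrArg Complex.re (h (star q))
  rw [sliceCoord_apply, Quaternion.self_mul_star] at h1
  exact Quaternion.normSq_eq_zero.1 (by simpa using h1)

lemma differentiable_sliceCoord {f : ℍ[ℝ] → ℍ[ℝ]} (hf : IsLeftSliceRegular f) {J : ℍ[ℝ]}
    (hJ : J * J = -1) (c : ℍ[ℝ]) :
    Differentiable ℂ fun z => sliceCoord J (f (sliceHom J hJ z) * c) := by
  rw [isLeftSliceRegular_iff] at hf
  intro z
  have h1 : HasFDerivAt (fun z => sliceCoord J (f (sliceHom J hJ z) * c))
      ((sliceCoord J).comp (MulOpposite.op c • (fderiv ℝ f (sliceHom J hJ z)).comp (sliceCLM J hJ))) z :=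
    (sliceCoord J).hasFDerivAt.comp z
      (((hf.1 _).hasFDerivAt.comp z (sliceCLM J hJ).hasFDerivAt).mul_const' c)
  refine differentiableAt_complex_iff_differentiableAt_real.2 ⟨h1.differentiableAt, ?_⟩
  rw [h1.fderiv]
  have e : fderiv ℝ f (sliceHom J hJ z) J = J * fderiv ℝ f (sliceHom J hJ z) 1 := by
    have := congrArg (fun q => J * q) (hf.2 J hJ z)
    simp only [mul_add, ← mul_assoc, hJ, mul_zero, neg_one_mul] at this
    exact (add_neg_eq_zero.1 this).symm
  have eI : sliceHom J hJ Complex.I = J := by simp [sliceHom_apply]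
  simp [eI, e, mul_assoc, sliceCoord_unit_mul hJ]

/-- Slice polyregular functions that vanish on one slice vanish. -/
lemma IsLeftSlicePolyregular.eq_zero {f : ℍ[ℝ] → ℍ[ℝ]} {n : ℕ} (hf : IsLeftSlicePolyregular n f)
    {I : ℍ[ℝ]} (hI : I * I = -1) (h : ∀ z, f (sliceHom I hI z) = 0) (q : ℍ[ℝ]) : f q = 0 := by
  obtain ⟨F, hF, hfF⟩ := hf
  have h1 : ∀ j z, F j (sliceHom I hI z) = 0 := fun j z => by
    refine eq_zero_of_sliceCoord (J := I) fun c => ?_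
    refine polyanalytic_components_eq_zero
      (G := fun j z => sliceCoord I (F j (sliceHom I hI z) * c))
      (fun j => differentiable_sliceCoord (hF j) hI c) (fun z => ?_) j z
    have h2 := h z
    rw [hfF] at h2
    have h3 := congrArg (fun q => sliceCoord I (q * c)) h2
    simpa only [star_sliceHom, Finset.sum_mul, map_sum, ← map_pow, mul_assoc,
      sliceCoord_sliceHom_mul, zero_mul, map_zero] using h3
  obtain ⟨J, hJ, z, rfl⟩ := exists_slice q
  rw [hfF]
  refine Finset.sum_eq_zero fun j _ => ?_
  suffices F j (sliceHom J hJ z) = 0 by rw [this, mul_zero]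
  refine eq_zero_of_sliceCoord (J := J) fun c => ?_
  refine entire_eq_zero_of_line (differentiable_sliceCoord (hF j) hJ c) (a := 0) one_ne_zero
    (fun t => ?_) z
  rw [zero_add, mul_one, sliceHom_ofReal, ← sliceHom_ofReal hI, h1, zero_mul, map_zero]

lemma isLeftSlicePolyregular_projKernel (k : ℕ) (p : ℍ[ℝ]) :
    IsLeftSlicePolyregular (k + 2) fun q => Real.exp (‖p‖ ^ 2) • projKernel (k + 1) q p := by
  simp only [projKernel_eq_value]
  exact ((isLeftSlicePolyregular_value
    (Nat.lt_succ_of_le (natDegree_starExp_mul_starHermite_le k (k + 1) p))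
    fun q => convergesAt_starExp_mul_starHermite _ _ _ q).const_smul _).const_smul _

end

end SliceCauchy

theorem mainTheorem6 (k : ℕ) :
    -- the series of the two kernels converge
    (∀ q p : ℍ[ℝ], Summable (bargmannKernelTerm k q p) ∧ Summable (projKernelTerm k q p)) ∧
    -- `P_k C` maps `L²` into the Bargmann space and is the integral operator with kernel `R_k`
    (∀ f : ℍ[ℝ] → ℍ[ℝ], MemLp f 2 gaussMeasure →
      (∀ᵐ q ∂gaussMeasure, Integrable (fun p => cauchyKernel q p * f p) gaussMeasure) ∧
      MemLp (cauchyTransform f) 2 gaussMeasure ∧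
      bergmanProj k (cauchyTransform f) ∈ bargmannSpace k ∧
      (∀ h ∈ bargmannSpace k, MemLp h 2 gaussMeasure ∧
        ∫ q, star (h q) * (cauchyTransform f q - bergmanProj k (cauchyTransform f) q)
          ∂gaussMeasure = 0) ∧
      ∀ q : ℍ[ℝ],
        Integrable (fun p => star (bargmannKernel k p q) * cauchyTransform f p) gaussMeasure ∧
        Integrable (fun p => projKernel k q p * f p) gaussMeasure ∧
        bergmanProj k (cauchyTransform f) q = ∫ p, projKernel k q p * f p ∂gaussMeasure) ∧
    -- for `k ≥ 1` the kernel has a closed form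
    (1 ≤ k → ∀ p : ℍ[ℝ],
      (∀ q : ℍ[ℝ],
        SliceSeries.ConvergesAt (starExp (star p) * starHermite (k - 1) k p) q ∧
        projKernel k q p =
          ((-1 : ℝ) ^ (k - 1) / (Real.pi * (k.factorial : ℝ)) * Real.exp (-‖p‖ ^ 2)) •
            SliceSeries.value (starExp (star p) * starHermite (k - 1) k p) q) ∧
      -- which is the unique slice polyregular extension of the complex closed form
      ∀ I : ℍ[ℝ], I * I = -1 → p ∈ slicePlane I → ∀ g : ℍ[ℝ] → ℍ[ℝ],
        ((IsLeftSlicePolyregular (k + 1) g ∧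
            ∀ q ∈ slicePlane I, g q = sliceClosedForm k p q) ↔
          g = fun q => Real.exp (‖p‖ ^ 2) • projKernel k q p)) := by
  refine ⟨fun q p => ⟨summable_bargmannKernelTerm k q p, summable_projKernelTerm k q p⟩,
    fun f hf => ?_, fun hk p => ?_⟩
  · have hg := memLp_cauchyTransform hf
    exact ⟨ae_integrable_cauchyKernel_mul hf, hg, bergmanProj_mem_bargmannSpace hg k,
      fun h hh => bergmanProj_orthogonal hg hh, fun q => ⟨(bergmanProj_expansion hg k q).1,
      (projKernel_expansion hf k q).1, bergmanProj_cauchyTransform_eq hf k q⟩⟩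
  · obtain ⟨k, rfl⟩ : ∃ k', k = k' + 1 := ⟨k - 1, by omega⟩
    rw [Nat.add_sub_cancel]
    refine ⟨fun q => ⟨convergesAt_starExp_mul_starHermite _ _ _ q, projKernel_eq_value k q p⟩,
      fun I hI hp g => ?_⟩
    obtain ⟨w, rfl⟩ := (mem_slicePlane_iff hI p).1 hp
    have hK := isLeftSlicePolyregular_projKernel k (sliceHom I hI w)
    have hcl : ∀ z, Real.exp (‖sliceHom I hI w‖ ^ 2) •
        projKernel (k + 1) (sliceHom I hI z) (sliceHom I hI w) =
        sliceClosedForm (k + 1) (sliceHom I hI w) (sliceHom I hI z) := fun z => by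
      rw [norm_sliceHom, sliceClosedForm_sliceHom]
    constructor
    · rintro ⟨hg, hgI⟩
      funext q
      refine sub_eq_zero.1 ((hg.sub hK).eq_zero hI (fun z => ?_) q)
      rw [hcl, hgI _ ((mem_slicePlane_iff hI _).2 ⟨z, rfl⟩), sub_self]
    · rintro rfl
      refine ⟨hK, fun q hq => ?_⟩
      obtain ⟨z, rfl⟩ := (mem_slicePlane_iff hI q).1 hq
      exact hcl z
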